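/- Let $\varepsilon,\mu:\mathbf R\to(0,\infty)$ be piecewise continuous and $1$-periodic with $\varepsilon(-x)=\varepsilon(x)$, $\mu(-x)=\mu(x)$, and let $\mathcal L\psi=-\frac1\varepsilon\big(\frac1\mu\psi'\big)'$ (solutions $\psi$ and their fluxes $\frac1\mu\psi'$ are continuous). For $k\in\mathbf R$ let $E_1(k)\le E_2(k)\le\cdots$ be the eigenvalues, counted with multiplicity, of $\mathcal L\psi=E\psi$, $\psi(x+1)=e^{ik}\psi(x)$; the solutions $\psi$ are the Bloch modes at $(k,E)$. Write $(u,v)_X=\int_0^1\varepsilon u\bar v\,dx$ and $\|u\|_X=(u,u)_X^{1/2}$. A Dirac point at which bands $j,j+1$ cross is a pair $(k^*,E^*)$ with $E_j(k^*)=E_{j+1}(k^*)=E^*$, with a two-dimensional space of Bloch modes, and such that for some $\alpha>0$, $E_j(k)=E^*-\alpha|k-k^*|+O((k-k^*)^2)$ and $E_{j+1}(k)=E^*+\alpha|k-k^*|+O((k-k^*)^2)$ for $k$ near $k^*$. Bloch modes of band $j$: let $\psi_{E,1},\psi_{E,2}$ solve $\mathcal L\psi=E\psi$ with $(\psi,\frac1\mu\psi')(0)=(1,0)$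 and $(0,1)$ respectively. For $0\le k\le\pi$ and $E=E_j(k)$ put $\phi_{j,k}=\psi_{E,2}(1)\,\psi_{E,1}+(e^{ik}-\psi_{E,1}(1))\,\psi_{E,2}$ and $\varphi_{j,k}=\phi_{j,k}/\|\phi_{j,k}\|_X$. If $\phi_{j,k}\equiv0$ (possible only for $k\in\{0,\pi\}$), put $\varphi_{j,k}=i\psi_{E,2}/\|\psi_{E,2}\|_X$ when the multiplicity at $(k,E)$ is one, and let $\varphi_{j,k}$ be the limit of $\varphi_{j,k'}$ as $k'\to k$, $k'\in(0,\pi)$, when it is two. For $-\pi<k<0$ put $\varphi_{j,k}(x)=\varphi_{j,-k}(-x)$. Let $u_{j,k}(x)=e^{-ikx}\varphi_{j,k}(x)$, $\varphi_{j,0^-}=\lim_{k\to0^-}\varphi_{j,k}$, $\varphi_{j,(-\pi)^+}=\lim_{k\to(-\pi)^+}\varphi_{j,k}$. The Zak phase of band $j$ is $$\theta_j=i\int_{-\pi}^0\Big(\frac{\partial u_{j,k}}{\partial k},u_{j,k}\Big)_X dk+i\int_0^{\pi}\Big(\frac{\partial u_{j,k}}{\partial k},u_{j,k}\Big)_X dk-\operatorname{Im}\ln(\varphi_{j,0},\varphi_{j,0^-})_X-\operatorname{Im}\ln(\varphi_{j,(-\pi)^+},\varphi_{j,\pi})_X\mod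 2\pi,$$ with the convention $\operatorname{Im}\ln 0=0$, i.e. a vanishing overlap (which occurs at a Dirac point) contributes no phase. Theorem. Let $j\ge1$ and suppose that bands $j$ and $j+1$ cross no other band, i.e. $E_m(k)\notin\{E_j(k),E_{j+1}(k)\}$ for all $m\ge 1$, $m\ne j,j+1$, and all $k\in[-\pi,\pi]$. If bands $j$ and $j+1$ cross at a Dirac point $(0,E^*)$, then $\theta_j$ and $\theta_{j+1}$ are well defined (the derivatives, integrals and limits above exist, the limits uniformly on $[0,1]$, and $\varphi_{j,k},\varphi_{j+1,k}$ are continuous from inside at the end points of $[0,\pi]$), $\varphi_{j,\pi}$ and $\varphi_{j+1,\pi}$ each are even or odd, and modulo $2\pi$ $$\theta_j+\theta_{j+1}=\begin{cases}0,&\text{if }\varphi_{j,\pi},\varphi_{j+1,\pi}\text{ have the same parity},\\ \pi,&\text{if they have different parities.}\end{cases}$$ If bands $j$ and $j+1$ cross at a Dirac point $(\pi,E^*)$, the same holds with $\varphi_{j,0},\varphi_{j+1,0}$ in place of $\varphi_{j,\pi},\varphi_{j+1,\pi}$. -/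

import Mathlib

open Set Filter Topology

/-- Piecewise continuity of a `1`-periodic function: only finitely many points of discontinuity in
a period, and finite one-sided limits everywhere. -/
def PiecewiseContinuous (f : ℝ → ℝ) : Prop :=
  {x ∈ Icc (0 : ℝ) 1 | ¬ ContinuousAt f x}.Finite ∧
  ∀ x, (∃ l, Tendsto f (𝓝[<] x) (𝓝 l)) ∧ ∃ r, Tendsto f (𝓝[>] x) (𝓝 r)

/-- The coefficients of the periodic operator `L ψ = -(1/ε) d/dx ((1/μ) dψ/dx)`. -/
structure PhotonicMedium where
  /-- permittivity -/
  ε : ℝ → ℝ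
  /-- permeability -/
  μ : ℝ → ℝ
  ε_pos : ∀ x, 0 < ε x
  μ_pos : ∀ x, 0 < μ x
  ε_periodic : Function.Periodic ε 1
  μ_periodic : Function.Periodic μ 1
  ε_piecewise : PiecewiseContinuous ε
  μ_piecewise : PiecewiseContinuous μ

noncomputable section

namespace PhotonicMedium

/-- Inversion symmetry. -/
def InversionSymmetric (M : PhotonicMedium) : Prop :=
  (∀ x, M.ε (-x) = M.ε x) ∧ ∀ x, M.μ (-x) = M.μ x

/-- `L ψ = E ψ` on the line, where `q = (1/μ) ψ'` is the flux of `ψ`: both `ψ` and `q` are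
continuous, `ψ' = μ q` at every point of continuity of `μ`, and `-(1/ε) q' = E ψ` at every point of
continuity of `ε`. -/
structure IsSolution (M : PhotonicMedium) (E : ℝ) (ψ q : ℝ → ℂ) : Prop where
  continuous_mode : Continuous ψ
  continuous_flux : Continuous q
  deriv_mode : ∀ x, ContinuousAt M.μ x → HasDerivAt ψ ((M.μ x : ℂ) * q x) x
  deriv_flux : ∀ x, ContinuousAt M.ε x → HasDerivAt q (-((E : ℂ) * (M.ε x : ℂ) * ψ x)) x

/-- The space of Bloch modes at `(k, E)`: the solutions of `L ψ = E ψ`, `ψ (x + 1) = e^{ik} ψ x`. -/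
def blochSpace (M : PhotonicMedium) (k E : ℝ) : Submodule ℂ (ℝ → ℂ) where
  carrier := {ψ | (∃ q, M.IsSolution E ψ q) ∧
    ∀ x, ψ (x + 1) = Complex.exp (Complex.I * (k : ℂ)) * ψ x}
  zero_mem' := by
    refine ⟨⟨0, continuous_const, continuous_const, fun x _ => ?_, fun x _ => ?_⟩, fun x => ?_⟩
    · exact (hasDerivAt_const x (0 : ℂ)).congr_deriv (by simp)
    · exact (hasDerivAt_const x (0 : ℂ)).congr_deriv (by simp)
    · simp
  add_mem' := by
    rintro f g ⟨⟨p, hp⟩, hf⟩ ⟨⟨q, hq⟩, hg⟩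
    refine ⟨⟨p + q, hp.continuous_mode.add hq.continuous_mode,
      hp.continuous_flux.add hq.continuous_flux, fun x hx => ?_, fun x hx => ?_⟩, fun x => ?_⟩
    · refine ((hp.deriv_mode x hx).add (hq.deriv_mode x hx)).congr_deriv ?_
      simp only [Pi.add_apply]; ring
    · refine ((hp.deriv_flux x hx).add (hq.deriv_flux x hx)).congr_deriv ?_
      simp only [Pi.add_apply]; ring
    · simp only [Pi.add_apply, hf x, hg x]; ring
  smul_mem' := by
    rintro c f ⟨⟨p, hp⟩, hf⟩
    refine ⟨⟨c • p, hp.continuous_mode.const_smul c, hp.continuous_flux.const_smul c,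
      fun x hx => ?_, fun x hx => ?_⟩, fun x => ?_⟩
    · refine ((hp.deriv_mode x hx).const_smul c).congr_deriv ?_
      simp only [Pi.smul_apply, smul_eq_mul]; ring
    · refine ((hp.deriv_flux x hx).const_smul c).congr_deriv ?_
      simp only [Pi.smul_apply, smul_eq_mul]; ring
    · simp only [Pi.smul_apply, smul_eq_mul, hf x]; ring

/-- The dispersion relation `E_j(k)`, `j = 1, 2, …`: the `j`-th eigenvalue at wavenumber `k`, in
increasing order and counted with multiplicity, i.e. the least `E` such that the eigenvalues not
exceeding `E` have total multiplicity at least `j`. -/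
def band (M : PhotonicMedium) (j : ℕ) (k : ℝ) : ℝ :=
  sInf {E : ℝ | ∃ s : Finset ℝ, (∀ l ∈ s, l ≤ E) ∧
    j ≤ ∑ l ∈ s, Module.finrank ℂ (M.blochSpace k l)}

/-- `(k₀, E₀)` is a Dirac point at which the bands `j` and `j + 1` cross. -/
def IsDiracPoint (M : PhotonicMedium) (j : ℕ) (k₀ E₀ : ℝ) : Prop :=
  M.band j k₀ = E₀ ∧ M.band (j + 1) k₀ = E₀ ∧
  (∃ α > 0, ∃ δ > 0, ∃ C : ℝ, ∀ k, |k - k₀| < δ →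
    |M.band j k - (E₀ - α * |k - k₀|)| ≤ C * (k - k₀) ^ 2 ∧
    |M.band (j + 1) k - (E₀ + α * |k - k₀|)| ≤ C * (k - k₀) ^ 2) ∧
  Module.finrank ℂ (M.blochSpace k₀ E₀) = 2

/-- The solution `(ψ, (1/μ) ψ')` of `L ψ = E ψ` with initial values `ψ 0 = a` and
`((1/μ) ψ') 0 = b`; by linearity of the equation there is exactly one. -/
def solution (M : PhotonicMedium) (E : ℝ) (a b : ℂ) : (ℝ → ℂ) × (ℝ → ℂ) :=
  Classical.epsilon fun p => M.IsSolution E p.1 p.2 ∧ p.1 0 = a ∧ p.2 0 = b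

/-- The fundamental solution `ψ_{E,1}`. -/
def psi₁ (M : PhotonicMedium) (E : ℝ) : ℝ → ℂ := (M.solution E 1 0).1

/-- The fundamental solution `ψ_{E,2}`. -/
def psi₂ (M : PhotonicMedium) (E : ℝ) : ℝ → ℂ := (M.solution E 0 1).1

/-- The inner product `(u, v)_X = ∫₀¹ ε u v̄`. -/
def cellInner (M : PhotonicMedium) (u v : ℝ → ℂ) : ℂ :=
  ∫ x in (0 : ℝ)..1, (M.ε x : ℂ) * u x * (starRingEnd ℂ) (v x)

/-- The norm of `X`. -/
def cellNorm (M : PhotonicMedium) (u : ℝ → ℂ) : ℝ := √(M.cellInner u u).re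

/-- The normalization `u / ‖u‖_X`. -/
def normalize (M : PhotonicMedium) (u : ℝ → ℂ) : ℝ → ℂ := fun x => u x / (M.cellNorm u : ℂ)

/-- The (not normalized) Bloch mode
`φ_{j,k} = ψ_{E,2}(1) ψ_{E,1} + (e^{ik} - ψ_{E,1}(1)) ψ_{E,2}`, `E = E_j(k)`, `0 ≤ k ≤ π`. -/
def rawMode (M : PhotonicMedium) (j : ℕ) (k : ℝ) : ℝ → ℂ := fun x =>
  M.psi₂ (M.band j k) 1 * M.psi₁ (M.band j k) x +
    (Complex.exp (Complex.I * (k : ℂ)) - M.psi₁ (M.band j k) 1) * M.psi₂ (M.band j k) x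

open Classical in
/-- The normalized Bloch mode for `0 ≤ k ≤ π`. Where `φ_{j,k}` vanishes identically (only possible
at `k = 0, π`) it is `i ψ_{E,2} / ‖ψ_{E,2}‖` if the multiplicity is one, and the limit of the Bloch
modes of the band from the interior of `[0, π]` at a Dirac point. -/
def halfMode (M : PhotonicMedium) (j : ℕ) (k : ℝ) : ℝ → ℂ :=
  if M.rawMode j k ≠ 0 then M.normalize (M.rawMode j k)
  else if Module.finrank ℂ (M.blochSpace k (M.band j k)) = 2 then
    fun x => limUnder (𝓝[Ioo 0 Real.pi] k) fun k' => M.normalize (M.rawMode j k') x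
  else fun x => Complex.I * M.normalize (M.psi₂ (M.band j k)) x

/-- The Bloch modes `φ_{j,k}` of the `j`-th band, `-π < k ≤ π`, under inversion symmetry:
`φ_{j,k}(x) = φ_{j,-k}(-x)` for `k < 0`. -/
def blochMode (M : PhotonicMedium) (j : ℕ) (k : ℝ) : ℝ → ℂ :=
  if 0 ≤ k then M.halfMode j k else fun x => M.halfMode j (-k) (-x)

/-- The periodic part `u_{j,k}(x) = e^{-ikx} φ_{j,k}(x)`. -/
def periodicPart (M : PhotonicMedium) (j : ℕ) (k x : ℝ) : ℂ :=
  Complex.exp (-(Complex.I * (k : ℂ) * (x : ℂ))) * M.blochMode j k x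

/-- The integrand `(∂u_{j,k}/∂k, u_{j,k})_X` of the Zak phase. -/
def berryConnection (M : PhotonicMedium) (j : ℕ) (k : ℝ) : ℂ :=
  M.cellInner (fun x => deriv (fun k' => M.periodicPart j k' x) k) (M.periodicPart j k)

/-- The Zak phase of the `j`-th band is well defined and equal to `θ` modulo `2π`:
the periodic parts are differentiable in `k` on `(-π, 0)` and `(0, π)`, the Bloch modes are
continuous on `[0, π]` and have limits `φ_{j,0⁻}` at `0⁻` and `φ_{j,(-π)⁺}` at `(-π)⁺`, and
`θ = i ∫_{-π}^0 (∂u/∂k, u)_X dk + i ∫_0^π (∂u/∂k, u)_X dk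
      - Im ln (φ_{j,0}, φ_{j,0⁻})_X - Im ln (φ_{j,(-π)⁺}, φ_{j,π})_X   mod 2π`.
Here `Im ln z = Complex.arg z`, with `Complex.arg 0 = 0`: a vanishing overlap (which occurs at a
Dirac point) contributes no phase. -/
def HasZakPhase (M : PhotonicMedium) (j : ℕ) (θ : Real.Angle) : Prop :=
  ∃ (φ₀ φpi : ℝ → ℂ) (t : ℝ),
    (∀ k ∈ Ioo (-Real.pi) 0 ∪ Ioo 0 Real.pi,
      (∀ x, DifferentiableAt ℝ (fun k' => M.periodicPart j k' x) k) ∧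
      IntervalIntegrable (fun x => (M.ε x : ℂ) * deriv (fun k' => M.periodicPart j k' x) k *
        (starRingEnd ℂ) (M.periodicPart j k x)) MeasureTheory.volume 0 1) ∧
    IntervalIntegrable (M.berryConnection j) MeasureTheory.volume (-Real.pi) 0 ∧
    IntervalIntegrable (M.berryConnection j) MeasureTheory.volume 0 Real.pi ∧
    TendstoUniformlyOn (M.blochMode j) (M.blochMode j 0) (𝓝[>] 0) (Icc 0 1) ∧
    TendstoUniformlyOn (M.blochMode j) (M.blochMode j Real.pi) (𝓝[<] Real.pi) (Icc 0 1) ∧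
    TendstoUniformlyOn (M.blochMode j) φ₀ (𝓝[<] 0) (Icc 0 1) ∧
    TendstoUniformlyOn (M.blochMode j) φpi (𝓝[>] (-Real.pi)) (Icc 0 1) ∧
    (t : ℂ) = Complex.I * (∫ k in (-Real.pi)..0, M.berryConnection j k) +
      Complex.I * (∫ k in (0 : ℝ)..Real.pi, M.berryConnection j k) -
      ((M.cellInner (M.blochMode j 0) φ₀).arg : ℂ) -
      ((M.cellInner φpi (M.blochMode j Real.pi)).arg : ℂ) ∧
    θ = (t : Real.Angle)

end PhotonicMedium

/-- Both functions are even or both are odd. -/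
def SameParity (f g : ℝ → ℂ) : Prop :=
  (Function.Even f ∧ Function.Even g) ∨ (Function.Odd f ∧ Function.Odd g)

/-- One function is even and the other one is odd. -/
def DifferentParity (f g : ℝ → ℂ) : Prop :=
  (Function.Even f ∧ Function.Odd g) ∨ (Function.Odd f ∧ Function.Even g)

end

/-! Inversion symmetry makes `ψ_{E,1}` even and `ψ_{E,2}` odd. Since `e^{ik} - cos k = i sin k`,
each normalized Bloch mode with `0 < k < π` has the form `a ψ_{E,1} + i b ψ_{E,2}` with real `a`,
`b`. The real part of its Berry connection is half the derivative of the squared norm, which is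
constant. The imaginary part integrates an odd periodic function over a period. So the connection
vanishes (`IsRegularBand.berryConnection_eq_zero`), and the Zak phase consists only of the two
overlaps of an end point mode with its reflection. Each overlap is `a² ‖ψ_{E,1}‖² - b² ‖ψ_{E,2}‖²`.

At a simple end point one of the coefficients is zero: an even mode has overlap `1` and phase `0`,
an odd one has overlap `-1` and phase `π`. At a Dirac point both solutions contribute equally in the
limit, so the overlap is `0` and gives no phase
(`IsRegularBand.exists_hasEndpointMode_of_degenerate`). Each band thus has Zak phase `0` or `π`
according to the parity at the far end point, and the sum follows.

The analytic input is the discriminant `D(E) = ψ_{E,1}(1)`. The monodromy matrix has both diagonal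
entries equal to `D` (`w₂_one`), so the eigenvalues at `k` solve `D = cos k`, and they are double
exactly where `D' = 0` (`finrank_blochSpace`). The formula `two_mul_dDisc` for `D'` controls this
degeneracy, the folds of `D` at the levels `±1`, and the limits of the coefficients. Counting the
solutions of `D = c` shows that bands are continuous in `k`, hence strictly monotone on `[0, π]`.
The lower band therefore stays below the Dirac energy and the upper one above it up to the far end
point, where both are simple. -/

/-! ### Weights and their primitives. -/

/-- A positive weight: bounded, measurable, and continuous off a countable set. -/
structure IsWeight (g : ℝ → ℝ) : Prop where
  pos : ∀ x, 0 < g x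
  measurable : Measurable g
  bounded : ∃ K, 0 < K ∧ ∀ x, |g x| ≤ K
  countable : {x | ¬ ContinuousAt g x}.Countable

/-- On the countable exceptional set every function is measurable, and on its complement the
restriction is continuous. -/
theorem measurable_of_countable_discontinuities {g : ℝ → ℝ}
    (h : {x | ¬ ContinuousAt g x}.Countable) : Measurable g := by
  refine measurable_of_restrict_of_restrict_compl h.measurableSet ?_ ?_
  · have := h.to_subtype
    exact measurable_of_countable _
  · refine Continuous.measurable ?_
    rw [← continuousOn_iff_continuous_domRestrict]
    intro x hx
    exact (not_not.1 hx).continuousWithinAt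

theorem PiecewiseContinuous.isWeight {g : ℝ → ℝ} (hg : PiecewiseContinuous g)
    (hper : Function.Periodic g 1) (hpos : ∀ x, 0 < g x) : IsWeight g := by
  have hc : {x | ¬ ContinuousAt g x}.Countable := by
    have : {x | ¬ ContinuousAt g x} ⊆
        ⋃ n : ℤ, (fun x => x + (n : ℝ)) '' {x ∈ Icc (0 : ℝ) 1 | ¬ ContinuousAt g x} := by
      intro x hx
      refine mem_iUnion.2 ⟨⌊x⌋, Int.fract x,
        ⟨⟨Int.fract_nonneg x, (Int.fract_lt_one x).le⟩, fun h => hx ?_⟩, Int.fract_add_floor x⟩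
      have h1 : ContinuousAt (fun y => g (y - (⌊x⌋ : ℝ))) x := by
        have h' : ContinuousAt g (x - (⌊x⌋ : ℝ)) := h
        exact ContinuousAt.comp (f := fun y : ℝ => y - (⌊x⌋ : ℝ)) h'
          (continuous_id.sub continuous_const).continuousAt
      have h2 : (fun y => g (y - (⌊x⌋ : ℝ))) = g := by
        funext y
        have := hper.sub_zsmul_eq (x := y) ⌊x⌋
        simpa using this
      rwa [h2] at h1
    refine Countable.mono this (countable_iUnion fun n => ?_)
    exact (hg.1.countable).image _
  refine ⟨hpos, measurable_of_countable_discontinuities hc, ?_, hc⟩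
  -- One-sided limits bound `g` on each side of `x`; the value at `x` itself may exceed both and
  -- enters the maximum separately. Compactness of the period then gives a global bound.
  have hloc : ∀ x ∈ Icc (0 : ℝ) 1, ∃ t ∈ 𝓝[Icc (0 : ℝ) 1] x, ∃ K, ∀ y ∈ t, g y ≤ K := by
    intro x _
    obtain ⟨⟨l, hl⟩, r, hr⟩ := hg.2 x
    have e1 := hl.eventually (gt_mem_nhds (lt_add_one l))
    have e2 := hr.eventually (gt_mem_nhds (lt_add_one r))
    rw [eventually_nhdsWithin_iff] at e1 e2
    refine ⟨{y | g y ≤ max (g x) (max (l + 1) (r + 1))}, mem_nhdsWithin_of_mem_nhds ?_, _,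
      fun y hy => hy⟩
    filter_upwards [e1, e2] with y h1 h2
    rcases lt_trichotomy y x with h | h | h
    · exact (h1 h).le.trans ((le_max_left _ _).trans (le_max_right _ _))
    · rw [h]; exact le_max_left _ _
    · exact (h2 h).le.trans ((le_max_right _ _).trans (le_max_right _ _))
  have hK : ∃ K, ∀ y ∈ Icc (0 : ℝ) 1, g y ≤ K := by
    refine isCompact_Icc.induction_on (p := fun s => ∃ K, ∀ y ∈ s, g y ≤ K) ⟨0, by simp⟩ ?_ ?_ hloc
    · rintro s t hst ⟨K, hK⟩
      exact ⟨K, fun y hy => hK y (hst hy)⟩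
    · rintro s t ⟨K, hK⟩ ⟨K', hK'⟩
      refine ⟨max K K', fun y hy => ?_⟩
      rcases hy with hy | hy
      · exact (hK y hy).trans (le_max_left _ _)
      · exact (hK' y hy).trans (le_max_right _ _)
  obtain ⟨K, hK⟩ := hK
  have hb : ∀ x, g x ≤ K := fun x => by
    obtain ⟨y, hy, h⟩ := hper.exists_mem_Ico₀ one_pos x
    rw [h]; exact hK y ⟨hy.1, hy.2.le⟩
  exact ⟨K, (hpos 0).trans_le (hb 0), fun x => by rw [abs_of_pos (hpos x)]; exact hb x⟩

theorem IsWeight.aestronglyMeasurable {g : ℝ → ℝ} (hg : IsWeight g) (μ : MeasureTheory.Measure ℝ) :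
    MeasureTheory.AEStronglyMeasurable g μ := hg.measurable.aestronglyMeasurable

theorem IsWeight.intervalIntegrable {g : ℝ → ℝ} (hg : IsWeight g) (a b : ℝ) :
    IntervalIntegrable g MeasureTheory.volume a b := by
  obtain ⟨K, -, hK⟩ := hg.bounded
  exact (intervalIntegrable_const (c := K)).mono_fun (hg.aestronglyMeasurable _)
    (Eventually.of_forall fun x => by
      simpa [Real.norm_eq_abs] using (hK x).trans (le_abs_self K))

theorem IsWeight.intervalIntegrable_mul {g u : ℝ → ℝ} (hg : IsWeight g) (hu : Continuous u)
    (a b : ℝ) : IntervalIntegrable (fun x => g x * u x) MeasureTheory.volume a b :=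
  (hg.intervalIntegrable a b).mul_continuousOn hu.continuousOn

theorem IsWeight.intervalIntegrable_ofReal_mul {g : ℝ → ℝ} {u : ℝ → ℂ} (hg : IsWeight g)
    (hu : Continuous u) (a b : ℝ) :
    IntervalIntegrable (fun x => (g x : ℂ) * u x) MeasureTheory.volume a b :=
  IntervalIntegrable.mul_continuousOn (f := fun x => (g x : ℂ))
    ⟨(hg.intervalIntegrable a b).1.ofReal, (hg.intervalIntegrable a b).2.ofReal⟩ hu.continuousOn

/-- The primitive of `g u` vanishing at `0`. -/
noncomputable def primitive (g u : ℝ → ℝ) (x : ℝ) : ℝ := ∫ t in (0 : ℝ)..x, g t * u t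

theorem IsWeight.continuous_primitive {g u : ℝ → ℝ} (hg : IsWeight g) (hu : Continuous u) :
    Continuous (primitive g u) :=
  intervalIntegral.continuous_primitive (fun a b => hg.intervalIntegrable_mul hu a b) 0

theorem IsWeight.hasDerivAt_primitive {g u : ℝ → ℝ} (hg : IsWeight g) (hu : Continuous u)
    {x : ℝ} (hx : ContinuousAt g x) : HasDerivAt (primitive g u) (g x * u x) x :=
  intervalIntegral.integral_hasDerivAt_right (hg.intervalIntegrable_mul hu 0 x)
    ((hg.measurable.mul hu.measurable).stronglyMeasurable.stronglyMeasurableAtFilter)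
    (hx.mul hu.continuousAt)

@[simp] theorem primitive_zero (g u : ℝ → ℝ) : primitive g u 0 = 0 := by simp [primitive]

theorem primitive_neg_of_even {g u : ℝ → ℝ} (hg : Function.Even g) (hu : Function.Even u) :
    Function.Odd (primitive g u) := by
  intro x
  have := intervalIntegral.integral_comp_neg (a := 0) (b := x) (fun t => g t * u t)
  simp only [neg_zero, hg _, hu _] at this
  rw [primitive, primitive, this, intervalIntegral.integral_symm]

theorem primitive_neg_of_odd {g u : ℝ → ℝ} (hg : Function.Even g) (hu : Function.Odd u) :
    Function.Even (primitive g u) := by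
  intro x
  have := intervalIntegral.integral_comp_neg (a := 0) (b := x) (fun t => g t * u t)
  simp only [neg_zero, hg _, hu _, mul_neg, intervalIntegral.integral_neg] at this
  rw [primitive, primitive, intervalIntegral.integral_symm, ← this, neg_neg]

/-! ### Entire power series in the spectral parameter. -/

/-- Coefficients of a power series in `z` that converges for all `z`, locally uniformly in `x`. -/
structure EntireCoeff (c : ℕ → ℝ → ℝ) : Prop where
  continuous : ∀ n, Continuous (c n)
  bound : ∀ R, ∃ C S, 0 ≤ C ∧ 0 ≤ S ∧ ∀ n x, |x| ≤ R → |c n x| ≤ C * S ^ n / n.factorial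

/-- The function `∑ zⁿ cₙ(x)`. -/
noncomputable def entireSeries (c : ℕ → ℝ → ℝ) (z x : ℝ) : ℝ := ∑' n, z ^ n * c n x

/-- The coefficients of the derivative with respect to `z`. -/
def derivCoeff (c : ℕ → ℝ → ℝ) (n : ℕ) (x : ℝ) : ℝ := (n + 1) * c (n + 1) x

namespace EntireCoeff

variable {c : ℕ → ℝ → ℝ}

theorem exists_summable_bound (hc : EntireCoeff c) (R Z : ℝ) :
    ∃ u : ℕ → ℝ, Summable u ∧ ∀ n z x, |z| ≤ Z → |x| ≤ R → ‖z ^ n * c n x‖ ≤ u n := by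
  obtain ⟨C, S, hC, hS, h⟩ := hc.bound R
  refine ⟨fun n => C * ((|Z| * S) ^ n / n.factorial),
    (Real.summable_pow_div_factorial _).mul_left C, fun n z x hz hx => ?_⟩
  rw [norm_mul, norm_pow, Real.norm_eq_abs, Real.norm_eq_abs]
  change _ ≤ C * ((|Z| * S) ^ n / n.factorial)
  rw [mul_pow]
  calc |z| ^ n * |c n x| ≤ |Z| ^ n * (C * S ^ n / n.factorial) := by
        have := hz.trans (le_abs_self Z)
        exact mul_le_mul (pow_le_pow_left₀ (abs_nonneg z) this n) (h n x hx) (abs_nonneg _)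
          (by positivity)
    _ = _ := by ring

theorem hasSum (hc : EntireCoeff c) (z x : ℝ) :
    HasSum (fun n => z ^ n * c n x) (entireSeries c z x) := by
  obtain ⟨u, hu, h⟩ := hc.exists_summable_bound |x| |z|
  exact (Summable.of_norm_bounded hu fun n => h n z x le_rfl le_rfl).hasSum

theorem continuous_uncurry (hc : EntireCoeff c) :
    Continuous (Function.uncurry (entireSeries c)) := by
  rw [continuous_iff_continuousAt]
  rintro ⟨z, x⟩
  obtain ⟨u, hu, h⟩ := hc.exists_summable_bound (|x| + 1) (|z| + 1)
  have : ContinuousOn (Function.uncurry (entireSeries c))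
      {w : ℝ × ℝ | |w.1| < |z| + 1 ∧ |w.2| < |x| + 1} := by
    refine continuousOn_tsum (f := fun n (w : ℝ × ℝ) => w.1 ^ n * c n w.2) (fun n => ?_) hu
      fun n w hw => h n w.1 w.2 hw.1.le hw.2.le
    exact ((continuous_fst.pow n).mul ((hc.continuous n).comp continuous_snd)).continuousOn
  refine this.continuousAt (IsOpen.mem_nhds ?_ ⟨by simp, by simp⟩)
  exact (isOpen_lt continuous_fst.abs continuous_const).inter
    (isOpen_lt continuous_snd.abs continuous_const)

theorem continuous_right (hc : EntireCoeff c) (z : ℝ) : Continuous (entireSeries c z) :=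
  hc.continuous_uncurry.comp (continuous_const.prodMk continuous_id)

/-- The factor `n + 1` turns `(n + 1)!` into `n!`, so the factorial bound keeps its form, with `C S`
for `C`. -/
theorem derivCoeff (hc : EntireCoeff c) : EntireCoeff (derivCoeff c) := by
  refine ⟨fun n => continuous_const.mul (hc.continuous (n + 1)), fun R => ?_⟩
  obtain ⟨C, S, hC, hS, h⟩ := hc.bound R
  refine ⟨C * S, S, mul_nonneg hC hS, hS, fun n x hx => ?_⟩
  have hn : (0 : ℝ) < n + 1 := by positivity
  rw [_root_.derivCoeff, abs_mul, abs_of_pos hn]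
  calc ((n : ℝ) + 1) * |c (n + 1) x|
      ≤ (n + 1) * (C * S ^ (n + 1) / (n + 1).factorial) := by gcongr; exact h _ x hx
    _ = C * S * S ^ n / n.factorial := by
        rw [Nat.factorial_succ]; push_cast; field_simp; ring

theorem hasDerivAt (hc : EntireCoeff c) (z x : ℝ) :
    HasDerivAt (fun z => entireSeries c z x) (entireSeries (_root_.derivCoeff c) z x) z := by
  obtain ⟨u, hu, h⟩ := hc.derivCoeff.exists_summable_bound |x| (|z| + 1)
  -- The term `n = 0` has derivative zero, hence the bound `0`; the term `n` is bounded by the term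
  -- `n - 1` of the derived series.
  have key := hasDerivAt_tsum_of_isPreconnected (𝕜 := ℝ) (t := Ioo (-(|z| + 1)) (|z| + 1))
    (u := fun n => if n = 0 then 0 else u (n - 1)) (g := fun n y => y ^ n * c n x)
    (g' := fun n y => (n * y ^ (n - 1)) * c n x) (y := z) (y₀ := z) ?_ isOpen_Ioo
    isPreconnected_Ioo (fun n y _ => (hasDerivAt_pow n y).mul_const _) ?_
    (abs_lt.1 (lt_add_one |z|)) (hc.hasSum z x).summable (abs_lt.1 (lt_add_one |z|))
  · refine key.congr_deriv ?_
    rw [Summable.tsum_eq_zero_add]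
    · simp only [Nat.cast_zero, zero_mul, zero_add, entireSeries, _root_.derivCoeff]
      refine tsum_congr fun n => ?_
      push_cast
      ring
    · rw [← summable_nat_add_iff 1]
      refine (hc.derivCoeff.hasSum z x).summable.congr fun n => ?_
      simp only [_root_.derivCoeff, Nat.add_sub_cancel]
      push_cast
      ring
  · rw [← summable_nat_add_iff 1]
    exact hu.congr fun n => by simp
  · rintro (_ | n) y hy
    · simp
    · have := h n y x (abs_lt.2 hy).le le_rfl
      simp only [_root_.derivCoeff, Nat.add_sub_cancel, Nat.add_eq_zero_iff, one_ne_zero,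
        and_false, if_false] at this ⊢
      refine le_of_eq_of_le ?_ this
      congr 1
      push_cast
      ring

theorem primitive_entireSeries (hc : EntireCoeff c) {g : ℝ → ℝ} (hg : IsWeight g) (z x : ℝ) :
    HasSum (fun n => z ^ n * primitive g (c n) x) (primitive g (entireSeries c z) x) := by
  obtain ⟨u, hu, h⟩ := hc.exists_summable_bound |x| |z|
  obtain ⟨K, hK0, hK⟩ := hg.bounded
  have key := intervalIntegral.hasSum_integral_of_dominated_convergence (a := 0) (b := x)
    (μ := MeasureTheory.volume) (F := fun n t => g t * (z ^ n * c n t))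
    (f := fun t => g t * entireSeries c z t) (fun n _ => K * u n) ?_ ?_ ?_ ?_ ?_
  · have e : (fun n => z ^ n * primitive g (c n) x) =
        fun n => ∫ t in (0 : ℝ)..x, g t * (z ^ n * c n t) := by
      funext n
      rw [primitive, ← intervalIntegral.integral_const_mul]
      congr 1
      funext t
      ring
    rw [e]
    exact key
  · intro n
    exact (hg.aestronglyMeasurable _).mul
      (continuous_const.mul (hc.continuous n)).aestronglyMeasurable
  · refine fun n => Eventually.of_forall fun t ht => ?_
    rw [norm_mul]
    have hx : |t| ≤ |x| := by
      rcases le_total 0 x with h0 | h0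
      · rw [uIoc_of_le h0] at ht
        rw [abs_of_pos ht.1, abs_of_nonneg h0]; exact ht.2
      · rw [uIoc_of_ge h0] at ht
        rw [abs_of_nonpos ht.2, abs_of_nonpos h0]; linarith [ht.1]
    exact mul_le_mul (hK t) (h n z t le_rfl hx) (norm_nonneg _) hK0.le
  · exact Eventually.of_forall fun t _ => hu.mul_left K
  · exact intervalIntegrable_const
  · exact Eventually.of_forall fun t _ => (hc.hasSum z t).mul_left (g t)

end EntireCoeff

/-! ### Iterated integrals that solve the equation. -/

/-- The iterates `(∫ h ∫ g)ⁿ 1`. -/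
noncomputable def evenIterate (g h : ℝ → ℝ) : ℕ → ℝ → ℝ
  | 0 => fun _ => 1
  | n + 1 => primitive h (primitive g (evenIterate g h n))

/-- The iterates `∫ g (∫ h ∫ g)ⁿ 1`. -/
noncomputable def oddIterate (g h : ℝ → ℝ) (n : ℕ) : ℝ → ℝ := primitive g (evenIterate g h n)

/-- Each integration raises the power of `|x|` and divides by the new exponent; iterating it
produces the factorials. -/
theorem IsWeight.abs_primitive_le {g u : ℝ → ℝ} {K C : ℝ} (hK : ∀ x, |g x| ≤ K) (hK0 : 0 ≤ K)
    {m : ℕ} (hu : ∀ x, |u x| ≤ C * |x| ^ m) (x : ℝ) :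
    |primitive g u x| ≤ K * C * (|x| ^ (m + 1) / (m + 1)) := by
  have h1 := intervalIntegral.norm_integral_le_integral_norm_uIoc
    (f := fun t => g t * u t) (a := 0) (b := x) (μ := MeasureTheory.volume)
  have h2 := integral_pow_abs_sub_uIoc (a := 0) (b := x) m
  simp only [sub_zero] at h2
  rw [← h2, ← MeasureTheory.integral_const_mul]
  refine h1.trans ?_
  refine MeasureTheory.integral_mono_of_nonneg (Eventually.of_forall fun t => norm_nonneg _) ?_
    (Eventually.of_forall fun t => ?_)
  · have : Continuous fun t : ℝ => K * C * |t| ^ m := by fun_prop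
    exact intervalIntegrable_iff.1 (this.intervalIntegrable 0 x)
  · simp only [norm_mul, Real.norm_eq_abs]
    calc |g t| * |u t| ≤ K * (C * |t| ^ m) :=
          mul_le_mul (hK t) (hu t) (abs_nonneg _) hK0
      _ = _ := by ring

section Iterates

variable {g h : ℝ → ℝ}

theorem continuous_evenIterate (hg : IsWeight g) (hh : IsWeight h) (n : ℕ) :
    Continuous (evenIterate g h n) := by
  induction n with
  | zero => exact continuous_const
  | succ n ih => exact hh.continuous_primitive (hg.continuous_primitive ih)

/-- One iterate consists of two integrations, hence `(2n)!`. The bound on `g` is kept for the one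
further integration in `oddIterate`. -/
theorem exists_abs_evenIterate_le (hg : IsWeight g) (hh : IsWeight h) :
    ∃ K, 0 ≤ K ∧ (∀ x, |g x| ≤ K) ∧
      ∀ n x, |evenIterate g h n x| ≤ K ^ (2 * n) / (2 * n).factorial * |x| ^ (2 * n) := by
  obtain ⟨K₁, h1, hK₁⟩ := hg.bounded
  obtain ⟨K₂, h2, hK₂⟩ := hh.bounded
  set K := max K₁ K₂
  have hK0 : 0 ≤ K := h1.le.trans (le_max_left _ _)
  have hKg : ∀ x, |g x| ≤ K := fun x => (hK₁ x).trans (le_max_left _ _)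
  have hKh : ∀ x, |h x| ≤ K := fun x => (hK₂ x).trans (le_max_right _ _)
  refine ⟨K, hK0, hKg, fun n => ?_⟩
  induction n with
  | zero => intro x; simp [evenIterate]
  | succ n ih =>
    intro x
    have e1 : ∀ x, |primitive g (evenIterate g h n) x| ≤
        (K * (K ^ (2 * n) / (2 * n).factorial) / (2 * n + 1)) * |x| ^ (2 * n + 1) := fun x => by
      have := IsWeight.abs_primitive_le hKg hK0 ih x
      push_cast at this
      refine this.trans_eq (by ring)
    have := IsWeight.abs_primitive_le hKh hK0 e1 x
    refine this.trans_eq ?_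
    rw [show 2 * (n + 1) = 2 * n + 1 + 1 by ring, Nat.factorial_succ (2 * n + 1),
      Nat.factorial_succ (2 * n)]
    push_cast
    field_simp
    ring

theorem EntireCoeff.evenIterate (hg : IsWeight g) (hh : IsWeight h) :
    EntireCoeff (evenIterate g h) := by
  refine ⟨continuous_evenIterate hg hh, fun R => ?_⟩
  obtain ⟨K, hK0, -, hK⟩ := exists_abs_evenIterate_le hg hh
  refine ⟨1, K ^ 2 * R ^ 2, zero_le_one, by positivity, fun n x hx => (hK n x).trans ?_⟩
  calc K ^ (2 * n) / (2 * n).factorial * |x| ^ (2 * n)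
      ≤ K ^ (2 * n) / n.factorial * R ^ (2 * n) := by
        gcongr
        omega
    _ = _ := by rw [mul_pow, ← pow_mul, ← pow_mul]; ring

theorem EntireCoeff.oddIterate (hg : IsWeight g) (hh : IsWeight h) :
    EntireCoeff (oddIterate g h) := by
  refine ⟨fun n => hg.continuous_primitive (continuous_evenIterate hg hh n), fun R => ?_⟩
  obtain ⟨K, hK0, hKg, hK⟩ := exists_abs_evenIterate_le hg hh
  refine ⟨K * |R|, K ^ 2 * R ^ 2, by positivity, by positivity, fun n x hx => ?_⟩
  refine (IsWeight.abs_primitive_le hKg hK0 (hK n) x).trans ?_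
  have hx' : |x| ≤ |R| := hx.trans (le_abs_self R)
  calc K * (K ^ (2 * n) / (2 * n).factorial) * (|x| ^ (2 * n + 1) / ((2 * n : ℕ) + 1))
      ≤ K * (K ^ (2 * n) / n.factorial) * (|R| ^ (2 * n + 1) / 1) := by
        gcongr
        · omega
        · push_cast; linarith [(Nat.cast_nonneg n : (0 : ℝ) ≤ n)]
    _ = _ := by rw [pow_succ, pow_mul |R| 2 n, sq_abs, mul_pow, ← pow_mul, ← pow_mul]; ring

/-- The term `n = 0` is `1`, and each later iterate is the `h`-primitive of an odd iterate. With `z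
= -E` this is half of the integrated first-order system; `entireSeries_oddIterate` is the other
half. -/
theorem entireSeries_evenIterate (hg : IsWeight g) (hh : IsWeight h) (z x : ℝ) :
    entireSeries (evenIterate g h) z x =
      1 + z * primitive h (entireSeries (oddIterate g h) z) x := by
  have h1 := (EntireCoeff.evenIterate hg hh).hasSum z x
  have h2 := ((EntireCoeff.oddIterate hg hh).primitive_entireSeries hh z x).mul_left z
  have h2' : HasSum (fun n => z ^ (n + 1) * evenIterate g h (n + 1) x)
      (z * primitive h (entireSeries (oddIterate g h) z) x) := by
    refine h2.congr_fun fun n => ?_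
    change z ^ (n + 1) * primitive h (oddIterate g h n) x = _
    ring
  rw [h1.unique ((hasSum_nat_add_iff (f := fun n => z ^ n * evenIterate g h n x) 1).1 h2')]
  simp [evenIterate, add_comm]

theorem entireSeries_oddIterate (hg : IsWeight g) (hh : IsWeight h) (z x : ℝ) :
    entireSeries (oddIterate g h) z x = primitive g (entireSeries (evenIterate g h) z) x :=
  ((EntireCoeff.oddIterate hg hh).hasSum z x).unique
    ((EntireCoeff.evenIterate hg hh).primitive_entireSeries hg z x)

theorem even_evenIterate (hg : Function.Even g) (hh : Function.Even h) (n : ℕ) :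
    Function.Even (evenIterate g h n) := by
  induction n with
  | zero => exact fun x => rfl
  | succ n ih => exact primitive_neg_of_odd hh (primitive_neg_of_even hg ih)

theorem even_entireSeries_evenIterate (hg : Function.Even g) (hh : Function.Even h) (z : ℝ) :
    Function.Even (entireSeries (evenIterate g h) z) := fun x => by
  simp only [entireSeries, even_evenIterate hg hh _ x]

theorem odd_entireSeries_oddIterate (hg : Function.Even g) (hh : Function.Even h) (z : ℝ) :
    Function.Odd (entireSeries (oddIterate g h) z) := fun x => by
  simp only [entireSeries, oddIterate, primitive_neg_of_even hg (even_evenIterate hg hh _) x,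
    mul_neg, tsum_neg]

theorem evenIterate_pos (hg : IsWeight g) (hh : IsWeight h) (n : ℕ) {x : ℝ} (hx : 0 < x) :
    0 < evenIterate g h n x := by
  have key : ∀ {w u : ℝ → ℝ}, IsWeight w → Continuous u → (∀ y, 0 < y → 0 < u y) →
      ∀ y, 0 < y → 0 < primitive w u y := fun {w u} hw hu hpos y hy =>
    intervalIntegral.intervalIntegral_pos_of_pos_on (hw.intervalIntegrable_mul hu 0 y)
      (fun t ht => mul_pos (hw.pos t) (hpos t ht.1)) hy
  induction n generalizing x with
  | zero => exact one_pos
  | succ n ih =>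
    have hc := continuous_evenIterate hg hh n
    exact key hh (hg.continuous_primitive hc) (key hg hc fun y hy => ih hy) x hx

/-- All coefficients at `x = 1` are positive, so the first two terms already exceed `1`. With `z =
-E` this excludes negative eigenvalues. -/
theorem one_lt_entireSeries_evenIterate (hg : IsWeight g) (hh : IsWeight h) {z : ℝ} (hz : 0 < z) :
    1 < entireSeries (evenIterate g h) z 1 := by
  have h1 := (EntireCoeff.evenIterate hg hh).hasSum z 1
  have h2 := sum_le_hasSum (Finset.range 2)
    (fun n _ => mul_nonneg (pow_nonneg hz.le n) (evenIterate_pos hg hh n one_pos).le) h1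
  have h3 := mul_pos hz (evenIterate_pos hg hh 1 one_pos)
  simp only [Finset.sum_range_succ, Finset.sum_range_zero, pow_zero, pow_one, one_mul,
    zero_add] at h2
  have h4 : evenIterate g h 0 1 = 1 := rfl
  linarith

end Iterates

/-! ### Weighted integrals depending on a parameter. -/

theorem IsWeight.exists_bound {F : ℝ → ℝ → ℝ} (hF : Continuous (Function.uncurry F)) (E : ℝ) :
    ∃ C, ∀ E' ∈ Icc (E - 1) (E + 1), ∀ x ∈ Icc (0 : ℝ) 1, |F E' x| ≤ C := by
  obtain ⟨C, hC⟩ := (isCompact_Icc.prod isCompact_Icc).exists_bound_of_continuousOn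
    (s := Icc (E - 1) (E + 1) ×ˢ Icc (0 : ℝ) 1) hF.continuousOn
  exact ⟨C, fun E' hE' x hx => hC (E', x) ⟨hE', hx⟩⟩

theorem IsWeight.continuous_integral {g : ℝ → ℝ} (hg : IsWeight g) {F : ℝ → ℝ → ℝ}
    (hF : Continuous (Function.uncurry F)) :
    Continuous fun E => ∫ x in (0 : ℝ)..1, g x * F E x := by
  rw [continuous_iff_continuousAt]
  intro E
  obtain ⟨K, hK0, hK⟩ := hg.bounded
  obtain ⟨C, hC⟩ := IsWeight.exists_bound hF E
  refine intervalIntegral.continuousAt_of_dominated_interval (bound := fun _ => K * C) ?_ ?_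
    intervalIntegrable_const ?_
  · exact Eventually.of_forall fun E' => (hg.aestronglyMeasurable _).mul
      (hF.comp (continuous_const.prodMk continuous_id)).aestronglyMeasurable
  · filter_upwards [Icc_mem_nhds (sub_one_lt E) (lt_add_one E)] with E' hE'
    refine Eventually.of_forall fun x hx => ?_
    rw [uIoc_of_le zero_le_one] at hx
    rw [norm_mul]
    exact mul_le_mul (hK x) (hC E' hE' x ⟨hx.1.le, hx.2⟩) (norm_nonneg _) hK0.le
  · exact Eventually.of_forall fun x _ => continuousAt_const.mul
      (hF.comp (continuous_id.prodMk continuous_const)).continuousAt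

theorem IsWeight.hasDerivAt_integral {g : ℝ → ℝ} (hg : IsWeight g) {F F' : ℝ → ℝ → ℝ}
    (hF : Continuous (Function.uncurry F)) (hF' : Continuous (Function.uncurry F'))
    (h : ∀ E x, HasDerivAt (fun E => F E x) (F' E x) E) (E : ℝ) :
    HasDerivAt (fun E => ∫ x in (0 : ℝ)..1, g x * F E x) (∫ x in (0 : ℝ)..1, g x * F' E x) E := by
  obtain ⟨K, hK0, hK⟩ := hg.bounded
  obtain ⟨C, hC⟩ := IsWeight.exists_bound hF' E
  have hcF : ∀ E, Continuous (F E) := fun E => hF.comp (continuous_const.prodMk continuous_id)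
  have hcF' : ∀ E, Continuous (F' E) := fun E => hF'.comp (continuous_const.prodMk continuous_id)
  refine (intervalIntegral.hasDerivAt_integral_of_dominated_loc_of_deriv_le
    (F := fun E x => g x * F E x) (F' := fun E x => g x * F' E x) (bound := fun _ => K * C)
    (Icc_mem_nhds (sub_one_lt E) (lt_add_one E)) ?_ (hg.intervalIntegrable_mul (hcF E) 0 1) ?_ ?_
    intervalIntegrable_const ?_).2
  · exact Eventually.of_forall fun E' =>
      (hg.aestronglyMeasurable _).mul (hcF E').aestronglyMeasurable
  · exact (hg.aestronglyMeasurable _).mul (hcF' E).aestronglyMeasurable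
  · refine Eventually.of_forall fun x hx E' hE' => ?_
    rw [uIoc_of_le zero_le_one] at hx
    rw [norm_mul]
    exact mul_le_mul (hK x) (hC E' hE' x ⟨hx.1.le, hx.2⟩) (norm_nonneg _) hK0.le
  · exact Eventually.of_forall fun x _ E' _ => (h E' x).const_mul (g x)

/-- The product rule is not available because `h` is only continuous at `a`, but the slope is
exactly `-h t`. This differentiates Lagrange's identity at coinciding energies. -/
theorem hasDerivAt_sub_mul {h : ℝ → ℝ} {a : ℝ} (hh : ContinuousAt h a) :
    HasDerivAt (fun t => (a - t) * h t) (-h a) a := by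
  rw [hasDerivAt_iff_tendsto_slope]
  refine ((hh.neg).tendsto.mono_left nhdsWithin_le_nhds).congr' ?_
  filter_upwards [self_mem_nhdsWithin] with t ht
  have : t - a ≠ 0 := sub_ne_zero.2 ht
  rw [slope_def_field]
  simp only [Pi.neg_apply]
  field_simp
  ring

/-! ### The fundamental solutions. -/

namespace PhotonicMedium

variable (M : PhotonicMedium)

theorem isWeight_ε : IsWeight M.ε := M.ε_piecewise.isWeight M.ε_periodic M.ε_pos

theorem isWeight_μ : IsWeight M.μ := M.μ_piecewise.isWeight M.μ_periodic M.μ_pos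

/-- The real fundamental solution with initial values `(1, 0)`. -/
noncomputable def y₁ (E x : ℝ) : ℝ := entireSeries (evenIterate M.ε M.μ) (-E) x

/-- The flux of `y₁`. -/
noncomputable def w₁ (E x : ℝ) : ℝ := -E * entireSeries (oddIterate M.ε M.μ) (-E) x

/-- The real fundamental solution with initial values `(0, 1)`. -/
noncomputable def y₂ (E x : ℝ) : ℝ := entireSeries (oddIterate M.μ M.ε) (-E) x

/-- The flux of `y₂`. -/
noncomputable def w₂ (E x : ℝ) : ℝ := entireSeries (evenIterate M.μ M.ε) (-E) x

/-- The derivative of `y₁` with respect to `E`. -/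
noncomputable def dy₁ (E x : ℝ) : ℝ := -entireSeries (derivCoeff (evenIterate M.ε M.μ)) (-E) x

/-- The derivative of `y₂` with respect to `E`. -/
noncomputable def dy₂ (E x : ℝ) : ℝ := -entireSeries (derivCoeff (oddIterate M.μ M.ε)) (-E) x

theorem entireCoeff_y₁ : EntireCoeff (evenIterate M.ε M.μ) :=
  EntireCoeff.evenIterate M.isWeight_ε M.isWeight_μ

theorem entireCoeff_w₁ : EntireCoeff (oddIterate M.ε M.μ) :=
  EntireCoeff.oddIterate M.isWeight_ε M.isWeight_μ

theorem entireCoeff_y₂ : EntireCoeff (oddIterate M.μ M.ε) :=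
  EntireCoeff.oddIterate M.isWeight_μ M.isWeight_ε

theorem entireCoeff_w₂ : EntireCoeff (evenIterate M.μ M.ε) :=
  EntireCoeff.evenIterate M.isWeight_μ M.isWeight_ε

theorem continuous_neg_prod : Continuous fun v : ℝ × ℝ => (-v.1, v.2) :=
  continuous_fst.neg.prodMk continuous_snd

theorem continuous_uncurry_y₁ : Continuous (Function.uncurry M.y₁) :=
  M.entireCoeff_y₁.continuous_uncurry.comp continuous_neg_prod

theorem continuous_uncurry_y₂ : Continuous (Function.uncurry M.y₂) :=
  M.entireCoeff_y₂.continuous_uncurry.comp continuous_neg_prod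

theorem continuous_uncurry_dy₁ : Continuous (Function.uncurry M.dy₁) :=
  (M.entireCoeff_y₁.derivCoeff.continuous_uncurry.comp continuous_neg_prod).neg

theorem continuous_uncurry_dy₂ : Continuous (Function.uncurry M.dy₂) :=
  (M.entireCoeff_y₂.derivCoeff.continuous_uncurry.comp continuous_neg_prod).neg

theorem continuous_y₁ (E : ℝ) : Continuous (M.y₁ E) := M.entireCoeff_y₁.continuous_right _

theorem continuous_y₂ (E : ℝ) : Continuous (M.y₂ E) := M.entireCoeff_y₂.continuous_right _

theorem continuous_w₁ (E : ℝ) : Continuous (M.w₁ E) :=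
  continuous_const.mul (M.entireCoeff_w₁.continuous_right _)

theorem continuous_w₂ (E : ℝ) : Continuous (M.w₂ E) := M.entireCoeff_w₂.continuous_right _

theorem continuous_dy₁ (E : ℝ) : Continuous (M.dy₁ E) :=
  (M.entireCoeff_y₁.derivCoeff.continuous_right _).neg

theorem continuous_dy₂ (E : ℝ) : Continuous (M.dy₂ E) :=
  (M.entireCoeff_y₂.derivCoeff.continuous_right _).neg

theorem hasDerivAt_entireSeries_neg {c : ℕ → ℝ → ℝ} (hc : EntireCoeff c) (E x : ℝ) :
    HasDerivAt (fun E => entireSeries c (-E) x) (-entireSeries (derivCoeff c) (-E) x) E :=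
  ((hc.hasDerivAt (-E) x).comp E (hasDerivAt_neg E)).congr_deriv (mul_neg_one _)

theorem hasDerivAt_y₁ (E x : ℝ) : HasDerivAt (fun E => M.y₁ E x) (M.dy₁ E x) E :=
  hasDerivAt_entireSeries_neg M.entireCoeff_y₁ E x

theorem hasDerivAt_y₂ (E x : ℝ) : HasDerivAt (fun E => M.y₂ E x) (M.dy₂ E x) E :=
  hasDerivAt_entireSeries_neg M.entireCoeff_y₂ E x

theorem differentiable_w₁ (x : ℝ) : Differentiable ℝ fun E => M.w₁ E x := fun E =>
  (((hasDerivAt_id E).neg).mul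
    (hasDerivAt_entireSeries_neg M.entireCoeff_w₁ E x)).differentiableAt

theorem y₁_eq (E : ℝ) : M.y₁ E = fun x =>
    1 + -E * primitive M.μ (entireSeries (oddIterate M.ε M.μ) (-E)) x :=
  funext fun x => entireSeries_evenIterate M.isWeight_ε M.isWeight_μ (-E) x

theorem w₁_eq (E : ℝ) : M.w₁ E = fun x => -E * primitive M.ε (M.y₁ E) x :=
  funext fun x => by
    rw [w₁, entireSeries_oddIterate M.isWeight_ε M.isWeight_μ]; rfl

theorem w₂_eq (E : ℝ) : M.w₂ E = fun x => 1 + -E * primitive M.ε (M.y₂ E) x :=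
  funext fun x => entireSeries_evenIterate M.isWeight_μ M.isWeight_ε (-E) x

theorem y₂_eq (E : ℝ) : M.y₂ E = primitive M.μ (M.w₂ E) :=
  funext fun x => entireSeries_oddIterate M.isWeight_μ M.isWeight_ε (-E) x

@[simp] theorem y₁_zero (E : ℝ) : M.y₁ E 0 = 1 := by simp [y₁_eq]
@[simp] theorem w₁_zero (E : ℝ) : M.w₁ E 0 = 0 := by simp [w₁_eq]
@[simp] theorem y₂_zero (E : ℝ) : M.y₂ E 0 = 0 := by simp [y₂_eq]
@[simp] theorem w₂_zero (E : ℝ) : M.w₂ E 0 = 1 := by simp [w₂_eq]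

theorem isSolution_y₁ (E : ℝ) : M.IsSolution E (fun x => (M.y₁ E x : ℂ)) fun x => (M.w₁ E x : ℂ) where
  continuous_mode := Complex.continuous_ofReal.comp (M.continuous_y₁ E)
  continuous_flux := Complex.continuous_ofReal.comp (M.continuous_w₁ E)
  deriv_mode x hx := by
    have h := ((M.isWeight_μ.hasDerivAt_primitive (M.entireCoeff_w₁.continuous_right (-E))
      hx).const_mul (-E)).const_add 1
    rw [← y₁_eq] at h
    refine h.ofReal_comp.congr_deriv ?_
    rw [w₁]; push_cast; ring
  deriv_flux x hx := by
    have h := (M.isWeight_ε.hasDerivAt_primitive (M.continuous_y₁ E) hx).const_mul (-E)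
    rw [← w₁_eq] at h
    refine h.ofReal_comp.congr_deriv ?_
    push_cast; ring

theorem isSolution_y₂ (E : ℝ) : M.IsSolution E (fun x => (M.y₂ E x : ℂ)) fun x => (M.w₂ E x : ℂ) where
  continuous_mode := Complex.continuous_ofReal.comp (M.continuous_y₂ E)
  continuous_flux := Complex.continuous_ofReal.comp (M.continuous_w₂ E)
  deriv_mode x hx := by
    have h := M.isWeight_μ.hasDerivAt_primitive (M.continuous_w₂ E) hx
    rw [← y₂_eq] at h
    refine h.ofReal_comp.congr_deriv ?_
    push_cast; ring
  deriv_flux x hx := by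
    have h := ((M.isWeight_ε.hasDerivAt_primitive (M.continuous_y₂ E) hx).const_mul
      (-E)).const_add 1
    rw [← w₂_eq] at h
    refine h.ofReal_comp.congr_deriv ?_
    push_cast; ring

/-! ### Lagrange's identity, uniqueness and the monodromy matrix. -/

variable {M}

/-- Lagrange's identity. -/
theorem IsSolution.lagrange {E E' : ℝ} {ψ q χ s : ℝ → ℂ} (h : M.IsSolution E ψ q)
    (h' : M.IsSolution E' χ s) (b : ℝ) :
    ∫ x in (0 : ℝ)..b, (M.ε x : ℂ) * (((E - E' : ℝ) : ℂ) * (ψ x * χ x)) =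
      (ψ b * s b - q b * χ b) - (ψ 0 * s 0 - q 0 * χ 0) := by
  -- The boundary form `ψ s - q χ` is continuous everywhere and differentiable off the countably
  -- many discontinuities of `ε` and `μ`; that suffices for the fundamental theorem of calculus.
  refine MeasureTheory.integral_eq_of_hasDerivAt_off_countable (fun x => ψ x * s x - q x * χ x) _
    (M.isWeight_ε.countable.union M.isWeight_μ.countable) ?_ ?_ ?_
  · exact ((h.continuous_mode.mul h'.continuous_flux).sub
      (h.continuous_flux.mul h'.continuous_mode)).continuousOn
  · rintro x ⟨-, hx⟩
    simp only [mem_union, mem_ofPred_eq, not_or, not_not] at hx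
    refine (((h.deriv_mode x hx.2).mul (h'.deriv_flux x hx.1)).sub
      ((h.deriv_flux x hx.1).mul (h'.deriv_mode x hx.2))).congr_deriv ?_
    push_cast; ring
  · exact M.isWeight_ε.intervalIntegrable_ofReal_mul
      (continuous_const.mul (h.continuous_mode.mul h'.continuous_mode)) 0 b

theorem IsSolution.wronskian {E : ℝ} {ψ q χ s : ℝ → ℂ} (h : M.IsSolution E ψ q)
    (h' : M.IsSolution E χ s) (x : ℝ) : ψ x * s x - q x * χ x = ψ 0 * s 0 - q 0 * χ 0 := by
  have := h.lagrange h' x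
  simp only [sub_self, Complex.ofReal_zero, zero_mul, mul_zero,
    intervalIntegral.integral_zero] at this
  exact (sub_eq_zero.1 this.symm)

theorem wronskian_eq_one (E x : ℝ) : M.y₁ E x * M.w₂ E x - M.w₁ E x * M.y₂ E x = 1 := by
  have := (M.isSolution_y₁ E).wronskian (M.isSolution_y₂ E) x
  simp only [y₁_zero, w₁_zero, y₂_zero, w₂_zero] at this
  push_cast at this
  have h : ((M.y₁ E x * M.w₂ E x - M.w₁ E x * M.y₂ E x : ℝ) : ℂ) = (1 : ℝ) := by
    push_cast; rw [this]; ring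
  exact_mod_cast h

/-- Uniqueness by Cramer's rule: the Wronskians with the two fundamental solutions are constant and
determine `ψ x` and `q x`, the determinant of the linear system being `1`. -/
theorem IsSolution.eq {E : ℝ} {ψ q : ℝ → ℂ} (h : M.IsSolution E ψ q) (x : ℝ) :
    ψ x = ψ 0 * M.y₁ E x + q 0 * M.y₂ E x ∧ q x = ψ 0 * M.w₁ E x + q 0 * M.w₂ E x := by
  have h1 := h.wronskian (M.isSolution_y₁ E) x
  have h2 := h.wronskian (M.isSolution_y₂ E) x
  have h3 : (M.y₁ E x : ℂ) * M.w₂ E x - M.w₁ E x * M.y₂ E x = 1 := by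
    exact_mod_cast M.wronskian_eq_one E x
  simp only [y₁_zero, w₁_zero, y₂_zero, w₂_zero, Complex.ofReal_one, Complex.ofReal_zero] at h1 h2
  constructor
  · linear_combination (-ψ x) * h3 - (M.y₂ E x : ℂ) * h1 + (M.y₁ E x : ℂ) * h2
  · linear_combination (-q x) * h3 - (M.w₂ E x : ℂ) * h1 + (M.w₁ E x : ℂ) * h2

theorem isSolution_combination (E : ℝ) (a b : ℂ) :
    M.IsSolution E (fun x => a * M.y₁ E x + b * M.y₂ E x)
      fun x => a * M.w₁ E x + b * M.w₂ E x where
  continuous_mode := ((M.isSolution_y₁ E).continuous_mode.const_mul a).add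
    ((M.isSolution_y₂ E).continuous_mode.const_mul b)
  continuous_flux := ((M.isSolution_y₁ E).continuous_flux.const_mul a).add
    ((M.isSolution_y₂ E).continuous_flux.const_mul b)
  deriv_mode x hx := by
    refine ((((M.isSolution_y₁ E).deriv_mode x hx).const_mul a).add
      (((M.isSolution_y₂ E).deriv_mode x hx).const_mul b)).congr_deriv ?_
    ring
  deriv_flux x hx := by
    refine ((((M.isSolution_y₁ E).deriv_flux x hx).const_mul a).add
      (((M.isSolution_y₂ E).deriv_flux x hx).const_mul b)).congr_deriv ?_
    ring

theorem solution_fst (E : ℝ) (a b : ℂ) :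
    (M.solution E a b).1 = fun x => a * M.y₁ E x + b * M.y₂ E x := by
  have h : ∃ p : (ℝ → ℂ) × (ℝ → ℂ), M.IsSolution E p.1 p.2 ∧ p.1 0 = a ∧ p.2 0 = b :=
    ⟨⟨_, _⟩, M.isSolution_combination E a b, by simp, by simp⟩
  obtain ⟨h1, h2, h3⟩ := Classical.epsilon_spec h
  funext x
  have := (h1.eq x).1
  rw [h2, h3] at this
  exact this

theorem psi₁_eq (E : ℝ) : M.psi₁ E = fun x => (M.y₁ E x : ℂ) := by
  rw [psi₁, solution_fst]; simp

theorem psi₂_eq (E : ℝ) : M.psi₂ E = fun x => (M.y₂ E x : ℂ) := by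
  rw [psi₂, solution_fst]; simp

theorem IsSolution.translate {E : ℝ} {ψ q : ℝ → ℂ} (h : M.IsSolution E ψ q) :
    M.IsSolution E (fun x => ψ (x + 1)) fun x => q (x + 1) where
  continuous_mode := h.continuous_mode.comp (continuous_id.add continuous_const)
  continuous_flux := h.continuous_flux.comp (continuous_id.add continuous_const)
  deriv_mode x hx := by
    have h1 : ContinuousAt M.μ (x + 1) := by
      have : M.μ = fun y => M.μ (y - 1) := funext fun y => (M.μ_periodic.sub_eq y).symm
      rw [this]
      refine ContinuousAt.comp (f := fun y : ℝ => y - 1) (g := M.μ) ?_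
        (continuous_id.sub continuous_const).continuousAt
      simpa using hx
    have := (h.deriv_mode (x + 1) h1).comp_add_const x 1
    rwa [M.μ_periodic] at this
  deriv_flux x hx := by
    have h1 : ContinuousAt M.ε (x + 1) := by
      have : M.ε = fun y => M.ε (y - 1) := funext fun y => (M.ε_periodic.sub_eq y).symm
      rw [this]
      refine ContinuousAt.comp (f := fun y : ℝ => y - 1) (g := M.ε) ?_
        (continuous_id.sub continuous_const).continuousAt
      simpa using hx
    have := (h.deriv_flux (x + 1) h1).comp_add_const x 1
    rwa [M.ε_periodic] at this

theorem y₁_add_one (E x : ℝ) :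
    M.y₁ E (x + 1) = M.y₁ E 1 * M.y₁ E x + M.w₁ E 1 * M.y₂ E x ∧
    M.w₁ E (x + 1) = M.y₁ E 1 * M.w₁ E x + M.w₁ E 1 * M.w₂ E x := by
  have := (M.isSolution_y₁ E).translate.eq x
  simp only [zero_add] at this
  exact_mod_cast this

theorem y₂_add_one (E x : ℝ) :
    M.y₂ E (x + 1) = M.y₂ E 1 * M.y₁ E x + M.w₂ E 1 * M.y₂ E x ∧
    M.w₂ E (x + 1) = M.y₂ E 1 * M.w₁ E x + M.w₂ E 1 * M.w₂ E x := by
  have := (M.isSolution_y₂ E).translate.eq x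
  simp only [zero_add] at this
  exact_mod_cast this

theorem even_y₁ (hM : M.InversionSymmetric) (E : ℝ) : Function.Even (M.y₁ E) :=
  even_entireSeries_evenIterate hM.1 hM.2 _

theorem odd_y₂ (hM : M.InversionSymmetric) (E : ℝ) : Function.Odd (M.y₂ E) :=
  odd_entireSeries_oddIterate hM.2 hM.1 _

theorem even_w₂ (hM : M.InversionSymmetric) (E : ℝ) : Function.Even (M.w₂ E) :=
  even_entireSeries_evenIterate hM.2 hM.1 _

theorem odd_w₁ (hM : M.InversionSymmetric) (E : ℝ) : Function.Odd (M.w₁ E) := fun x => by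
  rw [w₁, w₁, odd_entireSeries_oddIterate hM.1 hM.2]; ring

/-- At `x = -1` the translation formulas and the parities give `y₁(1)² - w₁(1) y₂(1) = 1` and
`w₂(1)² - w₁(1) y₂(1) = 1`. Together with the Wronskian they say `(w₂(1) - y₁(1))² = 0`. -/
theorem w₂_one (hM : M.InversionSymmetric) (E : ℝ) : M.w₂ E 1 = M.y₁ E 1 := by
  have h1 := (M.y₁_add_one E (-1)).1
  have h2 := (M.y₂_add_one E (-1)).2
  have h3 := M.wronskian_eq_one E 1
  rw [neg_add_cancel, M.even_y₁ hM, M.odd_y₂ hM, y₁_zero] at h1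
  rw [neg_add_cancel, M.odd_w₁ hM, M.even_w₂ hM, w₂_zero] at h2
  have : (M.w₂ E 1 - M.y₁ E 1) ^ 2 = 0 := by linear_combination -h1 - h2 - 2 * h3
  have := pow_eq_zero_iff (two_ne_zero) |>.1 this
  linarith

/-! ### The discriminant and its derivative. -/

variable (M)

/-- Half the discriminant of the equation. -/
noncomputable def disc (E : ℝ) : ℝ := M.y₁ E 1

/-- The value `ψ_{E,2}(1)`. -/
noncomputable def upper (E : ℝ) : ℝ := M.y₂ E 1

/-- The flux of `ψ_{E,1}` at `1`. -/
noncomputable def lower (E : ℝ) : ℝ := M.w₁ E 1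

/-- The squared norm of `ψ_{E,1}`. -/
noncomputable def normSq₁ (E : ℝ) : ℝ := ∫ x in (0 : ℝ)..1, M.ε x * (M.y₁ E x * M.y₁ E x)

/-- The squared norm of `ψ_{E,2}`. -/
noncomputable def normSq₂ (E : ℝ) : ℝ := ∫ x in (0 : ℝ)..1, M.ε x * (M.y₂ E x * M.y₂ E x)

variable {M}

theorem disc_sq (hM : M.InversionSymmetric) (E : ℝ) :
    M.disc E ^ 2 = 1 + M.upper E * M.lower E := by
  have := M.wronskian_eq_one E 1
  rw [w₂_one hM] at this
  rw [disc, upper, lower]; linarith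

theorem continuous_normSq₁ : Continuous M.normSq₁ :=
  M.isWeight_ε.continuous_integral (F := fun E x => M.y₁ E x * M.y₁ E x)
    (M.continuous_uncurry_y₁.mul M.continuous_uncurry_y₁)

theorem continuous_normSq₂ : Continuous M.normSq₂ :=
  M.isWeight_ε.continuous_integral (F := fun E x => M.y₂ E x * M.y₂ E x)
    (M.continuous_uncurry_y₂.mul M.continuous_uncurry_y₂)

/-- The integrand is nonnegative, so nonvanishing near `0` is enough; the split point `min δ 1`
allows for `δ > 1`. -/
theorem integral_weight_sq_pos {g u : ℝ → ℝ} (hg : IsWeight g) (hu : Continuous u)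
    {δ : ℝ} (hδ : 0 < δ) (hpos : ∀ x ∈ Ioo 0 δ, u x ≠ 0) :
    0 < ∫ x in (0 : ℝ)..1, g x * (u x * u x) := by
  have hc : ∀ a b, IntervalIntegrable (fun x => g x * (u x * u x)) MeasureTheory.volume a b :=
    hg.intervalIntegrable_mul (hu.mul hu)
  have h0 : 0 < min δ 1 := lt_min hδ one_pos
  rw [← intervalIntegral.integral_add_adjacent_intervals (hc 0 (min δ 1)) (hc (min δ 1) 1)]
  refine add_pos_of_pos_of_nonneg ?_ ?_
  · refine intervalIntegral.intervalIntegral_pos_of_pos_on (hc _ _) (fun x hx => ?_) h0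
    exact mul_pos (hg.pos x)
      (mul_self_pos.2 (hpos x ⟨hx.1, hx.2.trans_le (min_le_left _ _)⟩))
  · exact intervalIntegral.integral_nonneg (min_le_right _ _) fun x _ =>
      mul_nonneg (hg.pos x).le (mul_self_nonneg _)

theorem normSq₁_pos (E : ℝ) : 0 < M.normSq₁ E := by
  have h : ∀ᶠ x in 𝓝 (0 : ℝ), 0 < M.y₁ E x :=
    (M.continuous_y₁ E).continuousAt.eventually_const_lt (by simp)
  obtain ⟨δ, hδ, h⟩ := Metric.eventually_nhds_iff.1 h
  refine integral_weight_sq_pos M.isWeight_ε (M.continuous_y₁ E) hδ fun x hx => (h ?_).ne'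
  rw [Real.dist_0_eq_abs, abs_of_pos hx.1]; exact hx.2

/-- `y₂` is the primitive of `μ w₂` with `w₂ = 1` at `0`. The integral form is used because `y₂`
need not be differentiable at `0`, where `μ` may jump. -/
theorem y₂_pos_near_zero (E : ℝ) : ∃ δ > 0, ∀ x ∈ Ioo 0 δ, 0 < M.y₂ E x := by
  have h : ∀ᶠ x in 𝓝 (0 : ℝ), 0 < M.w₂ E x :=
    (M.continuous_w₂ E).continuousAt.eventually_const_lt (by simp)
  obtain ⟨δ, hδ, h⟩ := Metric.eventually_nhds_iff.1 h
  refine ⟨δ, hδ, fun x hx => ?_⟩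
  rw [y₂_eq]
  refine intervalIntegral.intervalIntegral_pos_of_pos_on
    (M.isWeight_μ.intervalIntegrable_mul (M.continuous_w₂ E) 0 x) (fun t ht => ?_) hx.1
  refine mul_pos (M.μ_pos t) (h ?_)
  rw [Real.dist_0_eq_abs, abs_of_pos ht.1]; exact ht.2.trans hx.2

theorem normSq₂_pos (E : ℝ) : 0 < M.normSq₂ E := by
  obtain ⟨δ, hδ, h⟩ := M.y₂_pos_near_zero E
  exact integral_weight_sq_pos M.isWeight_ε (M.continuous_y₂ E) hδ fun x hx => (h x hx).ne'

variable (M)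

/-- The derivative of the discriminant. -/
noncomputable def dDisc (E : ℝ) : ℝ := M.dy₁ E 1

variable {M}

theorem hasDerivAt_disc (E : ℝ) : HasDerivAt M.disc (M.dDisc E) E := M.hasDerivAt_y₁ E 1

theorem continuous_dDisc : Continuous M.dDisc :=
  M.continuous_uncurry_dy₁.comp (continuous_id.prodMk continuous_const)

theorem differentiable_upper : Differentiable ℝ M.upper := fun E =>
  (M.hasDerivAt_y₂ E 1).differentiableAt

theorem differentiable_lower : Differentiable ℝ M.lower := M.differentiable_w₁ 1

/-- Lagrange's identity at energies `E`, `E'` equates the mixed boundary form with `(E - E')` times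
the overlap of the solutions. The claim is its derivative in `E'` at `E' = E`. -/
theorem lagrange_y₁ (E : ℝ) :
    M.disc E * deriv M.lower E - M.lower E * M.dDisc E = -M.normSq₁ E := by
  set I : ℝ → ℝ := fun E' => ∫ x in (0 : ℝ)..1, M.ε x * (M.y₁ E x * M.y₁ E' x)
  have hI : Continuous I := M.isWeight_ε.continuous_integral (F := fun E' x => M.y₁ E x * M.y₁ E' x)
    (((M.continuous_y₁ E).comp continuous_snd).mul M.continuous_uncurry_y₁)
  have e : (fun E' => M.disc E * M.lower E' - M.lower E * M.disc E') =
      fun E' => (E - E') * I E' := by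
    funext E'
    have h := (M.isSolution_y₁ E).lagrange (M.isSolution_y₁ E') 1
    simp only [y₁_zero, w₁_zero] at h
    rw [← intervalIntegral.integral_const_mul]
    have h' : ((∫ x in (0 : ℝ)..1, (E - E') * (M.ε x * (M.y₁ E x * M.y₁ E' x)) : ℝ) : ℂ) =
        ((M.disc E * M.lower E' - M.lower E * M.disc E' : ℝ) : ℂ) := by
      rw [← intervalIntegral.integral_ofReal]
      simp only [disc, lower]
      push_cast at h ⊢
      simp only [mul_zero, zero_mul, sub_zero] at h
      rw [← h]
      congr 1
      funext x
      ring
    exact_mod_cast h'.symm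
  have h1 := ((differentiable_lower (M := M) E).hasDerivAt.const_mul (M.disc E)).sub
    ((hasDerivAt_disc (M := M) E).const_mul (M.lower E))
  have h2 := hasDerivAt_sub_mul (a := E) hI.continuousAt
  exact (h1.congr_of_eventuallyEq (Eventually.of_forall fun t => (congrFun e t).symm)).unique h2

theorem lagrange_y₂ (hM : M.InversionSymmetric) (E : ℝ) :
    M.upper E * M.dDisc E - M.disc E * deriv M.upper E = -M.normSq₂ E := by
  set I : ℝ → ℝ := fun E' => ∫ x in (0 : ℝ)..1, M.ε x * (M.y₂ E x * M.y₂ E' x)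
  have hI : Continuous I := M.isWeight_ε.continuous_integral (F := fun E' x => M.y₂ E x * M.y₂ E' x)
    (((M.continuous_y₂ E).comp continuous_snd).mul M.continuous_uncurry_y₂)
  have e : (fun E' => M.upper E * M.disc E' - M.disc E * M.upper E') =
      fun E' => (E - E') * I E' := by
    funext E'
    have h := (M.isSolution_y₂ E).lagrange (M.isSolution_y₂ E') 1
    simp only [y₂_zero, w₂_zero, w₂_one hM] at h
    rw [← intervalIntegral.integral_const_mul]
    have h' : ((∫ x in (0 : ℝ)..1, (E - E') * (M.ε x * (M.y₂ E x * M.y₂ E' x)) : ℝ) : ℂ) =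
        ((M.upper E * M.disc E' - M.disc E * M.upper E' : ℝ) : ℂ) := by
      rw [← intervalIntegral.integral_ofReal]
      simp only [disc, upper]
      push_cast at h ⊢
      simp only [mul_zero, zero_mul, sub_zero] at h
      rw [← h]
      congr 1
      funext x
      ring
    exact_mod_cast h'.symm
  have h1 := ((hasDerivAt_disc (M := M) E).const_mul (M.upper E)).sub
    ((differentiable_upper (M := M) E).hasDerivAt.const_mul (M.disc E))
  have h2 := hasDerivAt_sub_mul (a := E) hI.continuousAt
  exact (h1.congr_of_eventuallyEq (Eventually.of_forall fun t => (congrFun e t).symm)).unique h2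

/-- Differentiate `D² = 1 + upper · lower`, multiply by `D`, and eliminate the derivatives of
`upper` and `lower` by the two Lagrange identities. What remains carries the factor `D² - upper ·
lower = 1`, so no division by `D` is needed. -/
theorem two_mul_dDisc (hM : M.InversionSymmetric) (E : ℝ) :
    2 * M.dDisc E = M.lower E * M.normSq₂ E - M.upper E * M.normSq₁ E := by
  have h1 := lagrange_y₁ (M := M) E
  have h2 := lagrange_y₂ hM E
  have h3 := disc_sq hM E
  have h4 : 2 * M.disc E * M.dDisc E =
      deriv M.upper E * M.lower E + M.upper E * deriv M.lower E := by
    have e := ((hasDerivAt_disc (M := M) E).pow 2)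
    have e' := ((differentiable_upper (M := M) E).hasDerivAt.mul
      (differentiable_lower (M := M) E).hasDerivAt).const_add 1
    have := (e.congr_of_eventuallyEq (Eventually.of_forall fun t => (disc_sq hM t).symm)).unique e'
    simpa using this
  linear_combination (-2 * M.dDisc E) * h3 + M.disc E * h4 + M.upper E * h1 - M.lower E * h2

theorem one_lt_disc {E : ℝ} (hE : E < 0) : 1 < M.disc E :=
  one_lt_entireSeries_evenIterate M.isWeight_ε M.isWeight_μ (neg_pos.2 hE)

/-! ### Multiplicities of the eigenvalues. -/

/-- The initial data `(ψ 0, q 0)` must form an eigenvector of the monodromy matrix for the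
eigenvalue `e^{ik}`. -/
theorem mem_blochSpace_iff (hM : M.InversionSymmetric) (k E : ℝ) (ψ : ℝ → ℂ) :
    ψ ∈ M.blochSpace k E ↔ ∃ a b : ℂ, (ψ = fun x => a * M.y₁ E x + b * M.y₂ E x) ∧
      a * M.disc E + b * M.upper E = Complex.exp (Complex.I * k) * a ∧
      a * M.lower E + b * M.disc E = Complex.exp (Complex.I * k) * b := by
  constructor
  · rintro ⟨⟨q, hq⟩, hψ⟩
    have h1 := hψ 0
    rw [zero_add] at h1
    have e1 := hq.eq 1
    rw [w₂_one hM] at e1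
    refine ⟨ψ 0, q 0, funext fun x => (hq.eq x).1, by rw [← h1]; exact e1.1.symm, ?_⟩
    -- The Bloch condition speaks only of `ψ`. Comparing `ψ (x + 1)` with `e^{ik} ψ x` at a point
    -- where `y₂` does not vanish yields the missing condition on the flux.
    obtain ⟨δ, hδ, hpos⟩ := M.y₂_pos_near_zero E
    have hne : (M.y₂ E (δ / 2) : ℂ) ≠ 0 := by
      exact_mod_cast (hpos (δ / 2) ⟨by linarith, by linarith⟩).ne'
    have h2 := (hq.translate.eq (δ / 2)).1
    simp only [zero_add] at h2
    rw [hψ, h1, (hq.eq _).1] at h2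
    have h3 := e1.2
    apply mul_right_cancel₀ hne
    change (ψ 0 * (M.w₁ E 1 : ℂ) + q 0 * (M.y₁ E 1 : ℂ)) * _ = _
    rw [← h3]
    linear_combination -h2
  · rintro ⟨a, b, rfl, h1, h2⟩
    refine ⟨⟨_, M.isSolution_combination E a b⟩, fun x => ?_⟩
    have e1 := (M.y₁_add_one E x).1
    have e2 := (M.y₂_add_one E x).1
    rw [w₂_one hM] at e2
    beta_reduce
    rw [e1, e2]
    simp only [disc, upper, lower] at h1 h2
    push_cast
    linear_combination (M.y₁ E x : ℂ) * h1 + (M.y₂ E x : ℂ) * h2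

theorem exp_I_mul_sq_add_one (k : ℝ) :
    Complex.exp (Complex.I * k) ^ 2 + 1 = 2 * Complex.exp (Complex.I * k) * Real.cos k := by
  rw [mul_comm Complex.I, Complex.exp_mul_I]
  have := Complex.sin_sq_add_cos_sq (k : ℂ)
  push_cast
  linear_combination (-1 : ℂ) * this + Complex.sin k ^ 2 * Complex.I_sq

theorem disc_sq_complex (hM : M.InversionSymmetric) (E : ℝ) :
    (M.disc E : ℂ) ^ 2 = 1 + M.upper E * M.lower E := by
  exact_mod_cast disc_sq hM E

/-- With `z = e^{ik}`, the characteristic polynomial `z² - 2 D z + 1` equals `2 z (cos k - D)`. The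
adjugate matrix shows that this factor kills the initial data. -/
theorem finrank_blochSpace_eq_zero (hM : M.InversionSymmetric) {k E : ℝ}
    (h : M.disc E ≠ Real.cos k) : Module.finrank ℂ (M.blochSpace k E) = 0 := by
  have : M.blochSpace k E = ⊥ := by
    rw [Submodule.eq_bot_iff]
    intro ψ hψ
    obtain ⟨a, b, rfl, h1, h2⟩ := (mem_blochSpace_iff hM k E ψ).1 hψ
    have hd := disc_sq_complex hM E
    have he := exp_I_mul_sq_add_one k
    set z := Complex.exp (Complex.I * k)
    have hne : 2 * z * ((Real.cos k : ℂ) - M.disc E) ≠ 0 := by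
      refine mul_ne_zero (mul_ne_zero two_ne_zero (Complex.exp_ne_zero _)) (sub_ne_zero.2 ?_)
      exact_mod_cast h.symm
    have ha : a = 0 := by
      apply mul_right_cancel₀ hne
      linear_combination -a * hd - a * he + (M.disc E - z) * h1 - (M.upper E : ℂ) * h2
    have hb : b = 0 := by
      apply mul_right_cancel₀ hne
      linear_combination -b * hd - b * he + (M.disc E - z) * h2 - (M.lower E : ℂ) * h1
    funext x
    simp [ha, hb]
  rw [this, finrank_bot]

theorem exp_I_mul_of_degenerate (hM : M.InversionSymmetric) {k E : ℝ}
    (h : M.disc E = Real.cos k) (hp : M.upper E = 0) :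
    Complex.exp (Complex.I * k) = M.disc E := by
  have h1 := disc_sq hM E
  rw [hp, zero_mul, add_zero, h] at h1
  have h2 : Real.sin k = 0 := by
    have := Real.sin_sq_add_cos_sq k
    rw [h1] at this
    exact pow_eq_zero_iff two_ne_zero |>.1 (by linarith)
  rw [mul_comm Complex.I, Complex.exp_mul_I, h, ← Complex.ofReal_sin, h2]
  simp

/-- The monodromy matrix is the scalar `e^{ik}`, so every solution is a Bloch mode. -/
theorem finrank_blochSpace_eq_two (hM : M.InversionSymmetric) {k E : ℝ}
    (h : M.disc E = Real.cos k) (hp : M.upper E = 0) (hr : M.lower E = 0) :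
    Module.finrank ℂ (M.blochSpace k E) = 2 := by
  have hz := exp_I_mul_of_degenerate hM h hp
  let L : ℂ × ℂ →ₗ[ℂ] M.blochSpace k E :=
    { toFun := fun v => ⟨fun x => v.1 * M.y₁ E x + v.2 * M.y₂ E x,
        (mem_blochSpace_iff hM k E _).2 ⟨v.1, v.2, rfl, by rw [hz, hp]; push_cast; ring,
          by rw [hz, hr]; push_cast; ring⟩⟩
      map_add' := fun v w => by
        ext x
        simp only [Prod.fst_add, Prod.snd_add, Submodule.coe_add, Pi.add_apply]
        ring
      map_smul' := fun c v => by
        ext x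
        simp only [Prod.smul_fst, Prod.smul_snd, smul_eq_mul, RingHom.id_apply,
          Submodule.coe_smul, Pi.smul_apply]
        ring }
  have hL : Function.Bijective L := by
    constructor
    · rw [← LinearMap.ker_eq_bot, LinearMap.ker_eq_bot']
      rintro ⟨a, b⟩ hab
      have h0 : ∀ x, a * M.y₁ E x + b * M.y₂ E x = 0 := fun x =>
        congrFun (congrArg Subtype.val hab) x
      have ha : a = 0 := by simpa using h0 0
      obtain ⟨δ, hδ, hpos⟩ := M.y₂_pos_near_zero E
      have hne : (M.y₂ E (δ / 2) : ℂ) ≠ 0 := by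
        exact_mod_cast (hpos (δ / 2) ⟨by linarith, by linarith⟩).ne'
      have hb : b = 0 := by simpa [ha, hne] using h0 (δ / 2)
      rw [ha, hb]; rfl
    · rintro ⟨ψ, hψ⟩
      obtain ⟨a, b, h, -, -⟩ := (mem_blochSpace_iff hM k E ψ).1 hψ
      exact ⟨(a, b), Subtype.ext h.symm⟩
  rw [← (LinearEquiv.ofBijective L hL).finrank_eq]
  simp

theorem finrank_blochSpace_eq_one (hM : M.InversionSymmetric) {k E : ℝ}
    (h : M.disc E = Real.cos k) (hpr : ¬ (M.upper E = 0 ∧ M.lower E = 0)) :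
    Module.finrank ℂ (M.blochSpace k E) = 1 := by
  have hd := disc_sq_complex hM E
  have he := exp_I_mul_sq_add_one k
  have hy : ∃ x, (M.y₂ E x : ℂ) ≠ 0 := by
    obtain ⟨δ, hδ, hpos⟩ := M.y₂_pos_near_zero E
    exact ⟨δ / 2, by exact_mod_cast (hpos (δ / 2) ⟨by linarith, by linarith⟩).ne'⟩
  rw [← h] at he
  by_cases hp : M.upper E = 0
  · have hr : (M.lower E : ℂ) ≠ 0 := by exact_mod_cast fun h' => hpr ⟨hp, h'⟩
    have hz := exp_I_mul_of_degenerate hM h hp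
    refine finrank_eq_one_iff'.2 ⟨⟨fun x => 0 * M.y₁ E x + 1 * M.y₂ E x,
      (mem_blochSpace_iff hM k E _).2 ⟨0, 1, rfl, by rw [hp]; simp, by rw [hz]; ring⟩⟩, ?_, ?_⟩
    · obtain ⟨x, hx⟩ := hy
      intro h0
      apply hx
      simpa using congrFun (congrArg Subtype.val h0) x
    · rintro ⟨ψ, hψ⟩
      obtain ⟨a, b, rfl, -, h2⟩ := (mem_blochSpace_iff hM k E ψ).1 hψ
      have ha : a = 0 := by
        rw [hz] at h2
        exact mul_right_cancel₀ hr (by linear_combination h2)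
      refine ⟨b, Subtype.ext (funext fun x => ?_)⟩
      simp [ha]
  · have hp' : (M.upper E : ℂ) ≠ 0 := by exact_mod_cast hp
    set z := Complex.exp (Complex.I * k)
    refine finrank_eq_one_iff'.2 ⟨⟨fun x => M.upper E * M.y₁ E x + (z - M.disc E) * M.y₂ E x,
      (mem_blochSpace_iff hM k E _).2 ⟨M.upper E, z - M.disc E, rfl, by ring, ?_⟩⟩, ?_, ?_⟩
    · linear_combination -he - hd
    · intro h0
      apply hp'
      simpa using congrFun (congrArg Subtype.val h0) 0
    · rintro ⟨ψ, hψ⟩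
      obtain ⟨a, b, rfl, h1, -⟩ := (mem_blochSpace_iff hM k E ψ).1 hψ
      refine ⟨a / M.upper E, Subtype.ext (funext fun x => ?_)⟩
      change a / (M.upper E : ℂ) * (M.upper E * M.y₁ E x + (z - M.disc E) * M.y₂ E x) =
        a * M.y₁ E x + b * M.y₂ E x
      have hb : b = a / (M.upper E : ℂ) * (z - M.disc E) := by
        field_simp
        linear_combination h1
      rw [hb]
      field_simp

/-- For `|D| ≤ 1` one has `upper · lower = D² - 1 ≤ 0`. The two terms of `two_mul_dDisc` then cannot
cancel unless both vanish. -/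
theorem degenerate_iff_dDisc_eq_zero (hM : M.InversionSymmetric) {E : ℝ} (h : |M.disc E| ≤ 1) :
    (M.upper E = 0 ∧ M.lower E = 0) ↔ M.dDisc E = 0 := by
  have h1 := two_mul_dDisc hM E
  have h2 := disc_sq hM E
  have hA := normSq₁_pos (M := M) E
  have hB := normSq₂_pos (M := M) E
  constructor
  · rintro ⟨hp, hr⟩
    rw [hp, hr] at h1; linarith
  · intro h0
    rw [h0] at h1
    have h3 : M.upper E * M.lower E ≤ 0 := by
      have := (sq_le_one_iff_abs_le_one _).2 h
      linarith
    have h4 : M.upper E ^ 2 * M.normSq₁ E = (M.upper E * M.lower E) * M.normSq₂ E := by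
      linear_combination M.upper E * h1
    have h5 : M.upper E ^ 2 * M.normSq₁ E ≤ 0 := by
      rw [h4]; exact mul_nonpos_of_nonpos_of_nonneg h3 hB.le
    have hp : M.upper E = 0 := by
      by_contra hne
      have := mul_pos (pow_pos (abs_pos.2 hne) 2) hA
      rw [sq_abs] at this
      linarith
    refine ⟨hp, ?_⟩
    rw [hp] at h1
    have : M.lower E * M.normSq₂ E = 0 := by linarith
    exact (mul_eq_zero.1 this).resolve_right hB.ne'

theorem finrank_blochSpace (hM : M.InversionSymmetric) (k E : ℝ) :
    Module.finrank ℂ (M.blochSpace k E) =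
      if M.disc E = Real.cos k then (if M.dDisc E = 0 then 2 else 1) else 0 := by
  split_ifs with h h'
  · have := (degenerate_iff_dDisc_eq_zero hM (by rw [h]; exact Real.abs_cos_le_one k)).2 h'
    exact finrank_blochSpace_eq_two hM h this.1 this.2
  · refine finrank_blochSpace_eq_one hM h fun hpr => h' ?_
    exact (degenerate_iff_dDisc_eq_zero hM (by rw [h]; exact Real.abs_cos_le_one k)).1 hpr
  · exact finrank_blochSpace_eq_zero hM h

/-! ### Folds of the discriminant at degenerate energies. -/

theorem eventually_mul_pos_of_hasDerivAt {g : ℝ → ℝ} {g' a : ℝ} (hg : HasDerivAt g g' a)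
    (h0 : g a = 0) (hpos : 0 < g') : ∀ᶠ t in 𝓝[≠] a, 0 < g t * (t - a) := by
  have h := (hasDerivAt_iff_tendsto_slope.1 hg).eventually (lt_mem_nhds hpos)
  filter_upwards [h, self_mem_nhdsWithin] with t ht hta
  have hne : t - a ≠ 0 := sub_ne_zero.2 hta
  rw [slope_def_field, h0, sub_zero] at ht
  have := mul_pos ht (mul_self_pos.2 hne)
  rwa [← mul_assoc, div_mul_cancel₀ _ hne] at this

theorem hasDerivAt_upper_of_degenerate (hM : M.InversionSymmetric) {E : ℝ}
    (hp : M.upper E = 0) : HasDerivAt M.upper (M.disc E * M.normSq₂ E) E := by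
  refine (differentiable_upper E).hasDerivAt.congr_deriv ?_
  have h1 := lagrange_y₂ hM E
  have h2 := disc_sq hM E
  rw [hp] at h1 h2
  linear_combination (-deriv M.upper E) * h2 - M.disc E * h1

theorem hasDerivAt_lower_of_degenerate (hM : M.InversionSymmetric) {E : ℝ}
    (hr : M.lower E = 0) : HasDerivAt M.lower (-(M.disc E * M.normSq₁ E)) E := by
  refine (differentiable_lower E).hasDerivAt.congr_deriv ?_
  have h1 := lagrange_y₁ (M := M) E
  have h2 := disc_sq hM E
  rw [hr] at h1 h2
  linear_combination (-deriv M.lower E) * h2 + M.disc E * h1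

/-- At a degenerate energy `upper` and `lower` vanish with derivatives `D ‖ψ_{E,2}‖²` and `-D
‖ψ_{E,1}‖²`. Their signs nearby give the sign of `D'` through `two_mul_dDisc`, without a second
derivative of `D`. -/
theorem disc_fold (hM : M.InversionSymmetric) {z : ℝ} (h : |M.disc z| ≤ 1) (h' : M.dDisc z = 0) :
    M.disc z ^ 2 = 1 ∧ ∀ᶠ E in 𝓝[≠] z, M.disc z * M.dDisc E * (E - z) < 0 := by
  obtain ⟨hp, hr⟩ := (degenerate_iff_dDisc_eq_zero hM h).2 h'
  have h1 : M.disc z ^ 2 = 1 := by rw [disc_sq hM, hp, zero_mul, add_zero]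
  refine ⟨h1, ?_⟩
  have e1 := eventually_mul_pos_of_hasDerivAt
    ((hasDerivAt_upper_of_degenerate hM hp).const_mul (M.disc z)) (by simp [hp]) (by
      rw [← mul_assoc, ← sq, h1, one_mul]; exact normSq₂_pos z)
  have e2 := eventually_mul_pos_of_hasDerivAt
    ((hasDerivAt_lower_of_degenerate hM hr).const_mul (-M.disc z)) (by simp [hr]) (by
      rw [neg_mul_neg, ← mul_assoc, ← sq, h1, one_mul]; exact normSq₁_pos z)
  filter_upwards [e1, e2] with E h3 h4
  have h5 := two_mul_dDisc hM E
  have h6 := mul_pos h3 (normSq₁_pos (M := M) E)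
  have h7 := mul_pos h4 (normSq₂_pos (M := M) E)
  have h8 : 2 * (M.disc z * M.dDisc E * (E - z)) =
      -(-M.disc z * M.lower E * (E - z) * M.normSq₂ E) -
        M.disc z * M.upper E * (E - z) * M.normSq₁ E := by
    linear_combination (M.disc z * (E - z)) * h5
  linarith

end PhotonicMedium

/-! ### Counting the solutions of `f = c` with multiplicity. -/

/-- A differentiable function that crosses every level in `(-1, 1)` transversally and turns back
at every critical point on the levels `1` and `-1`. -/
structure IsDiscriminant (f f' : ℝ → ℝ) : Prop where
  hasDerivAt : ∀ E, HasDerivAt f (f' E) E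
  continuous_deriv : Continuous f'
  fold : ∀ z, |f z| ≤ 1 → f' z = 0 →
    f z ^ 2 = 1 ∧ ∀ᶠ E in 𝓝[≠] z, f z * f' E * (E - z) < 0

open Classical in
/-- The multiplicity of `l` as a solution of `f l = c`. -/
noncomputable def levelMult (f f' : ℝ → ℝ) (c l : ℝ) : ℕ :=
  if f l = c then (if f' l = 0 then 2 else 1) else 0

theorem levelMult_neg (f f' : ℝ → ℝ) (c l : ℝ) :
    levelMult (-f) (-f') (-c) l = levelMult f f' c l := by
  simp [levelMult]

namespace IsDiscriminant

variable {f f' : ℝ → ℝ}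

/-- Reduces decreasing crossings and folds at level `-1` to increasing crossings and folds at level
`1`. -/
theorem neg (hf : IsDiscriminant f f') : IsDiscriminant (-f) (-f') where
  hasDerivAt E := (hf.hasDerivAt E).neg
  continuous_deriv := hf.continuous_deriv.neg
  fold z h h' := by
    obtain ⟨h1, h2⟩ := hf.fold z (by simpa using h) (by simpa using h')
    exact ⟨by simpa using h1, by simpa using h2⟩

theorem continuous (hf : IsDiscriminant f f') : Continuous f :=
  continuous_iff_continuousAt.2 fun E => (hf.hasDerivAt E).continuousAt

/-- The solutions of `f = c` near `z` have the same total multiplicity as `z` has as a solution of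
`f = c₀`. -/
def LocalCount (f f' : ℝ → ℝ) (c₀ z δ : ℝ) : Prop :=
  ∀ᶠ c in 𝓝[Icc (-1) 1] c₀, ∃ t : Finset ℝ, (∀ l, l ∈ t ↔ l ∈ Ioo (z - δ) (z + δ) ∧ f l = c) ∧
    ∑ l ∈ t, levelMult f f' c l = levelMult f f' c₀ z

theorem LocalCount.of_neg {c₀ z δ : ℝ} (h : LocalCount (-f) (-f') (-c₀) z δ) :
    LocalCount f f' c₀ z δ := by
  have ht : Tendsto (fun c : ℝ => -c) (𝓝[Icc (-1) 1] c₀) (𝓝[Icc (-1) 1] (-c₀)) := by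
    refine tendsto_nhdsWithin_iff.2
      ⟨(continuous_neg.tendsto c₀).mono_left nhdsWithin_le_nhds, ?_⟩
    filter_upwards [self_mem_nhdsWithin] with c hc
    exact ⟨neg_le_neg hc.2, by linarith [hc.1]⟩
  filter_upwards [ht.eventually h] with c ⟨t, h1, h2⟩
  refine ⟨t, fun l => ?_, ?_⟩
  · rw [h1]; simp
  · simpa only [levelMult_neg] using h2

theorem localCount_of_pos (hf : IsDiscriminant f f') {z : ℝ} (hz : 0 < f' z) :
    ∀ᶠ δ in 𝓝[>] (0 : ℝ), LocalCount f f' (f z) z δ := by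
  have hev : ∀ᶠ E in 𝓝 z, 0 < f' E := hf.continuous_deriv.continuousAt.eventually_const_lt hz
  obtain ⟨δ₀, hδ₀, hpos⟩ := Metric.eventually_nhds_iff.1 hev
  filter_upwards [Ioo_mem_nhdsGT hδ₀] with δ hδ
  have hp : ∀ E ∈ Icc (z - δ) (z + δ), 0 < f' E := fun E hE => hpos (by
    rw [Real.dist_eq]
    exact (abs_le.2 ⟨by linarith [hE.1], by linarith [hE.2]⟩).trans_lt hδ.2)
  have hmono : StrictMonoOn f (Icc (z - δ) (z + δ)) :=
    strictMonoOn_of_deriv_pos (convex_Icc _ _) hf.continuous.continuousOn fun E hE => by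
      rw [(hf.hasDerivAt E).deriv]
      exact hp E (interior_subset hE)
  have hδ0 := hδ.1
  have hl : f (z - δ) < f z := hmono ⟨le_rfl, by linarith⟩ ⟨by linarith, by linarith⟩ (by linarith)
  have hr : f z < f (z + δ) := hmono ⟨by linarith, by linarith⟩ ⟨by linarith, le_rfl⟩ (by linarith)
  filter_upwards [mem_nhdsWithin_of_mem_nhds (Ioo_mem_nhds hl hr)] with c hc
  obtain ⟨l, hl1, hl2⟩ := intermediate_value_Ioo (by linarith : z - δ ≤ z + δ)
    hf.continuous.continuousOn hc
  refine ⟨{l}, fun l' => ?_, ?_⟩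
  · rw [Finset.mem_singleton]
    constructor
    · rintro rfl; exact ⟨hl1, hl2⟩
    · rintro ⟨h1, h2⟩
      exact hmono.injOn (Ioo_subset_Icc_self h1) (Ioo_subset_Icc_self hl1) (h2.trans hl2.symm)
  · simp [levelMult, hl2, (hp l (Ioo_subset_Icc_self hl1)).ne', hz.ne']

/-- Near `z` the function increases to `1` and then decreases. A level just below `1` has two simple
solutions, the level `1` has one double solution, and levels above `1` are excluded by the filter.
-/
theorem localCount_of_fold (hf : IsDiscriminant f f') {z : ℝ} (hz : f z = 1) (hz' : f' z = 0) :
    ∀ᶠ δ in 𝓝[>] (0 : ℝ), LocalCount f f' (f z) z δ := by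
  have hev := (hf.fold z (by rw [hz, abs_one]) hz').2
  rw [eventually_nhdsWithin_iff] at hev
  obtain ⟨δ₀, hδ₀, hneg⟩ := Metric.eventually_nhds_iff.1 hev
  filter_upwards [Ioo_mem_nhdsGT hδ₀] with δ hδ
  have hδ0 := hδ.1
  have hsign : ∀ E ∈ Icc (z - δ) (z + δ), E ≠ z → f' E * (E - z) < 0 := fun E hE hne => by
    have := hneg (y := E) (by
      rw [Real.dist_eq]
      exact (abs_le.2 ⟨by linarith [hE.1], by linarith [hE.2]⟩).trans_lt hδ.2) hne
    rwa [hz, one_mul] at this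
  have hmono : StrictMonoOn f (Icc (z - δ) z) :=
    strictMonoOn_of_deriv_pos (convex_Icc _ _) hf.continuous.continuousOn fun E hE => by
      rw [interior_Icc] at hE
      rw [(hf.hasDerivAt E).deriv]
      have := hsign E ⟨hE.1.le, by linarith [hE.2]⟩ hE.2.ne
      exact pos_of_mul_neg_left this (by linarith [hE.2])
  have hanti : StrictAntiOn f (Icc z (z + δ)) :=
    strictAntiOn_of_deriv_neg (convex_Icc _ _) hf.continuous.continuousOn fun E hE => by
      rw [interior_Icc] at hE
      rw [(hf.hasDerivAt E).deriv]
      have := hsign E ⟨by linarith [hE.1], hE.2.le⟩ hE.1.ne'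
      exact neg_of_mul_neg_left this (by linarith [hE.1])
  have hl : f (z - δ) < f z := hmono ⟨le_rfl, by linarith⟩ ⟨by linarith, le_rfl⟩ (by linarith)
  have hr : f (z + δ) < f z := hanti ⟨le_rfl, by linarith⟩ ⟨by linarith, le_rfl⟩ (by linarith)
  filter_upwards [mem_nhdsWithin_of_mem_nhds (Ioi_mem_nhds hl),
    mem_nhdsWithin_of_mem_nhds (Ioi_mem_nhds hr), self_mem_nhdsWithin] with c hc1 hc2 hc
  have hc1' : f (z - δ) < c := hc1
  have hc2' : f (z + δ) < c := hc2
  rcases hc.2.eq_or_lt with h1 | h1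
  · refine ⟨{z}, fun l => ?_, ?_⟩
    · rw [Finset.mem_singleton]
      constructor
      · rintro rfl; exact ⟨⟨by linarith, by linarith⟩, by rw [hz, h1]⟩
      · rintro ⟨h2, h3⟩
        rw [h1, ← hz] at h3
        rcases le_total l z with h | h
        · exact hmono.injOn ⟨h2.1.le, h⟩ ⟨by linarith, le_rfl⟩ h3
        · exact hanti.injOn ⟨h, h2.2.le⟩ ⟨le_rfl, by linarith⟩ h3
    · simp [h1, hz]
  · rw [← hz] at h1
    obtain ⟨l₁, h11, h12⟩ := intermediate_value_Ioo (by linarith : z - δ ≤ z)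
      hf.continuous.continuousOn ⟨hc1', h1⟩
    obtain ⟨l₂, h21, h22⟩ := intermediate_value_Ioo' (by linarith : z ≤ z + δ)
      hf.continuous.continuousOn ⟨hc2', h1⟩
    have hne : l₁ ≠ l₂ := (h11.2.trans h21.1).ne
    refine ⟨{l₁, l₂}, fun l => ?_, ?_⟩
    · rw [Finset.mem_insert, Finset.mem_singleton]
      constructor
      · rintro (rfl | rfl)
        · exact ⟨⟨h11.1, by linarith [h11.2]⟩, h12⟩
        · exact ⟨⟨by linarith [h21.1], h21.2⟩, h22⟩
      · rintro ⟨h2, h3⟩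
        rcases le_total l z with h | h
        · exact Or.inl (hmono.injOn ⟨h2.1.le, h⟩ (Ioo_subset_Icc_self h11) (h3.trans h12.symm))
        · exact Or.inr (hanti.injOn ⟨h, h2.2.le⟩ (Ioo_subset_Icc_self h21) (h3.trans h22.symm))
    · have e1 : f' l₁ ≠ 0 := fun h0 => by
        have := hsign l₁ ⟨h11.1.le, by linarith [h11.2]⟩ h11.2.ne
        rw [h0, zero_mul] at this; exact lt_irrefl _ this
      have e2 : f' l₂ ≠ 0 := fun h0 => by
        have := hsign l₂ ⟨by linarith [h21.1], h21.2.le⟩ h21.1.ne'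
        rw [h0, zero_mul] at this; exact lt_irrefl _ this
      rw [Finset.sum_pair hne]
      simp [levelMult, h12, h22, e1, e2, hz']

theorem localCount (hf : IsDiscriminant f f') {z : ℝ} (hz : |f z| ≤ 1) :
    ∀ᶠ δ in 𝓝[>] (0 : ℝ), LocalCount f f' (f z) z δ := by
  rcases lt_trichotomy (f' z) 0 with h | h | h
  · have := hf.neg.localCount_of_pos (z := z) (by simpa using h)
    exact this.mono fun δ hδ => LocalCount.of_neg hδ
  · have h1 := (hf.fold z hz h).1
    rcases sq_eq_sq_iff_eq_or_eq_neg.1 (h1.trans (one_pow 2).symm) with h2 | h2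
    · exact hf.localCount_of_fold h2 h
    · have := hf.neg.localCount_of_fold (z := z) (by simp [h2]) (by simpa using h)
      exact this.mono fun δ hδ => LocalCount.of_neg hδ
  · exact hf.localCount_of_pos h

/-- The local count at the level `f z` itself describes the nearby solutions as a finite set, so `z`
is isolated among them. -/
theorem eventually_ne (hf : IsDiscriminant f f') {z : ℝ} (hz : |f z| ≤ 1) :
    ∀ᶠ l in 𝓝[≠] z, f l ≠ f z := by
  obtain ⟨δ, hδ, hδ0⟩ := ((hf.localCount hz).and self_mem_nhdsWithin).exists
  have hδ0 : 0 < δ := hδ0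
  obtain ⟨t, ht, -⟩ := Eventually.self_of_nhdsWithin hδ (abs_le.1 hz)
  have h1 : ∀ᶠ l in 𝓝[≠] z, l ∈ Ioo (z - δ) (z + δ) :=
    mem_nhdsWithin_of_mem_nhds (Ioo_mem_nhds (by linarith) (by linarith))
  have h2 : ∀ᶠ l in 𝓝[≠] z, l ∉ t.erase z := by
    refine mem_nhdsWithin_of_mem_nhds ((t.erase z).finite_toSet.isClosed.isOpen_compl.mem_nhds ?_)
    simp
  filter_upwards [h1, h2, self_mem_nhdsWithin] with l hl1 hl2 hl3 heq
  exact hl2 (Finset.mem_erase.2 ⟨hl3, (ht l).2 ⟨hl1, heq⟩⟩)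

/-- Solutions up to `b` lie in `[0, b]`, since `f > 1` on the negatives; an accumulation point would
be a non-isolated solution. -/
theorem finite_level (hf : IsDiscriminant f f') (hpos : ∀ E < 0, 1 < f E) {c : ℝ}
    (hc : c ∈ Icc (-1 : ℝ) 1) (b : ℝ) : {l | l ≤ b ∧ f l = c}.Finite := by
  by_contra hinf
  have hsub : {l | l ≤ b ∧ f l = c} ⊆ Icc 0 b := by
    rintro l ⟨h1, h2⟩
    refine ⟨?_, h1⟩
    by_contra hl
    have := hpos l (not_le.1 hl)
    rw [h2] at this
    linarith [hc.2]
  obtain ⟨z, -, hz⟩ := Set.Infinite.exists_accPt_of_subset_isCompact hinf isCompact_Icc hsub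
  rw [accPt_iff_frequently_nhdsNE] at hz
  have hzc : f z = c := by
    have : IsClosed {l | f l = c} := isClosed_eq hf.continuous continuous_const
    have hid : Tendsto (fun l : ℝ => l) (𝓝[≠] z) (𝓝 z) := tendsto_id.mono_left nhdsWithin_le_nhds
    have hmem : z ∈ {l | f l = c} :=
      this.mem_of_frequently_of_tendsto (hz.mono fun l hl => hl.2) hid
    exact hmem
  refine hz ((hf.eventually_ne (by rw [hzc]; exact abs_le.2 hc)).mono ?_)
  rintro l hl ⟨-, h⟩
  exact hl (h.trans hzc.symm)

open Classical in
/-- The number of solutions `l ≤ b` of `f l = c`, with multiplicity. -/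
noncomputable def _root_.levelCount (f f' : ℝ → ℝ) (c b : ℝ) : ℕ :=
  if h : {l | l ≤ b ∧ f l = c}.Finite then ∑ l ∈ h.toFinset, levelMult f f' c l else 0

theorem levelCount_eq (hf : IsDiscriminant f f') (hpos : ∀ E < 0, 1 < f E) {c : ℝ}
    (hc : c ∈ Icc (-1 : ℝ) 1) {b : ℝ} {t : Finset ℝ} (ht : ∀ l, l ∈ t ↔ l ≤ b ∧ f l = c) :
    levelCount f f' c b = ∑ l ∈ t, levelMult f f' c l := by
  have hfin := hf.finite_level hpos hc b
  rw [levelCount, dif_pos hfin]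
  congr 1
  ext l
  rw [ht, Set.Finite.mem_toFinset]; rfl

/-- Around each solution at level `c₀` the local count is stable, elsewhere no solution appears, and
`f b ≠ c₀` prevents solutions from crossing the bound `b`. -/
theorem levelCount_eventually_eq (hf : IsDiscriminant f f') (hpos : ∀ E < 0, 1 < f E) {c₀ : ℝ}
    (hc₀ : c₀ ∈ Icc (-1 : ℝ) 1) {b : ℝ} (hb : f b ≠ c₀) :
    ∀ᶠ c in 𝓝[Icc (-1) 1] c₀, levelCount f f' c b = levelCount f f' c₀ b := by
  classical
  have hfin := hf.finite_level hpos hc₀ b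
  set Z := hfin.toFinset with hZ
  have hZmem : ∀ l, l ∈ Z ↔ l ≤ b ∧ f l = c₀ := fun l => by
    rw [hZ, Set.Finite.mem_toFinset]; rfl
  have e1 : ∀ᶠ δ in 𝓝[>] (0 : ℝ), ∀ z ∈ Z, LocalCount f f' c₀ z δ := by
    rw [Filter.eventually_all_finset]
    intro z hz
    have h := ((hZmem z).1 hz).2
    rw [← h]
    exact hf.localCount (by rw [h]; exact abs_le.2 hc₀)
  have e2 : ∀ᶠ δ in 𝓝[>] (0 : ℝ), ∀ z ∈ Z, z + δ < b := by
    rw [Filter.eventually_all_finset]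
    intro z hz
    have h := (hZmem z).1 hz
    have hlt : z < b := lt_of_le_of_ne h.1 fun h' => hb (h' ▸ h.2)
    filter_upwards [Ioo_mem_nhdsGT (sub_pos.2 hlt)] with δ hδ
    linarith [hδ.2]
  have e3 : ∀ᶠ δ in 𝓝[>] (0 : ℝ), ∀ z ∈ Z, ∀ z' ∈ Z, z < z' → z + δ < z' - δ := by
    simp only [Filter.eventually_all_finset]
    intro z _ z' _
    by_cases h : z < z'
    · filter_upwards [Ioo_mem_nhdsGT (half_pos (sub_pos.2 h))] with δ hδ _
      linarith [hδ.2]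
    · exact Eventually.of_forall fun _ h' => absurd h' h
  obtain ⟨δ, ⟨⟨h1, h2⟩, h3⟩, hδ⟩ := (((e1.and e2).and e3).and self_mem_nhdsWithin).exists
  have hδ : 0 < δ := hδ
  -- Off the chosen intervals the image of `f` is compact and misses `c₀`, hence misses all nearby
  -- levels.
  have hK : IsCompact (Icc 0 b \ ⋃ z ∈ Z, Ioo (z - δ) (z + δ)) :=
    isCompact_Icc.diff (isOpen_biUnion fun z _ => isOpen_Ioo)
  have hc : ∀ᶠ c in 𝓝[Icc (-1) 1] c₀, c ∉ f '' (Icc 0 b \ ⋃ z ∈ Z, Ioo (z - δ) (z + δ)) := by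
    refine mem_nhdsWithin_of_mem_nhds
      ((hK.image hf.continuous).isClosed.isOpen_compl.mem_nhds ?_)
    rintro ⟨l, ⟨hl1, hl2⟩, hl3⟩
    refine hl2 (mem_biUnion ((hZmem l).2 ⟨hl1.2, hl3⟩) ⟨?_, ?_⟩) <;> linarith
  filter_upwards [(Filter.eventually_all_finset Z).2 h1, hc, self_mem_nhdsWithin] with c hc1 hc2 hc3
  choose! t ht1 ht2 using hc1
  rw [hf.levelCount_eq hpos hc₀ hZmem, hf.levelCount_eq hpos hc3 (t := Z.biUnion t),
    Finset.sum_biUnion]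
  · exact Finset.sum_congr rfl ht2
  · intro z hz z' hz' hne
    rw [Function.onFun, Finset.disjoint_left]
    intro l hl hl'
    have m1 := ((ht1 z hz l).1 hl).1
    have m2 := ((ht1 z' hz' l).1 hl').1
    rcases lt_or_gt_of_ne hne with h | h
    · have := h3 z hz z' hz' h
      linarith [m1.2, m2.1]
    · have := h3 z' hz' z hz h
      linarith [m2.2, m1.1]
  · intro l
    rw [Finset.mem_biUnion]
    constructor
    · rintro ⟨z, hz, hl⟩
      obtain ⟨m1, m2⟩ := (ht1 z hz l).1 hl
      exact ⟨by linarith [m1.2, h2 z hz], m2⟩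
    · rintro ⟨hl1, hl2⟩
      have hl0 : 0 ≤ l := by
        by_contra hl
        have := hpos l (not_le.1 hl)
        rw [hl2] at this
        linarith [hc3.2]
      have : l ∈ ⋃ z ∈ Z, Ioo (z - δ) (z + δ) := by
        by_contra hl
        exact hc2 ⟨l, ⟨⟨hl0, hl1⟩, hl⟩, hl2⟩
      obtain ⟨z, hz, hl⟩ := mem_iUnion₂.1 this
      exact ⟨z, hz, (ht1 z hz l).2 ⟨hl, hl2⟩⟩

theorem levelCount_mono (hf : IsDiscriminant f f') (hpos : ∀ E < 0, 1 < f E) {c : ℝ}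
    (hc : c ∈ Icc (-1 : ℝ) 1) : Monotone (levelCount f f' c) := by
  intro b b' hbb
  have h1 := hf.finite_level hpos hc b
  have h2 := hf.finite_level hpos hc b'
  rw [levelCount, levelCount, dif_pos h1, dif_pos h2]
  refine Finset.sum_le_sum_of_subset ?_
  exact Set.Finite.toFinset_subset_toFinset.2 fun l hl => ⟨hl.1.trans hbb, hl.2⟩

theorem exists_level_of_levelCount_pos (hf : IsDiscriminant f f') (hpos : ∀ E < 0, 1 < f E)
    {c : ℝ} (hc : c ∈ Icc (-1 : ℝ) 1) {b : ℝ} (hb : 0 < levelCount f f' c b) :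
    ∃ l ≤ b, f l = c ∧ levelCount f f' c l = levelCount f f' c b := by
  have h1 := hf.finite_level hpos hc b
  have hne : h1.toFinset.Nonempty := by
    rw [Finset.nonempty_iff_ne_empty]
    intro h0
    -- Without a solution the count would be an empty sum; the witness below is the largest solution
    -- up to `b`, beyond which nothing more is counted.
    rw [levelCount, dif_pos h1, h0] at hb
    simp at hb
  have hmax := h1.toFinset.max'_mem hne
  set l := h1.toFinset.max' hne
  obtain ⟨hl1, hl2⟩ := h1.mem_toFinset.1 hmax
  refine ⟨l, hl1, hl2, ?_⟩
  have ht : ∀ x, x ∈ h1.toFinset ↔ x ≤ b ∧ f x = c := fun x => h1.mem_toFinset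
  rw [hf.levelCount_eq hpos hc ht, hf.levelCount_eq hpos hc (t := h1.toFinset)]
  intro x
  rw [ht]
  refine ⟨fun hx => ⟨h1.toFinset.le_max' x ((ht x).2 hx), hx.2⟩, fun hx => ⟨hx.1.trans hl1, hx.2⟩⟩

/-- The total multiplicity jumps by the multiplicity of the level at a solution. -/
theorem levelCount_jump (hf : IsDiscriminant f f') (hpos : ∀ E < 0, 1 < f E)
    {c : ℝ} (hc : c ∈ Icc (-1 : ℝ) 1) (E : ℝ) :
    ∃ b < E, ∀ b' ∈ Ico b E,
      levelCount f f' c E = levelCount f f' c b' + levelMult f f' c E := by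
  classical
  have h1 := hf.finite_level hpos hc E
  have ht : ∀ x, x ∈ h1.toFinset ↔ x ≤ E ∧ f x = c := fun x => h1.mem_toFinset
  have hev : ∀ᶠ b in 𝓝[<] E, ∀ l ∈ h1.toFinset.erase E, l < b := by
    rw [Filter.eventually_all_finset]
    intro l hl
    rw [Finset.mem_erase] at hl
    have hlt : l < E := lt_of_le_of_ne ((ht l).1 hl.2).1 hl.1
    filter_upwards [Ioo_mem_nhdsLT hlt] with b hb
    exact hb.1
  obtain ⟨b, hb, hbE⟩ := (hev.and self_mem_nhdsWithin).exists
  have hbE : b < E := hbE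
  refine ⟨b, hbE, fun b' hb' => ?_⟩
  rw [hf.levelCount_eq hpos hc ht, hf.levelCount_eq hpos hc (t := h1.toFinset.erase E)]
  · by_cases hE : E ∈ h1.toFinset
    · rw [Finset.sum_erase_add _ _ hE]
    · rw [Finset.erase_eq_of_notMem hE]
      have : f E ≠ c := fun h => hE ((ht E).2 ⟨le_rfl, h⟩)
      simp [levelMult, this]
  · intro l
    rw [Finset.mem_erase, ht]
    constructor
    · rintro ⟨h2, h3, h4⟩
      exact ⟨(hb l (Finset.mem_erase.2 ⟨h2, (ht l).2 ⟨h3, h4⟩⟩)).le.trans hb'.1, h4⟩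
    · rintro ⟨h2, h3⟩
      exact ⟨(h2.trans_lt hb'.2).ne, h2.trans hb'.2.le, h3⟩

/-- The `j`-th solution of `f l = c`. -/
noncomputable def _root_.levelBand (f f' : ℝ → ℝ) (j : ℕ) (c : ℝ) : ℝ :=
  sInf {E | j ≤ levelCount f f' c E}

/-- The count grows only at solutions, and only finitely many lie below `b`. So the infimum is
attained, and it is attained at a solution. -/
theorem isLeast_levelBand (hf : IsDiscriminant f f') (hpos : ∀ E < 0, 1 < f E)
    {c : ℝ} (hc : c ∈ Icc (-1 : ℝ) 1) {j : ℕ} (hj : 1 ≤ j)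
    (hne : ∃ E, j ≤ levelCount f f' c E) :
    IsLeast {E | j ≤ levelCount f f' c E} (levelBand f f' j c) ∧
      f (levelBand f f' j c) = c := by
  classical
  obtain ⟨b, hb⟩ := hne
  have h1 := hf.finite_level hpos hc b
  have ht : ∀ x, x ∈ h1.toFinset ↔ x ≤ b ∧ f x = c := fun x => h1.mem_toFinset
  set s := h1.toFinset.filter fun l => j ≤ levelCount f f' c l
  have hs : ∀ x, x ∈ s ↔ (x ≤ b ∧ f x = c) ∧ j ≤ levelCount f f' c x := fun x => by
    rw [Finset.mem_filter, ht]
  have hex : ∀ E, j ≤ levelCount f f' c E → ∃ l ≤ E, f l = c ∧ j ≤ levelCount f f' c l := by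
    intro E hE
    obtain ⟨l, h1, h2, h3⟩ := hf.exists_level_of_levelCount_pos hpos hc (hj.trans hE)
    exact ⟨l, h1, h2, h3 ▸ hE⟩
  have hsne : s.Nonempty := by
    obtain ⟨l, h1, h2, h3⟩ := hex b hb
    exact ⟨l, (hs l).2 ⟨⟨h1, h2⟩, h3⟩⟩
  have hmin := (hs _).1 (s.min'_mem hsne)
  set l₀ := s.min' hsne
  have hleast : IsLeast {E | j ≤ levelCount f f' c E} l₀ := by
    refine ⟨hmin.2, fun E hE => ?_⟩
    obtain ⟨l, h1, h2, h3⟩ := hex E hE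
    rcases le_total l b with h | h
    · exact (s.min'_le l ((hs l).2 ⟨⟨h, h2⟩, h3⟩)).trans h1
    · exact hmin.1.1.trans (h.trans h1)
  rw [levelBand, hleast.csInf_eq]
  exact ⟨hleast, hmin.1.2⟩

/-- Solutions are isolated, so there are non-solutions `b` arbitrarily close to `E₀` on either side.
The counts at such `b` are stable in `c` and trap the `j`-th solution. -/
theorem continuousWithinAt_levelBand (hf : IsDiscriminant f f') (hpos : ∀ E < 0, 1 < f E)
    {c₀ : ℝ} (hc₀ : c₀ ∈ Icc (-1 : ℝ) 1) {j : ℕ} (hj : 1 ≤ j)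
    (hne : ∃ E, j ≤ levelCount f f' c₀ E) :
    ContinuousWithinAt (levelBand f f' j) (Icc (-1) 1) c₀ := by
  obtain ⟨hleast, hlevel⟩ := hf.isLeast_levelBand hpos hc₀ hj hne
  set E₀ := levelBand f f' j c₀
  have hiso := hf.eventually_ne (z := E₀) (by rw [hlevel]; exact abs_le.2 hc₀)
  rw [hlevel] at hiso
  rw [ContinuousWithinAt, tendsto_order]
  have hup : ∀ u > E₀, ∀ᶠ c in 𝓝[Icc (-1) 1] c₀, ∃ b < u, j ≤ levelCount f f' c b := by
    intro u hu
    obtain ⟨b, hb1, hb2⟩ := ((hiso.filter_mono (nhdsGT_le_nhdsNE E₀)).and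
      (Ioo_mem_nhdsGT hu)).exists
    filter_upwards [hf.levelCount_eventually_eq hpos hc₀ hb1] with c hc
    exact ⟨b, hb2.2, by rw [hc]; exact hleast.1.trans (hf.levelCount_mono hpos hc₀ hb2.1.le)⟩
  constructor
  · intro v hv
    obtain ⟨b, hb1, hb2⟩ := ((hiso.filter_mono (nhdsLT_le_nhdsNE E₀)).and
      (Ioo_mem_nhdsLT hv)).exists
    -- Here `hup` only guarantees that a `j`-th solution exists at nearby levels, so that
    -- `levelBand` is not the infimum of an empty set.
    filter_upwards [hf.levelCount_eventually_eq hpos hc₀ hb1, hup (E₀ + 1) (lt_add_one _),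
      self_mem_nhdsWithin] with c hc ⟨b', _, hb'⟩ hcI
    have h1 := (hf.isLeast_levelBand hpos hcI hj ⟨b', hb'⟩).1.1
    by_contra hlt
    have h2 : levelBand f f' j c ≤ b := (not_lt.1 hlt).trans hb2.1.le
    have h3 : j ≤ levelCount f f' c₀ b := by
      rw [← hc]; exact le_trans h1 (hf.levelCount_mono hpos hcI h2)
    exact absurd (hleast.2 h3) (not_le.2 hb2.2)
  · intro u hu
    filter_upwards [hup u hu, self_mem_nhdsWithin] with c ⟨b, hb1, hb2⟩ hcI
    exact ((hf.isLeast_levelBand hpos hcI hj ⟨b, hb2⟩).1.2 hb2).trans_lt hb1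

/-- A double solution belongs to two consecutive bands. -/
theorem levelBand_of_double (hf : IsDiscriminant f f') (hpos : ∀ E < 0, 1 < f E)
    {c : ℝ} (hc : c ∈ Icc (-1 : ℝ) 1) {j : ℕ} (hj : 1 ≤ j)
    (hne : ∃ E, j ≤ levelCount f f' c E) (hd : f' (levelBand f f' j c) = 0) :
    levelBand f f' (j + 1) c = levelBand f f' j c ∨
      (2 ≤ j ∧ levelBand f f' (j - 1) c = levelBand f f' j c) := by
  obtain ⟨hleast, hlevel⟩ := hf.isLeast_levelBand hpos hc hj hne
  set E := levelBand f f' j c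
  obtain ⟨b, hbE, hjump⟩ := hf.levelCount_jump hpos hc E
  have hm : levelMult f f' c E = 2 := by simp [levelMult, hlevel, hd]
  rw [hm] at hjump
  have hjb := hjump b ⟨le_rfl, hbE⟩
  have h1 : levelCount f f' c b < j := by
    by_contra h
    exact absurd (hleast.2 (not_lt.1 h)) (not_le.2 hbE)
  have h2 : j ≤ levelCount f f' c E := hleast.1
  have hlt : ∀ E' < E, levelCount f f' c E' ≤ levelCount f f' c b := by
    intro E' hE'
    have h3 := hjump (max E' b) ⟨le_max_right _ _, max_lt hE' hbE⟩
    have h4 := hf.levelCount_mono hpos hc (le_max_left E' b)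
    omega
  -- The count jumps at `E` from `n < j` to `n + 2 ≥ j`, so `n` is `j - 1` or `j - 2`: the partner
  -- of band `j` is `j + 1` or `j - 1`. The second case forces `j ≥ 2`.
  by_cases h3 : levelCount f f' c b = j - 1
  · left
    refine IsLeast.csInf_eq ⟨?_, fun E' hE' => hleast.2 ?_⟩
    · change j + 1 ≤ levelCount f f' c E
      omega
    · have : j + 1 ≤ levelCount f f' c E' := hE'
      change j ≤ levelCount f f' c E'
      omega
  · right
    refine ⟨by omega, IsLeast.csInf_eq ⟨?_, fun E' hE' => ?_⟩⟩
    · change j - 1 ≤ levelCount f f' c E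
      omega
    · by_contra h
      have h4 := hlt E' (not_le.1 h)
      have h5 : j - 1 ≤ levelCount f f' c E' := hE'
      omega

end IsDiscriminant

/-! ### Bands as monotone functions of the wavenumber. -/

namespace PhotonicMedium

variable {M : PhotonicMedium}

theorem isDiscriminant_disc (hM : M.InversionSymmetric) : IsDiscriminant M.disc M.dDisc where
  hasDerivAt := hasDerivAt_disc
  continuous_deriv := continuous_dDisc
  fold _ h h' := disc_fold hM h h'

theorem cos_mem_Icc (k : ℝ) : Real.cos k ∈ Icc (-1 : ℝ) 1 :=
  ⟨Real.neg_one_le_cos k, Real.cos_le_one k⟩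

/-- Energies with `D ≠ cos k` contribute nothing, so among the finite sets in `band` the set of all
solutions up to `E` has the largest total multiplicity. -/
theorem band_eq_levelBand (hM : M.InversionSymmetric) (j : ℕ) (k : ℝ) :
    M.band j k = levelBand M.disc M.dDisc j (Real.cos k) := by
  classical
  have hmult : ∀ l, Module.finrank ℂ (M.blochSpace k l) =
      levelMult M.disc M.dDisc (Real.cos k) l := fun l => by
    rw [finrank_blochSpace hM, levelMult]
  have hf := isDiscriminant_disc hM
  rw [band, levelBand]
  congr 1
  ext E
  simp only [mem_ofPred_eq, hmult]
  have h1 := hf.finite_level (fun E hE => one_lt_disc hE) (cos_mem_Icc k) E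
  have ht : ∀ x, x ∈ h1.toFinset ↔ x ≤ E ∧ M.disc x = Real.cos k := fun x => h1.mem_toFinset
  rw [hf.levelCount_eq (fun E hE => one_lt_disc hE) (cos_mem_Icc k) ht]
  constructor
  · rintro ⟨s, hs, hsum⟩
    refine hsum.trans ?_
    rw [← Finset.sum_filter_add_sum_filter_not s fun l => M.disc l = Real.cos k]
    have h0 : ∑ l ∈ s with ¬ M.disc l = Real.cos k, levelMult M.disc M.dDisc (Real.cos k) l = 0 :=
      Finset.sum_eq_zero fun l hl => if_neg (Finset.mem_filter.1 hl).2
    rw [h0, add_zero]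
    refine Finset.sum_le_sum_of_subset fun l hl => ?_
    rw [Finset.mem_filter] at hl
    exact (ht l).2 ⟨hs l hl.1, hl.2⟩
  · intro h
    exact ⟨h1.toFinset, fun l hl => ((ht l).1 hl).1, h⟩

/-- The band consists of eigenvalues and is continuous on `[0, π]`. -/
structure IsRegularBand (M : PhotonicMedium) (j : ℕ) : Prop where
  continuousOn : ContinuousOn (M.band j) (Icc 0 Real.pi)
  disc_band : ∀ k ∈ Icc 0 Real.pi, M.disc (M.band j k) = Real.cos k

/-- `D` recovers `cos k` from the energy, and the cosine is injective on `[0, π]`. Continuity then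
makes the band strictly monotone. -/
theorem IsRegularBand.injOn {j : ℕ} (h : M.IsRegularBand j) :
    InjOn (M.band j) (Icc 0 Real.pi) := fun k hk k' hk' e =>
  Real.injOn_cos hk hk' (by rw [← h.disc_band k hk, ← h.disc_band k' hk', e])

theorem IsRegularBand.strictMono_or_strictAnti {j : ℕ} (h : M.IsRegularBand j) :
    StrictMonoOn (M.band j) (Icc 0 Real.pi) ∨ StrictAntiOn (M.band j) (Icc 0 Real.pi) :=
  h.continuousOn.strictMonoOn_of_injOn_Icc' Real.pi_pos.le h.injOn

theorem isRegularBand_of_nonempty (hM : M.InversionSymmetric) {j : ℕ} (hj : 1 ≤ j)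
    (hne : ∀ k ∈ Icc 0 Real.pi, ∃ E, j ≤ levelCount M.disc M.dDisc (Real.cos k) E) :
    M.IsRegularBand j := by
  have hf := isDiscriminant_disc hM
  have e : M.band j = fun k => levelBand M.disc M.dDisc j (Real.cos k) :=
    funext fun k => band_eq_levelBand hM j k
  constructor
  · intro k hk
    rw [e]
    refine (hf.continuousWithinAt_levelBand (fun E hE => one_lt_disc hE) (cos_mem_Icc k) hj
      (hne k hk)).tendsto.comp (tendsto_nhdsWithin_iff.2
        ⟨Real.continuous_cos.continuousAt.mono_left nhdsWithin_le_nhds, ?_⟩)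
    exact Eventually.of_forall cos_mem_Icc
  · intro k hk
    rw [e]
    exact (hf.isLeast_levelBand (fun E hE => one_lt_disc hE) (cos_mem_Icc k) hj (hne k hk)).2

/-- If the total multiplicity never reached `j`, both bands would be the infimum of the empty set
and hence equal. -/
theorem exists_levelCount_of_band_ne (hM : M.InversionSymmetric) {j : ℕ} {k : ℝ}
    (h : M.band (j + 1) k ≠ M.band j k) :
    ∃ E, j ≤ levelCount M.disc M.dDisc (Real.cos k) E := by
  by_contra hne
  push Not at hne
  apply h
  rw [band_eq_levelBand hM, band_eq_levelBand hM, levelBand, levelBand]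
  congr 1
  ext E
  have := hne E
  simp only [mem_ofPred_eq]
  constructor <;> intro h' <;> omega

theorem dDisc_band_ne_zero (hM : M.InversionSymmetric) {j : ℕ} (hj : 1 ≤ j) {k : ℝ}
    (hne : ∃ E, j ≤ levelCount M.disc M.dDisc (Real.cos k) E)
    (h1 : M.band (j + 1) k ≠ M.band j k) (h2 : 2 ≤ j → M.band (j - 1) k ≠ M.band j k) :
    M.dDisc (M.band j k) ≠ 0 := by
  intro h
  simp only [band_eq_levelBand hM] at h h1 h2
  rcases (isDiscriminant_disc hM).levelBand_of_double (fun E hE => one_lt_disc hE)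
    (cos_mem_Icc k) hj hne h with h3 | ⟨h3, h4⟩
  · exact h1 h3
  · exact h2 h3 h4

/-! ### The two bands at a Dirac point. -/

theorem eventually_lt_of_asymptotics {b : ℝ → ℝ} {k₀ E₀ α δ C : ℝ} (hα : 0 < α) (hδ : 0 < δ)
    (h : ∀ k, |k - k₀| < δ → |b k - (E₀ - α * |k - k₀|)| ≤ C * (k - k₀) ^ 2) :
    ∀ᶠ k in 𝓝[≠] k₀, b k < E₀ := by
  have h1 : ∀ᶠ k in 𝓝 k₀, |k - k₀| < δ := by
    have : ContinuousAt (fun k => |k - k₀|) k₀ := by fun_prop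
    exact this.eventually_lt_const (by simpa using hδ)
  have h2 : ∀ᶠ k in 𝓝 k₀, C * |k - k₀| < α := by
    have : ContinuousAt (fun k => C * |k - k₀|) k₀ := by fun_prop
    exact this.eventually_lt_const (by simpa using hα)
  filter_upwards [mem_nhdsWithin_of_mem_nhds h1, mem_nhdsWithin_of_mem_nhds h2,
    self_mem_nhdsWithin] with k hk1 hk2 hk3
  have h3 := (abs_le.1 (h k hk1)).2
  have h4 : 0 < |k - k₀| := abs_pos.2 (sub_ne_zero.2 hk3)
  rw [← sq_abs] at h3
  nlinarith

theorem eventually_gt_of_asymptotics {b : ℝ → ℝ} {k₀ E₀ α δ C : ℝ} (hα : 0 < α) (hδ : 0 < δ)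
    (h : ∀ k, |k - k₀| < δ → |b k - (E₀ + α * |k - k₀|)| ≤ C * (k - k₀) ^ 2) :
    ∀ᶠ k in 𝓝[≠] k₀, E₀ < b k := by
  have := eventually_lt_of_asymptotics (b := fun k => -b k) (E₀ := -E₀) hα hδ fun k hk => by
    rw [← abs_neg]
    convert h k hk using 2
    ring
  exact this.mono fun k hk => neg_lt_neg_iff.1 hk

theorem nhdsWithin_Ioo_neBot {k₀ : ℝ} (hk₀ : k₀ = 0 ∨ k₀ = Real.pi) :
    (𝓝[Ioo 0 Real.pi] k₀).NeBot := by
  rcases hk₀ with rfl | rfl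
  · exact left_nhdsWithin_Ioo_neBot Real.pi_pos
  · exact right_nhdsWithin_Ioo_neBot Real.pi_pos

theorem nhdsWithin_Ioo_le_nhdsNE {k₀ : ℝ} (hk₀ : k₀ = 0 ∨ k₀ = Real.pi) :
    𝓝[Ioo 0 Real.pi] k₀ ≤ 𝓝[≠] k₀ := by
  refine nhdsWithin_mono _ fun k hk => ?_
  rcases hk₀ with rfl | rfl
  · exact hk.1.ne'
  · exact hk.2.ne

/-- On the far side of a value at an end point, a strictly monotone function stays on the side of
that value that it takes near the end point. -/
theorem lt_of_eventually_lt {b : ℝ → ℝ} {k₀ k₁ : ℝ}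
    (hb : StrictMonoOn b (Icc 0 Real.pi) ∨ StrictAntiOn b (Icc 0 Real.pi))
    (hk : (k₀ = 0 ∧ k₁ = Real.pi) ∨ (k₀ = Real.pi ∧ k₁ = 0))
    (h : ∀ᶠ k in 𝓝[≠] k₀, b k < b k₀) : b k₁ < b k₀ := by
  have hk₀ : k₀ = 0 ∨ k₀ = Real.pi := hk.imp And.left And.left
  have := nhdsWithin_Ioo_neBot hk₀
  obtain ⟨k, hk1, hk2⟩ := ((h.filter_mono (nhdsWithin_Ioo_le_nhdsNE hk₀)).and
    self_mem_nhdsWithin).exists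
  have hpi := Real.pi_pos
  have m0 : (0 : ℝ) ∈ Icc 0 Real.pi := ⟨le_rfl, hpi.le⟩
  have mpi : Real.pi ∈ Icc 0 Real.pi := ⟨hpi.le, le_rfl⟩
  have mk := Ioo_subset_Icc_self hk2
  rcases hk with ⟨rfl, rfl⟩ | ⟨rfl, rfl⟩ <;> rcases hb with hb | hb
  · exact absurd (hb m0 mk hk2.1) (not_lt.2 hk1.le)
  · exact hb m0 mpi hpi
  · exact hb m0 mpi hpi
  · exact absurd (hb mk mpi hk2.2) (not_lt.2 hk1.le)

theorem gt_of_eventually_gt {b : ℝ → ℝ} {k₀ k₁ : ℝ}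
    (hb : StrictMonoOn b (Icc 0 Real.pi) ∨ StrictAntiOn b (Icc 0 Real.pi))
    (hk : (k₀ = 0 ∧ k₁ = Real.pi) ∨ (k₀ = Real.pi ∧ k₁ = 0))
    (h : ∀ᶠ k in 𝓝[≠] k₀, b k₀ < b k) : b k₀ < b k₁ :=
  neg_lt_neg_iff.1 (lt_of_eventually_lt (b := fun k => -b k)
    (hb.symm.imp (fun h _ hx _ hy hxy => neg_lt_neg (h hx hy hxy))
      fun h _ hx _ hy hxy => neg_lt_neg (h hx hy hxy)) hk
    (h.mono fun _ hk => neg_lt_neg hk))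

/-- The two bands that cross at a Dirac point at one end of `[0, π]` are regular, degenerate at
that end, and simple at the other end. -/
theorem IsDiracPoint.regular (hM : M.InversionSymmetric) {j : ℕ} (hj : 1 ≤ j)
    (hcross : ∀ m, 1 ≤ m → m ≠ j → m ≠ j + 1 → ∀ k ∈ Icc (-Real.pi) Real.pi,
      M.band m k ≠ M.band j k ∧ M.band m k ≠ M.band (j + 1) k) {k₀ k₁ E₀ : ℝ}
    (hk : (k₀ = 0 ∧ k₁ = Real.pi) ∨ (k₀ = Real.pi ∧ k₁ = 0)) (hD : M.IsDiracPoint j k₀ E₀) :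
    ∀ i, i = j ∨ i = j + 1 →
      M.IsRegularBand i ∧ M.dDisc (M.band i k₀) = 0 ∧ M.dDisc (M.band i k₁) ≠ 0 := by
  have hpi := Real.pi_pos
  have hsub : Icc 0 Real.pi ⊆ Icc (-Real.pi) Real.pi := Icc_subset_Icc_left (by linarith)
  -- Band `j + 1` has enough eigenvalues below it because band `j + 2` differs from it.
  have hne1 : ∀ k ∈ Icc 0 Real.pi, ∃ E, j + 1 ≤ levelCount M.disc M.dDisc (Real.cos k) E :=
    fun k hk => exists_levelCount_of_band_ne hM
      (hcross (j + 1 + 1) (by omega) (by omega) (by omega) k (hsub hk)).2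
  have hne0 : ∀ k ∈ Icc 0 Real.pi, ∃ E, j ≤ levelCount M.disc M.dDisc (Real.cos k) E :=
    fun k hk => (hne1 k hk).imp fun E hE => by omega
  have r0 := isRegularBand_of_nonempty hM hj hne0
  have r1 := isRegularBand_of_nonempty hM (Nat.le_add_left 1 j) hne1
  obtain ⟨hE0, hE1, ⟨α, hα, δ, hδ, C, has⟩, hrank⟩ := hD
  have hm1 : k₁ ∈ Icc 0 Real.pi := by
    rcases hk with ⟨-, rfl⟩ | ⟨-, rfl⟩
    · exact ⟨hpi.le, le_rfl⟩
    · exact ⟨le_rfl, hpi.le⟩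
  -- By monotonicity the far ends lie on opposite sides of the Dirac energy. The two bands are thus
  -- distinct at `k₁`; other bands are excluded by `hcross`, so both energies are simple there.
  have hlt : M.band j k₁ < M.band (j + 1) k₁ := by
    have a1 := lt_of_eventually_lt r0.strictMono_or_strictAnti hk (by
      rw [hE0]; exact eventually_lt_of_asymptotics hα hδ fun k hk => (has k hk).1)
    have a2 := gt_of_eventually_gt r1.strictMono_or_strictAnti hk (by
      rw [hE1]; exact eventually_gt_of_asymptotics hα hδ fun k hk => (has k hk).2)
    rw [hE0] at a1
    rw [hE1] at a2
    exact a1.trans a2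
  have hdeg : M.dDisc E₀ = 0 := by
    rw [finrank_blochSpace hM] at hrank
    by_contra h
    split_ifs at hrank; omega
  rintro i (rfl | rfl)
  · refine ⟨r0, by rw [hE0]; exact hdeg, dDisc_band_ne_zero hM hj (hne0 k₁ hm1) hlt.ne' fun h => ?_⟩
    exact (hcross (i - 1) (by omega) (by omega) (by omega) k₁ (hsub hm1)).1
  · refine ⟨r1, by rw [hE1]; exact hdeg, dDisc_band_ne_zero hM (by omega) (hne1 k₁ hm1) ?_
      fun _ => hlt.ne⟩
    exact (hcross (j + 1 + 1) (by omega) (by omega) (by omega) k₁ (hsub hm1)).2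

/-! ### Normalized Bloch modes inside the Brillouin zone. -/

variable (M) in
/-- The solution `a ψ_{E,1} + i b ψ_{E,2}`. -/
noncomputable def modeComb (E a b x : ℝ) : ℂ :=
  ((a * M.y₁ E x : ℝ) : ℂ) + Complex.I * ((b * M.y₂ E x : ℝ) : ℂ)

variable (M) in
/-- The inner product of `ψ_{E,1}` and `ψ_{E,2}`. -/
noncomputable def crossTerm (E : ℝ) : ℝ := ∫ x in (0 : ℝ)..1, M.ε x * (M.y₁ E x * M.y₂ E x)

theorem integral_eq_re_add_im {R S : ℝ → ℝ} (hR : Continuous R) (hS : Continuous S) :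
    ∫ x in (0 : ℝ)..1, (M.ε x : ℂ) * (((R x : ℝ) : ℂ) + Complex.I * ((S x : ℝ) : ℂ)) =
      ((∫ x in (0 : ℝ)..1, M.ε x * R x : ℝ) : ℂ) +
        Complex.I * ((∫ x in (0 : ℝ)..1, M.ε x * S x : ℝ) : ℂ) := by
  rw [← intervalIntegral.integral_ofReal, ← intervalIntegral.integral_ofReal,
    ← intervalIntegral.integral_const_mul, ← intervalIntegral.integral_add]
  · congr 1
    funext x
    push_cast
    ring
  · have h := M.isWeight_ε.intervalIntegrable_mul hR 0 1
    exact ⟨h.1.ofReal, h.2.ofReal⟩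
  · have h := M.isWeight_ε.intervalIntegrable_mul hS 0 1
    exact IntervalIntegrable.const_mul ⟨h.1.ofReal, h.2.ofReal⟩ _

theorem integral_combination {u v : ℝ → ℝ} (hu : Continuous u) (hv : Continuous v) (s t : ℝ) :
    ∫ x in (0 : ℝ)..1, M.ε x * (s * u x + t * v x) =
      s * (∫ x in (0 : ℝ)..1, M.ε x * u x) + t * ∫ x in (0 : ℝ)..1, M.ε x * v x := by
  rw [← intervalIntegral.integral_const_mul, ← intervalIntegral.integral_const_mul,
    ← intervalIntegral.integral_add]
  · congr 1
    funext x
    ring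
  · exact (M.isWeight_ε.intervalIntegrable_mul hu 0 1).const_mul s
  · exact (M.isWeight_ε.intervalIntegrable_mul hv 0 1).const_mul t

theorem cellInner_modeComb (E a b c d : ℝ) :
    M.cellInner (M.modeComb E a b) (M.modeComb E c d) =
      ((a * c * M.normSq₁ E + b * d * M.normSq₂ E : ℝ) : ℂ) +
        Complex.I * (((b * c - a * d) * M.crossTerm E : ℝ) : ℂ) := by
  have h1 := M.continuous_y₁ E
  have h2 := M.continuous_y₂ E
  have e := M.integral_eq_re_add_im
    (R := fun x => (a * c) * (M.y₁ E x * M.y₁ E x) + (b * d) * (M.y₂ E x * M.y₂ E x))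
    (S := fun x => (b * c - a * d) * (M.y₁ E x * M.y₂ E x))
    ((continuous_const.mul (h1.mul h1)).add (continuous_const.mul (h2.mul h2)))
    (continuous_const.mul (h1.mul h2))
  have e3 : ∫ x in (0 : ℝ)..1, M.ε x *
      ((a * c) * (M.y₁ E x * M.y₁ E x) + (b * d) * (M.y₂ E x * M.y₂ E x)) =
      a * c * M.normSq₁ E + b * d * M.normSq₂ E :=
    integral_combination (h1.mul h1) (h2.mul h2) (a * c) (b * d)
  rw [e3] at e
  have e2 : ∫ x in (0 : ℝ)..1, M.ε x * ((b * c - a * d) * (M.y₁ E x * M.y₂ E x)) =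
      (b * c - a * d) * M.crossTerm E := by
    rw [crossTerm, ← intervalIntegral.integral_const_mul]
    congr 1
    funext x
    ring
  rw [e2] at e
  rw [cellInner, ← e]
  congr 1
  funext x
  simp only [modeComb, map_add, map_mul, Complex.conj_ofReal, Complex.conj_I]
  push_cast
  linear_combination (-(M.ε x : ℂ) * b * d * M.y₂ E x ^ 2) * Complex.I_sq

theorem cellNorm_modeComb (E a b : ℝ) :
    M.cellNorm (M.modeComb E a b) = √(a ^ 2 * M.normSq₁ E + b ^ 2 * M.normSq₂ E) := by
  have e : (b * a - a * b) * M.crossTerm E = 0 := by ring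
  rw [cellNorm, cellInner_modeComb, e]
  simp only [Complex.ofReal_zero, mul_zero, add_zero, Complex.ofReal_re]
  congr 1
  ring

theorem normalize_modeComb (E a b : ℝ) :
    M.normalize (M.modeComb E a b) =
      M.modeComb E (a / √(a ^ 2 * M.normSq₁ E + b ^ 2 * M.normSq₂ E))
        (b / √(a ^ 2 * M.normSq₁ E + b ^ 2 * M.normSq₂ E)) := by
  funext x
  rw [normalize, cellNorm_modeComb, modeComb, modeComb]
  push_cast
  ring

theorem modeComb_neg (hM : M.InversionSymmetric) (E a b x : ℝ) :
    M.modeComb E a b (-x) = M.modeComb E a (-b) x := by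
  rw [modeComb, modeComb, M.even_y₁ hM, M.odd_y₂ hM]
  push_cast
  ring

variable (M) in
/-- The norm of the mode `φ_{j,k}`. -/
noncomputable def rawNorm (j : ℕ) (k : ℝ) : ℝ :=
  √(M.upper (M.band j k) ^ 2 * M.normSq₁ (M.band j k) +
    Real.sin k ^ 2 * M.normSq₂ (M.band j k))

variable (M) in
/-- The coefficient of `ψ_{E,1}` in the normalized mode. -/
noncomputable def coeff₁ (j : ℕ) (k : ℝ) : ℝ := M.upper (M.band j k) / M.rawNorm j k

variable (M) in
/-- The coefficient of `i ψ_{E,2}` in the normalized mode. -/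
noncomputable def coeff₂ (j : ℕ) (k : ℝ) : ℝ := Real.sin k / M.rawNorm j k

namespace IsRegularBand

variable {j : ℕ}

/-- On the band `e^{ik} - D = i sin k`, so the coefficients of `ψ_{E,1}` and `i ψ_{E,2}` are real.
-/
theorem rawMode_eq (h : M.IsRegularBand j) {k : ℝ} (hk : k ∈ Icc 0 Real.pi) :
    M.rawMode j k = M.modeComb (M.band j k) (M.upper (M.band j k)) (Real.sin k) := by
  have hd := h.disc_band k hk
  funext x
  rw [rawMode, psi₁_eq, psi₂_eq, modeComb]
  change (M.upper (M.band j k) : ℂ) * _ + (_ - (M.disc (M.band j k) : ℂ)) * _ = _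
  rw [hd, mul_comm Complex.I, Complex.exp_mul_I]
  push_cast
  ring

theorem normalize_rawMode (h : M.IsRegularBand j) {k : ℝ} (hk : k ∈ Icc 0 Real.pi) :
    M.normalize (M.rawMode j k) = M.modeComb (M.band j k) (M.coeff₁ j k) (M.coeff₂ j k) := by
  rw [h.rawMode_eq hk, normalize_modeComb]; rfl

theorem upper_mul_lower (hM : M.InversionSymmetric) (h : M.IsRegularBand j) {k : ℝ}
    (hk : k ∈ Icc 0 Real.pi) :
    M.upper (M.band j k) * M.lower (M.band j k) = -Real.sin k ^ 2 := by
  have h1 := disc_sq hM (M.band j k)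
  rw [h.disc_band k hk] at h1
  linarith [Real.sin_sq_add_cos_sq k]

theorem upper_ne_zero (hM : M.InversionSymmetric) (h : M.IsRegularBand j) {k : ℝ}
    (hk : k ∈ Ioo 0 Real.pi) : M.upper (M.band j k) ≠ 0 := by
  intro h0
  have h1 := h.upper_mul_lower hM (Ioo_subset_Icc_self hk)
  have h2 := pow_pos (Real.sin_pos_of_mem_Ioo hk) 2
  rw [h0, zero_mul] at h1
  linarith

theorem rawMode_ne_zero (h : M.IsRegularBand j) {k : ℝ} (hk : k ∈ Icc 0 Real.pi)
    (hp : M.upper (M.band j k) ≠ 0) : M.rawMode j k ≠ 0 := by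
  intro h0
  have := congrFun h0 0
  rw [h.rawMode_eq hk, modeComb] at this
  simp at this
  exact hp this

theorem halfMode_eq (h : M.IsRegularBand j) {k : ℝ} (hk : k ∈ Icc 0 Real.pi)
    (hp : M.upper (M.band j k) ≠ 0) :
    M.halfMode j k = M.modeComb (M.band j k) (M.coeff₁ j k) (M.coeff₂ j k) := by
  rw [halfMode, if_pos (h.rawMode_ne_zero hk hp), h.normalize_rawMode hk]

theorem dDisc_ne_zero (hM : M.InversionSymmetric) (h : M.IsRegularBand j) {k : ℝ}
    (hk : k ∈ Ioo 0 Real.pi) : M.dDisc (M.band j k) ≠ 0 := by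
  intro h0
  have hd := h.disc_band k (Ioo_subset_Icc_self hk)
  exact h.upper_ne_zero hM hk ((degenerate_iff_dDisc_eq_zero hM
    (by rw [hd]; exact Real.abs_cos_le_one k)).2 h0).1

theorem rawNorm_sq_pos (hM : M.InversionSymmetric) (h : M.IsRegularBand j) {k : ℝ}
    (hk : k ∈ Ioo 0 Real.pi) :
    0 < M.upper (M.band j k) ^ 2 * M.normSq₁ (M.band j k) +
      Real.sin k ^ 2 * M.normSq₂ (M.band j k) :=
  add_pos_of_pos_of_nonneg (mul_pos (pow_two_pos_of_ne_zero (h.upper_ne_zero hM hk))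
    (normSq₁_pos _)) (mul_nonneg (sq_nonneg _) (normSq₂_pos _).le)

theorem rawNorm_pos (hM : M.InversionSymmetric) (h : M.IsRegularBand j) {k : ℝ}
    (hk : k ∈ Ioo 0 Real.pi) : 0 < M.rawNorm j k := Real.sqrt_pos.2 (h.rawNorm_sq_pos hM hk)

theorem coeff_normalized (hM : M.InversionSymmetric) (h : M.IsRegularBand j) {k : ℝ}
    (hk : k ∈ Ioo 0 Real.pi) :
    M.coeff₁ j k ^ 2 * M.normSq₁ (M.band j k) + M.coeff₂ j k ^ 2 * M.normSq₂ (M.band j k) = 1 := by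
  have h1 := h.rawNorm_pos hM hk
  have h2 : M.rawNorm j k ^ 2 = _ := Real.sq_sqrt (h.rawNorm_sq_pos hM hk).le
  rw [coeff₁, coeff₂]
  field_simp
  rw [h2]

/-- As a function of `c = cos k` the band is a continuous right inverse of `D`, and `D' ≠ 0` inside;
the inverse function rule applies. -/
theorem differentiableAt_band (hM : M.InversionSymmetric) (h : M.IsRegularBand j) {k : ℝ}
    (hk : k ∈ Ioo 0 Real.pi) : DifferentiableAt ℝ (M.band j) k := by
  have hac : Real.arccos (Real.cos k) = k := Real.arccos_cos hk.1.le hk.2.le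
  have hcont : ContinuousAt (fun c => M.band j (Real.arccos c)) (Real.cos k) := by
    refine ContinuousAt.comp (g := M.band j) ?_ Real.continuous_arccos.continuousAt
    rw [hac]
    exact h.continuousOn.continuousAt (Icc_mem_nhds hk.1 hk.2)
  have hinv : ∀ᶠ c in 𝓝 (Real.cos k), M.disc (M.band j (Real.arccos c)) = c := by
    have h1 : -1 < Real.cos k := by
      rw [← Real.cos_pi]
      exact Real.strictAntiOn_cos ⟨hk.1.le, hk.2.le⟩ ⟨Real.pi_pos.le, le_rfl⟩ hk.2
    have h2 : Real.cos k < 1 := by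
      rw [← Real.cos_zero]
      exact Real.strictAntiOn_cos ⟨le_rfl, Real.pi_pos.le⟩ ⟨hk.1.le, hk.2.le⟩ hk.1
    filter_upwards [Ioo_mem_nhds h1 h2] with c hc
    rw [h.disc_band _ ⟨Real.arccos_nonneg c, Real.arccos_le_pi c⟩,
      Real.cos_arccos hc.1.le hc.2.le]
  have hder := HasDerivAt.of_local_left_inverse hcont (f := M.disc)
    (f' := M.dDisc (M.band j k)) (by rw [hac]; exact hasDerivAt_disc _)
    (h.dDisc_ne_zero hM hk) hinv
  have hcomp := (hder.comp k (Real.hasDerivAt_cos k)).differentiableAt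
  refine hcomp.congr_of_eventuallyEq ?_
  filter_upwards [Ioo_mem_nhds hk.1 hk.2] with k' hk'
  simp [Real.arccos_cos hk'.1.le hk'.2.le]

end IsRegularBand

theorem hasDerivAt_normSq₁ (E : ℝ) :
    HasDerivAt M.normSq₁ (2 * ∫ x in (0 : ℝ)..1, M.ε x * (M.y₁ E x * M.dy₁ E x)) E := by
  refine (M.isWeight_ε.hasDerivAt_integral (F := fun E x => M.y₁ E x * M.y₁ E x)
    (F' := fun E x => M.dy₁ E x * M.y₁ E x + M.y₁ E x * M.dy₁ E x)
    (M.continuous_uncurry_y₁.mul M.continuous_uncurry_y₁)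
    ((M.continuous_uncurry_dy₁.mul M.continuous_uncurry_y₁).add
      (M.continuous_uncurry_y₁.mul M.continuous_uncurry_dy₁))
    (fun E x => (M.hasDerivAt_y₁ E x).mul (M.hasDerivAt_y₁ E x)) E).congr_deriv ?_
  rw [← intervalIntegral.integral_const_mul]
  congr 1
  funext x
  ring

theorem hasDerivAt_normSq₂ (E : ℝ) :
    HasDerivAt M.normSq₂ (2 * ∫ x in (0 : ℝ)..1, M.ε x * (M.y₂ E x * M.dy₂ E x)) E := by
  refine (M.isWeight_ε.hasDerivAt_integral (F := fun E x => M.y₂ E x * M.y₂ E x)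
    (F' := fun E x => M.dy₂ E x * M.y₂ E x + M.y₂ E x * M.dy₂ E x)
    (M.continuous_uncurry_y₂.mul M.continuous_uncurry_y₂)
    ((M.continuous_uncurry_dy₂.mul M.continuous_uncurry_y₂).add
      (M.continuous_uncurry_y₂.mul M.continuous_uncurry_dy₂))
    (fun E x => (M.hasDerivAt_y₂ E x).mul (M.hasDerivAt_y₂ E x)) E).congr_deriv ?_
  rw [← intervalIntegral.integral_const_mul]
  congr 1
  funext x
  ring

namespace IsRegularBand

variable {j : ℕ}

theorem differentiableAt_rawNorm (hM : M.InversionSymmetric) (h : M.IsRegularBand j) {k : ℝ}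
    (hk : k ∈ Ioo 0 Real.pi) : DifferentiableAt ℝ (M.rawNorm j) k := by
  have hE := h.differentiableAt_band hM hk
  have h1 : DifferentiableAt ℝ (fun k => M.upper (M.band j k)) k :=
    (differentiable_upper _).comp k hE
  have h2 : DifferentiableAt ℝ (fun k => M.normSq₁ (M.band j k)) k :=
    (hasDerivAt_normSq₁ _).differentiableAt.comp k hE
  have h3 : DifferentiableAt ℝ (fun k => M.normSq₂ (M.band j k)) k :=
    (hasDerivAt_normSq₂ _).differentiableAt.comp k hE
  exact (((h1.pow 2).mul h2).add ((Real.differentiable_sin.differentiableAt.pow 2).mul h3)).sqrt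
    (h.rawNorm_sq_pos hM hk).ne'

theorem differentiableAt_coeff₁ (hM : M.InversionSymmetric) (h : M.IsRegularBand j) {k : ℝ}
    (hk : k ∈ Ioo 0 Real.pi) : DifferentiableAt ℝ (M.coeff₁ j) k :=
  DifferentiableAt.div ((differentiable_upper _).comp k (h.differentiableAt_band hM hk))
    (h.differentiableAt_rawNorm hM hk) (h.rawNorm_pos hM hk).ne'

theorem differentiableAt_coeff₂ (hM : M.InversionSymmetric) (h : M.IsRegularBand j) {k : ℝ}
    (hk : k ∈ Ioo 0 Real.pi) : DifferentiableAt ℝ (M.coeff₂ j) k :=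
  DifferentiableAt.div Real.differentiable_sin.differentiableAt
    (h.differentiableAt_rawNorm hM hk) (h.rawNorm_pos hM hk).ne'

theorem periodicPart_eq (hM : M.InversionSymmetric) (h : M.IsRegularBand j) {k : ℝ}
    (hk : k ∈ Ioo 0 Real.pi) (x : ℝ) :
    M.periodicPart j k x = Complex.exp (-(Complex.I * (k : ℂ) * (x : ℂ))) *
      M.modeComb (M.band j k) (M.coeff₁ j k) (M.coeff₂ j k) x := by
  rw [periodicPart, blochMode, if_pos hk.1.le,
    h.halfMode_eq (Ioo_subset_Icc_self hk) (h.upper_ne_zero hM hk)]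

theorem periodicPart_add_one (hM : M.InversionSymmetric) (h : M.IsRegularBand j) {k : ℝ}
    (hk : k ∈ Ioo 0 Real.pi) (x : ℝ) : M.periodicPart j k (x + 1) = M.periodicPart j k x := by
  have hk' := Ioo_subset_Icc_self hk
  have hpr := h.upper_mul_lower hM hk'
  have hd := h.disc_band k hk'
  rw [h.periodicPart_eq hM hk, h.periodicPart_eq hM hk]
  have e1 := (M.y₁_add_one (M.band j k) x).1
  have e2 := (M.y₂_add_one (M.band j k) x).1
  rw [w₂_one hM] at e2
  have hexp : Complex.exp (-(Complex.I * (k : ℂ) * ((x + 1 : ℝ) : ℂ))) *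
      (Real.cos k + Complex.I * Real.sin k) =
      Complex.exp (-(Complex.I * (k : ℂ) * (x : ℂ))) := by
    have : (Real.cos k + Complex.I * Real.sin k : ℂ) = Complex.exp (Complex.I * k) := by
      rw [mul_comm Complex.I (k : ℂ), Complex.exp_mul_I]; push_cast; ring
    rw [this, ← Complex.exp_add]
    congr 1
    push_cast
    ring
  rw [← hexp, mul_assoc (Complex.exp _)]
  congr 1
  simp only [modeComb, e1, e2]
  change M.y₁ (M.band j k) 1 = _ at hd
  change M.y₂ (M.band j k) 1 * M.w₁ (M.band j k) 1 = _ at hpr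
  have hN := (h.rawNorm_pos hM hk).ne'
  -- `c1` and `c2` are the rows of the eigenvector equation for the monodromy matrix after removing
  -- the diagonal part `cos k`.
  have c1 : M.coeff₁ j k * M.w₁ (M.band j k) 1 = -Real.sin k * M.coeff₂ j k := by
    have hpr' : M.upper (M.band j k) * M.w₁ (M.band j k) 1 = -Real.sin k ^ 2 := hpr
    rw [coeff₁, coeff₂]
    field_simp
    rw [hpr']
  have c2 : M.coeff₂ j k * M.y₂ (M.band j k) 1 = Real.sin k * M.coeff₁ j k := by
    rw [coeff₁, coeff₂, upper]
    ring
  have c1' : (M.coeff₁ j k : ℂ) * M.w₁ (M.band j k) 1 = -Real.sin k * M.coeff₂ j k := by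
    exact_mod_cast c1
  have c2' : (M.coeff₂ j k : ℂ) * M.y₂ (M.band j k) 1 = Real.sin k * M.coeff₁ j k := by
    exact_mod_cast c2
  rw [hd]
  push_cast at c1' c2' ⊢
  linear_combination (M.y₂ (M.band j k) x : ℂ) * c1' +
    Complex.I * (M.y₁ (M.band j k) x : ℂ) * c2' -
    (Complex.sin k * M.coeff₂ j k * M.y₂ (M.band j k) x : ℂ) * Complex.I_sq

end IsRegularBand

/-! ### Vanishing of the Berry connection. -/

theorem even_dy₁ (hM : M.InversionSymmetric) (E : ℝ) : Function.Even (M.dy₁ E) := fun x =>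
  (M.hasDerivAt_y₁ E (-x)).unique ((M.hasDerivAt_y₁ E x).congr_of_eventuallyEq
    (Eventually.of_forall fun E => M.even_y₁ hM E x))

theorem odd_dy₂ (hM : M.InversionSymmetric) (E : ℝ) : Function.Odd (M.dy₂ E) := fun x =>
  (M.hasDerivAt_y₂ E (-x)).unique ((M.hasDerivAt_y₂ E x).neg.congr_of_eventuallyEq
    (Eventually.of_forall fun E => M.odd_y₂ hM E x))

/-- The integral over `[-1, 0]` equals the one over `[0, 1]` by periodicity and its negative by
oddness. -/
theorem integral_eq_zero_of_odd_of_periodic {S : ℝ → ℝ} (hodd : Function.Odd S)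
    (hper : Function.Periodic S 1) : ∫ x in (0 : ℝ)..1, S x = 0 := by
  have h1 := hper.intervalIntegral_add_eq (-1) 0
  have h2 := intervalIntegral.integral_comp_neg (a := 0) (b := 1) S
  simp only [hodd _, intervalIntegral.integral_neg, neg_zero] at h2
  simp only [neg_add_cancel, zero_add] at h1
  linarith

variable (M) in
/-- The integrand of the inner product `(∂u/∂k, u)_X`. -/
noncomputable def berryDensity (j : ℕ) (k x : ℝ) : ℂ :=
  (M.ε x : ℂ) * deriv (fun k' => M.periodicPart j k' x) k *
    (starRingEnd ℂ) (M.periodicPart j k x)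

variable (M) in
/-- The real part of `e^{ikx} ∂u/∂k`. -/
noncomputable def derivRe (j : ℕ) (k x : ℝ) : ℝ :=
  deriv (M.coeff₁ j) k * M.y₁ (M.band j k) x +
    M.coeff₁ j k * (deriv (M.band j) k * M.dy₁ (M.band j k) x) +
    x * (M.coeff₂ j k * M.y₂ (M.band j k) x)

variable (M) in
/-- The imaginary part of `e^{ikx} ∂u/∂k`. -/
noncomputable def derivIm (j : ℕ) (k x : ℝ) : ℝ :=
  deriv (M.coeff₂ j) k * M.y₂ (M.band j k) x +
    M.coeff₂ j k * (deriv (M.band j) k * M.dy₂ (M.band j k) x) -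
    x * (M.coeff₁ j k * M.y₁ (M.band j k) x)

theorem continuous_derivRe (j : ℕ) (k : ℝ) : Continuous (M.derivRe j k) := by
  have h1 := M.continuous_y₁ (M.band j k)
  have h2 := M.continuous_y₂ (M.band j k)
  have h3 := M.continuous_dy₁ (M.band j k)
  unfold derivRe
  fun_prop

theorem continuous_derivIm (j : ℕ) (k : ℝ) : Continuous (M.derivIm j k) := by
  have h1 := M.continuous_y₁ (M.band j k)
  have h2 := M.continuous_y₂ (M.band j k)
  have h3 := M.continuous_dy₂ (M.band j k)
  unfold derivIm
  fun_prop

namespace IsRegularBand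

variable {j : ℕ}

theorem hasDerivAt_periodicPart (hM : M.InversionSymmetric) (h : M.IsRegularBand j) {k : ℝ}
    (hk : k ∈ Ioo 0 Real.pi) (x : ℝ) :
    HasDerivAt (fun k' => M.periodicPart j k' x)
      (Complex.exp (-(Complex.I * (k : ℂ) * (x : ℂ))) *
        ((M.derivRe j k x : ℂ) + Complex.I * (M.derivIm j k x : ℂ))) k := by
  have hE := (h.differentiableAt_band hM hk).hasDerivAt
  have ha := (h.differentiableAt_coeff₁ hM hk).hasDerivAt
  have hb := (h.differentiableAt_coeff₂ hM hk).hasDerivAt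
  have h1 := ha.mul ((M.hasDerivAt_y₁ (M.band j k) x).comp k hE)
  have h2 := hb.mul ((M.hasDerivAt_y₂ (M.band j k) x).comp k hE)
  have h3 : HasDerivAt (fun k : ℝ => Complex.exp (-(Complex.I * (k : ℂ) * (x : ℂ))))
      (Complex.exp (-(Complex.I * (k : ℂ) * (x : ℂ))) * (-(Complex.I * 1 * (x : ℂ)))) k :=
    ((((hasDerivAt_id k).ofReal_comp.const_mul Complex.I).mul_const (x : ℂ)).neg).cexp
  have h4 := h3.mul (h1.ofReal_comp.add (h2.ofReal_comp.const_mul Complex.I))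
  refine (h4.congr_of_eventuallyEq ?_).congr_deriv ?_
  · filter_upwards [Ioo_mem_nhds hk.1 hk.2] with k' hk'
    rw [h.periodicPart_eq hM hk']
    rfl
  · simp only [derivRe, derivIm, Function.comp_apply, Pi.mul_apply, Pi.add_apply]
    push_cast
    linear_combination (-(Complex.exp (-(Complex.I * (k : ℂ) * (x : ℂ))) * x *
      M.coeff₂ j k * M.y₂ (M.band j k) x)) * Complex.I_sq

theorem berryDensity_eq (hM : M.InversionSymmetric) (h : M.IsRegularBand j) {k : ℝ}
    (hk : k ∈ Ioo 0 Real.pi) (x : ℝ) :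
    M.berryDensity j k x = (M.ε x : ℂ) *
      (((M.derivRe j k x * (M.coeff₁ j k * M.y₁ (M.band j k) x) +
        M.derivIm j k x * (M.coeff₂ j k * M.y₂ (M.band j k) x) : ℝ) : ℂ) +
      Complex.I * ((M.derivIm j k x * (M.coeff₁ j k * M.y₁ (M.band j k) x) -
        M.derivRe j k x * (M.coeff₂ j k * M.y₂ (M.band j k) x) : ℝ) : ℂ)) := by
  rw [berryDensity, (h.hasDerivAt_periodicPart hM hk x).deriv, h.periodicPart_eq hM hk, modeComb]
  have hexp : Complex.exp (-(Complex.I * (k : ℂ) * (x : ℂ))) *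
      (starRingEnd ℂ) (Complex.exp (-(Complex.I * (k : ℂ) * (x : ℂ)))) = 1 := by
    rw [← Complex.exp_conj, ← Complex.exp_add]
    simp only [map_neg, map_mul, Complex.conj_I, Complex.conj_ofReal]
    rw [← Complex.exp_zero]
    congr 1
    ring
  simp only [map_mul, map_add, Complex.conj_ofReal, Complex.conj_I]
  push_cast
  linear_combination ((M.ε x : ℂ) * ((M.derivRe j k x : ℂ) + Complex.I * M.derivIm j k x) *
    (M.coeff₁ j k * M.y₁ (M.band j k) x - Complex.I * (M.coeff₂ j k * M.y₂ (M.band j k) x))) *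
    hexp - ((M.ε x : ℂ) * M.derivIm j k x * M.coeff₂ j k * M.y₂ (M.band j k) x) * Complex.I_sq

theorem periodic_berryDensity (hM : M.InversionSymmetric) (h : M.IsRegularBand j) {k : ℝ}
    (hk : k ∈ Ioo 0 Real.pi) : Function.Periodic (M.berryDensity j k) 1 := by
  intro x
  have e : (fun k' => M.periodicPart j k' (x + 1)) =ᶠ[𝓝 k] fun k' => M.periodicPart j k' x := by
    filter_upwards [Ioo_mem_nhds hk.1 hk.2] with k' hk'
    exact h.periodicPart_add_one hM hk' x
  rw [berryDensity, berryDensity, e.deriv_eq, M.ε_periodic, h.periodicPart_add_one hM hk]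

/-- The terms with a factor `x`, which come from `e^{-ikx}`, cancel. The rest is half the
`k`-derivative of the normalization `coeff_normalized`. -/
theorem integral_re_berryDensity (hM : M.InversionSymmetric) (h : M.IsRegularBand j) {k : ℝ}
    (hk : k ∈ Ioo 0 Real.pi) :
    ∫ x in (0 : ℝ)..1, M.ε x * (M.derivRe j k x * (M.coeff₁ j k * M.y₁ (M.band j k) x) +
        M.derivIm j k x * (M.coeff₂ j k * M.y₂ (M.band j k) x)) = 0 := by
  have hE := (h.differentiableAt_band hM hk).hasDerivAt
  have ha := (h.differentiableAt_coeff₁ hM hk).hasDerivAt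
  have hb := (h.differentiableAt_coeff₂ hM hk).hasDerivAt
  have hnorm := ((ha.pow 2).mul ((hasDerivAt_normSq₁ (M := M) (M.band j k)).comp k hE)).add
    ((hb.pow 2).mul ((hasDerivAt_normSq₂ (M := M) (M.band j k)).comp k hE))
  have hone : HasDerivAt (fun _ : ℝ => (1 : ℝ)) 0 k := hasDerivAt_const k 1
  have e := hnorm.unique (hone.congr_of_eventuallyEq (by
    filter_upwards [Ioo_mem_nhds hk.1 hk.2] with k' hk'
    exact h.coeff_normalized hM hk'))
  simp only [Function.comp_apply, Pi.pow_apply, Nat.cast_ofNat, Nat.add_one_sub_one, pow_one] at e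
  have c1 := M.continuous_y₁ (M.band j k)
  have c2 := M.continuous_y₂ (M.band j k)
  have c3 := M.continuous_dy₁ (M.band j k)
  have c4 := M.continuous_dy₂ (M.band j k)
  have i1 := integral_combination (M := M) (c1.mul c1) (c1.mul c3)
    (M.coeff₁ j k * deriv (M.coeff₁ j) k) (M.coeff₁ j k ^ 2 * deriv (M.band j) k)
  have i2 := integral_combination (M := M) (c2.mul c2) (c2.mul c4)
    (M.coeff₂ j k * deriv (M.coeff₂ j) k) (M.coeff₂ j k ^ 2 * deriv (M.band j) k)
  have i3 := intervalIntegral.integral_add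
    (M.isWeight_ε.intervalIntegrable_mul ((continuous_const.mul (c1.mul c1)).add
      (continuous_const.mul (c1.mul c3)) : Continuous fun x =>
        M.coeff₁ j k * deriv (M.coeff₁ j) k * (M.y₁ (M.band j k) x * M.y₁ (M.band j k) x) +
        M.coeff₁ j k ^ 2 * deriv (M.band j) k * (M.y₁ (M.band j k) x * M.dy₁ (M.band j k) x)) 0 1)
    (M.isWeight_ε.intervalIntegrable_mul ((continuous_const.mul (c2.mul c2)).add
      (continuous_const.mul (c2.mul c4)) : Continuous fun x =>
        M.coeff₂ j k * deriv (M.coeff₂ j) k * (M.y₂ (M.band j k) x * M.y₂ (M.band j k) x) +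
        M.coeff₂ j k ^ 2 * deriv (M.band j) k * (M.y₂ (M.band j k) x * M.dy₂ (M.band j k) x)) 0 1)
  simp only [Pi.mul_apply, Pi.add_apply] at i1 i2 i3
  rw [i1, i2] at i3
  refine Eq.trans ?_ (i3.trans ?_)
  · congr 1
    funext x
    rw [derivRe, derivIm]
    ring
  · change _ * M.normSq₁ (M.band j k) + _ + (_ * M.normSq₂ (M.band j k) + _) = 0
    linear_combination e / 2

theorem integral_berryDensity (hM : M.InversionSymmetric) (h : M.IsRegularBand j) {k : ℝ}
    (hk : k ∈ Ioo 0 Real.pi) : ∫ x in (0 : ℝ)..1, M.berryDensity j k x = 0 := by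
  have c1 := M.continuous_y₁ (M.band j k)
  have c2 := M.continuous_y₂ (M.band j k)
  have c3 := M.continuous_derivRe j k
  have c4 := M.continuous_derivIm j k
  have hcR : Continuous fun x => M.derivRe j k x * (M.coeff₁ j k * M.y₁ (M.band j k) x) +
      M.derivIm j k x * (M.coeff₂ j k * M.y₂ (M.band j k) x) := by fun_prop
  have hcS : Continuous fun x => M.derivIm j k x * (M.coeff₁ j k * M.y₁ (M.band j k) x) -
      M.derivRe j k x * (M.coeff₂ j k * M.y₂ (M.band j k) x) := by fun_prop
  have hS : ∫ x in (0 : ℝ)..1, M.ε x *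
      (M.derivIm j k x * (M.coeff₁ j k * M.y₁ (M.band j k) x) -
        M.derivRe j k x * (M.coeff₂ j k * M.y₂ (M.band j k) x)) = 0 := by
    -- Oddness is checked term by term. Terms with a factor `x` are not periodic one by one, so
    -- periodicity is taken from the imaginary part of the whole density.
    refine integral_eq_zero_of_odd_of_periodic (fun x => ?_) fun x => ?_
    · simp only [derivRe, derivIm, hM.1, M.even_y₁ hM _ x, M.odd_y₂ hM _ x, M.even_dy₁ hM _ x,
        M.odd_dy₂ hM _ x]
      ring
    · have hx := congrArg Complex.im (h.periodic_berryDensity hM hk x)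
      rw [h.berryDensity_eq hM hk, h.berryDensity_eq hM hk] at hx
      simpa only [Complex.re_ofReal_mul, Complex.im_ofReal_mul, Complex.add_im, Complex.ofReal_im,
        Complex.I_mul_im, Complex.ofReal_re, zero_add] using hx
  have e := integral_eq_re_add_im (M := M) hcR hcS
  rw [h.integral_re_berryDensity hM hk, hS] at e
  simp only [Complex.ofReal_zero, mul_zero, add_zero] at e
  rw [← e]
  congr 1
  funext x
  exact h.berryDensity_eq hM hk x

theorem intervalIntegrable_berryDensity (hM : M.InversionSymmetric) (h : M.IsRegularBand j) {k : ℝ}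
    (hk : k ∈ Ioo 0 Real.pi) (a b : ℝ) :
    IntervalIntegrable (M.berryDensity j k) MeasureTheory.volume a b := by
  have e : M.berryDensity j k = _ := funext fun x => h.berryDensity_eq hM hk x
  rw [e]
  have c1 := M.continuous_y₁ (M.band j k)
  have c2 := M.continuous_y₂ (M.band j k)
  have c3 := M.continuous_derivRe j k
  have c4 := M.continuous_derivIm j k
  refine M.isWeight_ε.intervalIntegrable_ofReal_mul ?_ a b
  exact (Complex.continuous_ofReal.comp (by fun_prop)).add
    (continuous_const.mul (Complex.continuous_ofReal.comp (by fun_prop)))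

end IsRegularBand

theorem periodicPart_neg (j : ℕ) {k : ℝ} (hk : k < 0) (x : ℝ) :
    M.periodicPart j k x = M.periodicPart j (-k) (-x) := by
  rw [periodicPart, periodicPart, blochMode, blochMode, if_neg (not_le.2 hk),
    if_pos (neg_nonneg.2 hk.le)]
  congr 2
  push_cast
  ring

theorem deriv_periodicPart_neg (j : ℕ) {k : ℝ} (hk : k < 0) (x : ℝ) :
    deriv (fun k' => M.periodicPart j k' x) k =
      -deriv (fun k' => M.periodicPart j k' (-x)) (-k) := by
  have e : (fun k' => M.periodicPart j k' x) =ᶠ[𝓝 k] fun k' => M.periodicPart j (-k') (-x) := by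
    filter_upwards [Iio_mem_nhds hk] with k' hk'
    exact periodicPart_neg j hk' x
  rw [e.deriv_eq]
  exact deriv_comp_neg (fun k' => M.periodicPart j k' (-x)) k

/-- Reflecting `x` turns negative wavenumbers into positive ones, so the vanishing for `k > 0`
carries over. -/
theorem berryDensity_neg (hM : M.InversionSymmetric) (j : ℕ) {k : ℝ} (hk : k < 0) (x : ℝ) :
    M.berryDensity j k x = -M.berryDensity j (-k) (-x) := by
  rw [berryDensity, berryDensity, deriv_periodicPart_neg j hk, periodicPart_neg j hk, hM.1]
  ring

namespace IsRegularBand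

variable {j : ℕ}

theorem differentiableAt_periodicPart (hM : M.InversionSymmetric) (h : M.IsRegularBand j) {k : ℝ}
    (hk : k ∈ Ioo (-Real.pi) 0 ∪ Ioo 0 Real.pi) (x : ℝ) :
    DifferentiableAt ℝ (fun k' => M.periodicPart j k' x) k := by
  rcases hk with hk | hk
  · have hk' : -k ∈ Ioo 0 Real.pi := ⟨neg_pos.2 hk.2, neg_lt.1 hk.1⟩
    have h1 := (h.hasDerivAt_periodicPart hM hk' (-x)).differentiableAt.comp k
      (differentiable_neg k)
    refine h1.congr_of_eventuallyEq ?_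
    filter_upwards [Iio_mem_nhds hk.2] with k' hk'
    exact periodicPart_neg j hk' x
  · exact (h.hasDerivAt_periodicPart hM hk x).differentiableAt

theorem intervalIntegrable_berryDensity_union (hM : M.InversionSymmetric) (h : M.IsRegularBand j)
    {k : ℝ} (hk : k ∈ Ioo (-Real.pi) 0 ∪ Ioo 0 Real.pi) :
    IntervalIntegrable (M.berryDensity j k) MeasureTheory.volume 0 1 := by
  rcases hk with hk | hk
  · have hk' : -k ∈ Ioo 0 Real.pi := ⟨neg_pos.2 hk.2, neg_lt.1 hk.1⟩
    have e : M.berryDensity j k = -fun x => M.berryDensity j (-k) (-x) :=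
      funext fun x => berryDensity_neg hM j hk.2 x
    rw [e]
    refine IntervalIntegrable.neg ?_
    have := (h.intervalIntegrable_berryDensity hM hk' 0 (-1)).comp_sub_left 0
    simpa using this
  · exact h.intervalIntegrable_berryDensity hM hk 0 1

theorem berryConnection_eq_zero (hM : M.InversionSymmetric) (h : M.IsRegularBand j)
    {k : ℝ} (hk : k ∈ Ioo (-Real.pi) 0 ∪ Ioo 0 Real.pi) : M.berryConnection j k = 0 := by
  change ∫ x in (0 : ℝ)..1, M.berryDensity j k x = 0
  rcases hk with hk | hk
  · have hk' : -k ∈ Ioo 0 Real.pi := ⟨neg_pos.2 hk.2, neg_lt.1 hk.1⟩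
    have h1 := (h.periodic_berryDensity hM hk').intervalIntegral_add_eq (-1) 0
    have h2 := intervalIntegral.integral_comp_neg (a := 0) (b := 1) (M.berryDensity j (-k))
    simp only [neg_add_cancel, zero_add] at h1
    rw [neg_zero, h1, h.integral_berryDensity hM hk'] at h2
    simp only [berryDensity_neg hM j hk.2, intervalIntegral.integral_neg, h2, neg_zero]
  · exact h.integral_berryDensity hM hk

end IsRegularBand

/-! ### Limits of the Bloch modes at the end points. -/

theorem tendstoUniformlyOn_modeComb {ι : Type*} {l : Filter ι} {E a b : ι → ℝ} {E₀ a₀ b₀ : ℝ}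
    (hE : Tendsto E l (𝓝 E₀)) (ha : Tendsto a l (𝓝 a₀)) (hb : Tendsto b l (𝓝 b₀)) {K : Set ℝ}
    (hK : IsCompact K) :
    TendstoUniformlyOn (fun i => M.modeComb (E i) (a i) (b i)) (M.modeComb E₀ a₀ b₀) l K := by
  let F : ℝ × ℝ × ℝ → ℝ → ℂ := fun p x => M.modeComb p.1 p.2.1 p.2.2 x
  have hF : Continuous (Function.uncurry F) := by
    have h1 : Continuous fun w : (ℝ × ℝ × ℝ) × ℝ => M.y₁ w.1.1 w.2 :=
      M.continuous_uncurry_y₁.comp (continuous_fst.fst.prodMk continuous_snd)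
    have h2 : Continuous fun w : (ℝ × ℝ × ℝ) × ℝ => M.y₂ w.1.1 w.2 :=
      M.continuous_uncurry_y₂.comp (continuous_fst.fst.prodMk continuous_snd)
    exact (Complex.continuous_ofReal.comp (continuous_fst.snd.fst.mul h1)).add
      (continuous_const.mul (Complex.continuous_ofReal.comp (continuous_fst.snd.snd.mul h2)))
  obtain ⟨U, hU, hUn⟩ := exists_compact_mem_nhds (E₀, a₀, b₀)
  have h1 := ((hU.prod hK).uniformContinuousOn_of_continuous
    (f := Function.uncurry F) hF.continuousOn).tendstoUniformlyOn (x := (E₀, a₀, b₀))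
    (F := F) (mem_of_mem_nhds hUn)
  rw [nhdsWithin_eq_nhds.2 hUn] at h1
  exact fun u hu => (hE.prodMk_nhds (ha.prodMk_nhds hb)).eventually (h1 u hu)

/-- The Bloch modes of a band have the limit `a ψ_{E,1} + i b ψ_{E,2}` at an end point of
`[0, π]`. -/
structure HasEndpointMode (M : PhotonicMedium) (j : ℕ) (k₀ a b : ℝ) : Prop where
  -- The interval is `[-1, 1]` because modes at negative `k` evaluate at `-x`.
  tendsto : TendstoUniformlyOn (M.halfMode j) (M.modeComb (M.band j k₀) a b)
    (𝓝[Ioo 0 Real.pi] k₀) (Icc (-1) 1)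
  eq : M.halfMode j k₀ = M.modeComb (M.band j k₀) a b
  -- This makes the overlap of the mode with its reflection real.
  cross : a * b * M.crossTerm (M.band j k₀) = 0

theorem tendsto_of_sq_of_nonneg {ι : Type*} {l : Filter ι} {c d : ι → ℝ} {t : ℝ}
    (hd : Tendsto d l (𝓝 t)) (h : ∀ᶠ i in l, c i ^ 2 = d i) (hc : ∀ᶠ i in l, 0 ≤ c i) :
    Tendsto c l (𝓝 √t) := by
  refine ((Real.continuous_sqrt.tendsto t).comp hd).congr' ?_
  filter_upwards [h, hc] with i h1 h2
  rw [Function.comp_apply, ← h1, Real.sqrt_sq h2]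

namespace IsRegularBand

variable {j : ℕ}

theorem tendsto_band (h : M.IsRegularBand j) {k₀ : ℝ} (hk₀ : k₀ ∈ Icc 0 Real.pi) :
    Tendsto (M.band j) (𝓝[Ioo 0 Real.pi] k₀) (𝓝 (M.band j k₀)) :=
  (h.continuousOn k₀ hk₀).tendsto.mono_left (nhdsWithin_mono _ Ioo_subset_Icc_self)

theorem hasEndpointMode_of_tendsto (hM : M.InversionSymmetric) (h : M.IsRegularBand j)
    {k₀ a b : ℝ} (hk₀ : k₀ ∈ Icc 0 Real.pi)
    (ha : Tendsto (M.coeff₁ j) (𝓝[Ioo 0 Real.pi] k₀) (𝓝 a))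
    (hb : Tendsto (M.coeff₂ j) (𝓝[Ioo 0 Real.pi] k₀) (𝓝 b)) :
    TendstoUniformlyOn (M.halfMode j) (M.modeComb (M.band j k₀) a b)
      (𝓝[Ioo 0 Real.pi] k₀) (Icc (-1) 1) := by
  refine (tendstoUniformlyOn_modeComb (h.tendsto_band hk₀) ha hb isCompact_Icc).congr ?_
  filter_upwards [self_mem_nhdsWithin] with k hk x _
  rw [h.halfMode_eq (Ioo_subset_Icc_self hk) (h.upper_ne_zero hM hk)]

/-- Substituting `sin² k = -upper · lower` into the squared norm exposes `two_mul_dDisc`. The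
squares of both coefficients become quotients by `2 D'`, whose limits are accessible; signs are
treated separately. -/
theorem rawNorm_sq (hM : M.InversionSymmetric) (h : M.IsRegularBand j) {k : ℝ}
    (hk : k ∈ Ioo 0 Real.pi) :
    M.rawNorm j k ^ 2 = -M.upper (M.band j k) * (2 * M.dDisc (M.band j k)) := by
  have h1 : M.rawNorm j k ^ 2 = _ := Real.sq_sqrt (h.rawNorm_sq_pos hM hk).le
  have h2 := h.upper_mul_lower hM (Ioo_subset_Icc_self hk)
  rw [h1, two_mul_dDisc hM]
  linear_combination M.normSq₂ (M.band j k) * h2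

theorem coeff₁_sq (hM : M.InversionSymmetric) (h : M.IsRegularBand j) {k : ℝ}
    (hk : k ∈ Ioo 0 Real.pi) :
    M.coeff₁ j k ^ 2 = -M.upper (M.band j k) / (2 * M.dDisc (M.band j k)) := by
  have h1 := h.dDisc_ne_zero hM hk
  have h2 := h.upper_ne_zero hM hk
  rw [coeff₁, div_pow, h.rawNorm_sq hM hk]
  field_simp

theorem coeff₂_sq (hM : M.InversionSymmetric) (h : M.IsRegularBand j) {k : ℝ}
    (hk : k ∈ Ioo 0 Real.pi) :
    M.coeff₂ j k ^ 2 = M.lower (M.band j k) / (2 * M.dDisc (M.band j k)) := by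
  have h1 := h.dDisc_ne_zero hM hk
  have h2 := h.upper_ne_zero hM hk
  have h3 := h.upper_mul_lower hM (Ioo_subset_Icc_self hk)
  rw [coeff₂, div_pow, h.rawNorm_sq hM hk, ← neg_eq_iff_eq_neg.2 h3]
  field_simp

theorem coeff₂_nonneg (j : ℕ) {k : ℝ} (hk : k ∈ Ioo 0 Real.pi) : 0 ≤ M.coeff₂ j k :=
  div_nonneg (Real.sin_pos_of_mem_Ioo hk).le (Real.sqrt_nonneg _)

theorem mem_Icc_of_endpoint {k₀ : ℝ} (hk₀ : k₀ = 0 ∨ k₀ = Real.pi) : k₀ ∈ Icc 0 Real.pi := by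
  rcases hk₀ with rfl | rfl
  · exact ⟨le_rfl, Real.pi_pos.le⟩
  · exact ⟨Real.pi_pos.le, le_rfl⟩

theorem sin_endpoint {k₀ : ℝ} (hk₀ : k₀ = 0 ∨ k₀ = Real.pi) : Real.sin k₀ = 0 := by
  rcases hk₀ with rfl | rfl
  · exact Real.sin_zero
  · exact Real.sin_pi

/-- At a simple end point at which `ψ_{E,2}(1) ≠ 0` the mode is `± ψ_{E,1}`, up to normalization. -/
theorem exists_hasEndpointMode_of_upper_ne_zero (hM : M.InversionSymmetric)
    (h : M.IsRegularBand j) {k₀ : ℝ} (hk₀ : k₀ = 0 ∨ k₀ = Real.pi)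
    (hp : M.upper (M.band j k₀) ≠ 0) :
    ∃ a, M.HasEndpointMode j k₀ a 0 ∧ a ^ 2 * M.normSq₁ (M.band j k₀) = 1 := by
  have hmem := mem_Icc_of_endpoint hk₀
  have hsin := sin_endpoint hk₀
  have hA := normSq₁_pos (M := M) (M.band j k₀)
  have hE := h.tendsto_band hmem
  have hsin' : Tendsto Real.sin (𝓝[Ioo 0 Real.pi] k₀) (𝓝 (Real.sin k₀)) :=
    Real.continuous_sin.continuousAt.mono_left nhdsWithin_le_nhds
  have hup := ((differentiable_upper (M := M)).continuous.tendsto _).comp hE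
  have hN : Tendsto (M.rawNorm j) (𝓝[Ioo 0 Real.pi] k₀) (𝓝 (M.rawNorm j k₀)) := by
    refine (Real.continuous_sqrt.tendsto _).comp ?_
    exact ((hup.pow 2).mul ((continuous_normSq₁.tendsto _).comp hE)).add
      ((hsin'.pow 2).mul ((continuous_normSq₂.tendsto _).comp hE))
  have hpos : 0 < M.upper (M.band j k₀) ^ 2 * M.normSq₁ (M.band j k₀) :=
    mul_pos (pow_two_pos_of_ne_zero hp) hA
  have hN0 : M.rawNorm j k₀ ^ 2 = M.upper (M.band j k₀) ^ 2 * M.normSq₁ (M.band j k₀) := by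
    have e : M.upper (M.band j k₀) ^ 2 * M.normSq₁ (M.band j k₀) + Real.sin k₀ ^ 2 *
        M.normSq₂ (M.band j k₀) = M.upper (M.band j k₀) ^ 2 * M.normSq₁ (M.band j k₀) := by
      rw [hsin]; ring
    rw [rawNorm, e, Real.sq_sqrt hpos.le]
  have hNne : M.rawNorm j k₀ ≠ 0 := fun h0 => by
    rw [h0] at hN0
    simp only [ne_eq, OfNat.ofNat_ne_zero, not_false_eq_true, zero_pow] at hN0
    linarith
  have hb0 : M.coeff₂ j k₀ = 0 := by rw [coeff₂, hsin, zero_div]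
  refine ⟨M.coeff₁ j k₀, ⟨?_, ?_, by ring⟩, ?_⟩
  · have e := h.hasEndpointMode_of_tendsto hM hmem (a := M.coeff₁ j k₀) (b := M.coeff₂ j k₀)
      (hup.div hN hNne) (hsin'.div hN hNne)
    rwa [hb0] at e
  · rw [h.halfMode_eq hmem hp, hb0]
  · rw [coeff₁, div_pow, hN0]
    field_simp

/-- At a simple end point at which `ψ_{E,2}(1) = 0` the mode is `i ψ_{E,2}`, up to
normalization. -/
theorem exists_hasEndpointMode_of_upper_eq_zero (hM : M.InversionSymmetric)
    (h : M.IsRegularBand j) {k₀ : ℝ} (hk₀ : k₀ = 0 ∨ k₀ = Real.pi)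
    (hd : M.dDisc (M.band j k₀) ≠ 0) (hp : M.upper (M.band j k₀) = 0) :
    ∃ b, M.HasEndpointMode j k₀ 0 b ∧ b ^ 2 * M.normSq₂ (M.band j k₀) = 1 := by
  have hmem := mem_Icc_of_endpoint hk₀
  have hsin := sin_endpoint hk₀
  have hB := normSq₂_pos (M := M) (M.band j k₀)
  have hE := h.tendsto_band hmem
  have hup := ((differentiable_upper (M := M)).continuous.tendsto _).comp hE
  have hlo := ((differentiable_lower (M := M)).continuous.tendsto _).comp hE
  have hdd := (((continuous_dDisc (M := M)).tendsto _).comp hE).const_mul 2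
  have hd2 : 2 * M.dDisc (M.band j k₀) ≠ 0 := mul_ne_zero two_ne_zero hd
  have e1 := two_mul_dDisc hM (M.band j k₀)
  rw [hp, zero_mul, sub_zero] at e1
  have hr : M.lower (M.band j k₀) ≠ 0 := fun h0 => hd2 (by rw [e1, h0, zero_mul])
  have e2 : M.lower (M.band j k₀) / (2 * M.dDisc (M.band j k₀)) =
      1 / M.normSq₂ (M.band j k₀) := by
    rw [e1]
    field_simp
  -- `coeff₂` is nonnegative since `sin k > 0`, so its limit is the positive root, in agreement with
  -- the prescribed mode `i ψ_{E,2} / ‖ψ_{E,2}‖`.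
  have hb : Tendsto (M.coeff₂ j) (𝓝[Ioo 0 Real.pi] k₀) (𝓝 √(1 / M.normSq₂ (M.band j k₀))) := by
    rw [← e2]
    refine tendsto_of_sq_of_nonneg (hlo.div hdd hd2) ?_ ?_
    · filter_upwards [self_mem_nhdsWithin] with k hk using h.coeff₂_sq hM hk
    · filter_upwards [self_mem_nhdsWithin] with k hk using coeff₂_nonneg j hk
  have ha : Tendsto (M.coeff₁ j) (𝓝[Ioo 0 Real.pi] k₀) (𝓝 0) := by
    have h1 := hup.neg.div hdd hd2
    rw [hp, neg_zero, zero_div] at h1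
    have h2 : Tendsto (fun k => |M.coeff₁ j k|) (𝓝[Ioo 0 Real.pi] k₀) (𝓝 √0) := by
      refine tendsto_of_sq_of_nonneg h1 ?_ (Eventually.of_forall fun k => abs_nonneg _)
      filter_upwards [self_mem_nhdsWithin] with k hk
      rw [sq_abs]
      exact h.coeff₁_sq hM hk
    rw [Real.sqrt_zero] at h2
    exact tendsto_zero_iff_abs_tendsto_zero _ |>.2 h2
  refine ⟨_, ⟨h.hasEndpointMode_of_tendsto hM hmem ha hb, ?_, by ring⟩, ?_⟩
  · have hraw : M.rawMode j k₀ = 0 := by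
      rw [h.rawMode_eq hmem, hp, hsin]
      funext x
      simp [modeComb]
    have hrank : Module.finrank ℂ (M.blochSpace k₀ (M.band j k₀)) ≠ 2 := by
      rw [finrank_blochSpace hM, if_pos (h.disc_band k₀ hmem), if_neg hd]
      norm_num
    rw [halfMode, if_neg (not_not.2 hraw), if_neg hrank]
    have e3 : M.normalize (M.psi₂ (M.band j k₀)) = fun x =>
        ((√(1 / M.normSq₂ (M.band j k₀)) : ℝ) : ℂ) * M.y₂ (M.band j k₀) x := by
      have e4 : M.cellInner (M.psi₂ (M.band j k₀)) (M.psi₂ (M.band j k₀)) =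
          (M.normSq₂ (M.band j k₀) : ℂ) := by
        rw [cellInner, normSq₂, ← intervalIntegral.integral_ofReal, psi₂_eq]
        congr 1
        funext x
        rw [Complex.conj_ofReal]
        push_cast
        ring
      funext x
      rw [normalize, cellNorm, e4, Complex.ofReal_re, psi₂_eq, Real.sqrt_div zero_le_one,
        Real.sqrt_one]
      push_cast
      ring
    rw [e3]
    funext x
    rw [modeComb]
    push_cast
    ring
  · rw [Real.sq_sqrt (by positivity)]
    field_simp

/-- At a degenerate end point the Bloch modes have a limit to which `ψ_{E,1}` and `ψ_{E,2}`
contribute equally. -/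
theorem exists_hasEndpointMode_of_degenerate (hM : M.InversionSymmetric)
    (h : M.IsRegularBand j) {k₀ : ℝ} (hk₀ : k₀ = 0 ∨ k₀ = Real.pi)
    (hd : M.dDisc (M.band j k₀) = 0) :
    ∃ a b, M.HasEndpointMode j k₀ a b ∧
      a ^ 2 * M.normSq₁ (M.band j k₀) = b ^ 2 * M.normSq₂ (M.band j k₀) := by
  have hmem := mem_Icc_of_endpoint hk₀
  have hsin := sin_endpoint hk₀
  have hA := normSq₁_pos (M := M) (M.band j k₀)
  have hB := normSq₂_pos (M := M) (M.band j k₀)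
  have hE := h.tendsto_band hmem
  have hdisc := h.disc_band k₀ hmem
  obtain ⟨hp, hr⟩ := (degenerate_iff_dDisc_eq_zero hM
    (by rw [hdisc]; exact Real.abs_cos_le_one k₀)).2 hd
  have hσ : M.disc (M.band j k₀) ^ 2 = 1 := by rw [disc_sq hM, hp, zero_mul, add_zero]
  have hσ0 : M.disc (M.band j k₀) ≠ 0 := fun h0 => by rw [h0] at hσ; norm_num at hσ
  have hne : ∀ᶠ k in 𝓝[Ioo 0 Real.pi] k₀, M.band j k ≠ M.band j k₀ := by
    filter_upwards [self_mem_nhdsWithin, nhdsWithin_Ioo_le_nhdsNE hk₀ self_mem_nhdsWithin]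
      with k hk1 hk2 heq
    exact hk2 (h.injOn (Ioo_subset_Icc_self hk1) hmem heq)
  have hE' : Tendsto (M.band j) (𝓝[Ioo 0 Real.pi] k₀) (𝓝[≠] (M.band j k₀)) :=
    tendsto_nhdsWithin_iff.2 ⟨hE, hne⟩
  -- The squared coefficients have the form `0 / 0` at the end point. Dividing numerator and
  -- denominator by `E_j(k) - E₀` replaces `upper` and `lower` by slopes with known limits, and
  -- gives `1 / (2 ‖ψ_{E,1}‖²)` and `1 / (2 ‖ψ_{E,2}‖²)`.
  have hps := (hasDerivAt_iff_tendsto_slope.1 (hasDerivAt_upper_of_degenerate hM hp)).comp hE'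
  have hrs := (hasDerivAt_iff_tendsto_slope.1 (hasDerivAt_lower_of_degenerate hM hr)).comp hE'
  set E₀ := M.band j k₀ with hE₀
  have hAt := ((continuous_normSq₁ (M := M)).tendsto E₀).comp hE
  have hBt := ((continuous_normSq₂ (M := M)).tendsto E₀).comp hE
  have hden := (hrs.mul hBt).sub (hps.mul hAt)
  have hden0 : -(M.disc E₀ * M.normSq₁ E₀) * M.normSq₂ E₀ -
      M.disc E₀ * M.normSq₂ E₀ * M.normSq₁ E₀ ≠ 0 := by
    have : -(M.disc E₀ * M.normSq₁ E₀) * M.normSq₂ E₀ -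
      M.disc E₀ * M.normSq₂ E₀ * M.normSq₁ E₀ =
      -2 * (M.disc E₀ * M.normSq₁ E₀ * M.normSq₂ E₀) := by ring
    rw [this]
    exact mul_ne_zero (by norm_num) (mul_ne_zero (mul_ne_zero hσ0 hA.ne') hB.ne')
  have hden' : ∀ k,
      slope M.lower E₀ (M.band j k) * M.normSq₂ (M.band j k) -
        slope M.upper E₀ (M.band j k) * M.normSq₁ (M.band j k) =
      2 * M.dDisc (M.band j k) / (M.band j k - E₀) := by
    intro k
    rw [slope_def_field, slope_def_field, hp, hr, two_mul_dDisc hM]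
    ring
  have t1 : Tendsto (fun k => M.coeff₁ j k ^ 2) (𝓝[Ioo 0 Real.pi] k₀)
      (𝓝 (1 / (2 * M.normSq₁ E₀))) := by
    have h1 := hps.neg.div hden hden0
    have e : -(M.disc E₀ * M.normSq₂ E₀) / (-(M.disc E₀ * M.normSq₁ E₀) * M.normSq₂ E₀ -
        M.disc E₀ * M.normSq₂ E₀ * M.normSq₁ E₀) = 1 / (2 * M.normSq₁ E₀) := by
      rw [div_eq_div_iff hden0 (by positivity)]
      ring
    rw [e] at h1
    refine h1.congr' ?_
    filter_upwards [self_mem_nhdsWithin, hne] with k hk hk'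
    have hs : M.band j k - E₀ ≠ 0 := sub_ne_zero.2 hk'
    have hd' := h.dDisc_ne_zero hM hk
    simp only [Function.comp_apply, Pi.div_apply]
    rw [hden' k, h.coeff₁_sq hM hk, slope_def_field, hp, sub_zero]
    field_simp
  have t2 : Tendsto (fun k => M.coeff₂ j k ^ 2) (𝓝[Ioo 0 Real.pi] k₀)
      (𝓝 (1 / (2 * M.normSq₂ E₀))) := by
    have h1 := hrs.div hden hden0
    have e : -(M.disc E₀ * M.normSq₁ E₀) / (-(M.disc E₀ * M.normSq₁ E₀) * M.normSq₂ E₀ -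
        M.disc E₀ * M.normSq₂ E₀ * M.normSq₁ E₀) = 1 / (2 * M.normSq₂ E₀) := by
      rw [div_eq_div_iff hden0 (by positivity)]
      ring
    rw [e] at h1
    refine h1.congr' ?_
    filter_upwards [self_mem_nhdsWithin, hne] with k hk hk'
    have hs : M.band j k - E₀ ≠ 0 := sub_ne_zero.2 hk'
    have hd' := h.dDisc_ne_zero hM hk
    simp only [Function.comp_apply, Pi.div_apply]
    rw [hden' k, h.coeff₂_sq hM hk, slope_def_field, hr, sub_zero]
    field_simp
  have hb : Tendsto (M.coeff₂ j) (𝓝[Ioo 0 Real.pi] k₀) (𝓝 √(1 / (2 * M.normSq₂ E₀))) := by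
    refine tendsto_of_sq_of_nonneg t2 (Eventually.of_forall fun _ => rfl) ?_
    filter_upwards [self_mem_nhdsWithin] with k hk using coeff₂_nonneg j hk
  -- The sign of `coeff₁` is that of `upper`, which vanishes to first order at `E₀`; a monotone band
  -- stays on one side of `E₀`, so this sign is eventually constant.
  have hsign : (∀ᶠ k in 𝓝[Ioo 0 Real.pi] k₀, 0 ≤ M.coeff₁ j k) ∨
      ∀ᶠ k in 𝓝[Ioo 0 Real.pi] k₀, M.coeff₁ j k ≤ 0 := by
    have hside : (∀ k ∈ Ioo 0 Real.pi, E₀ < M.band j k) ∨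
        ∀ k ∈ Ioo 0 Real.pi, M.band j k < E₀ := by
      rw [hE₀]
      rcases hk₀ with rfl | rfl <;> rcases h.strictMono_or_strictAnti with hm | hm
      · exact Or.inl fun k hk => hm hmem (Ioo_subset_Icc_self hk) hk.1
      · exact Or.inr fun k hk => hm hmem (Ioo_subset_Icc_self hk) hk.1
      · exact Or.inr fun k hk => hm (Ioo_subset_Icc_self hk) hmem hk.2
      · exact Or.inl fun k hk => hm (Ioo_subset_Icc_self hk) hmem hk.2
    have hpos : ∀ᶠ k in 𝓝[Ioo 0 Real.pi] k₀,
        0 < M.disc E₀ * M.upper (M.band j k) * (M.band j k - E₀) := by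
      refine hE'.eventually (eventually_mul_pos_of_hasDerivAt
        ((hasDerivAt_upper_of_degenerate hM hp).const_mul (M.disc E₀)) (by simp [hp]) ?_)
      rw [← mul_assoc, ← sq, hσ, one_mul]; exact hB
    have hcoeff : ∀ k, (0 ≤ M.upper (M.band j k) → 0 ≤ M.coeff₁ j k) ∧
        (M.upper (M.band j k) ≤ 0 → M.coeff₁ j k ≤ 0) := fun k =>
      ⟨fun h0 => div_nonneg h0 (Real.sqrt_nonneg _),
        fun h0 => div_nonpos_of_nonpos_of_nonneg h0 (Real.sqrt_nonneg _)⟩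
    rcases sq_eq_sq_iff_eq_or_eq_neg.1 (hσ.trans (one_pow 2).symm) with h1 | h1 <;>
      rw [h1] at hpos <;> rcases hside with hs | hs
    · left
      filter_upwards [hpos, self_mem_nhdsWithin] with k h2 hk
      have := hs k hk
      exact (hcoeff k).1 (by nlinarith)
    · right
      filter_upwards [hpos, self_mem_nhdsWithin] with k h2 hk
      have := hs k hk
      exact (hcoeff k).2 (by nlinarith)
    · right
      filter_upwards [hpos, self_mem_nhdsWithin] with k h2 hk
      have := hs k hk
      exact (hcoeff k).2 (by nlinarith)
    · left
      filter_upwards [hpos, self_mem_nhdsWithin] with k h2 hk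
      have := hs k hk
      exact (hcoeff k).1 (by nlinarith)
  have ha : ∃ a, Tendsto (M.coeff₁ j) (𝓝[Ioo 0 Real.pi] k₀) (𝓝 a) := by
    rcases hsign with hs | hs
    · exact ⟨_, tendsto_of_sq_of_nonneg t1 (Eventually.of_forall fun _ => rfl) hs⟩
    · have := tendsto_of_sq_of_nonneg (c := fun k => -M.coeff₁ j k) t1
        (Eventually.of_forall fun _ => neg_sq _) (hs.mono fun k hk => neg_nonneg.2 hk)
      exact ⟨_, by simpa using this.neg⟩
  obtain ⟨a, ha⟩ := ha
  have := nhdsWithin_Ioo_neBot hk₀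
  have ha2 : a ^ 2 = 1 / (2 * M.normSq₁ E₀) := tendsto_nhds_unique (ha.pow 2) t1
  have hlim := h.hasEndpointMode_of_tendsto hM hmem ha hb
  refine ⟨a, _, ⟨hlim, ?_, ?_⟩, ?_⟩
  · have hraw : M.rawMode j k₀ = 0 := by
      rw [h.rawMode_eq hmem, hp, hsin]
      funext x
      simp [modeComb]
    have hrank : Module.finrank ℂ (M.blochSpace k₀ (M.band j k₀)) = 2 := by
      rw [finrank_blochSpace hM, if_pos hdisc, if_pos hd]
    rw [halfMode, if_neg (not_not.2 hraw), if_pos hrank]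
    funext x
    refine Tendsto.limUnder_eq ?_
    -- The limit that defines the mode is taken at every real `x`, hence the compact set is a single
    -- point.
    have hx := (tendstoUniformlyOn_modeComb (M := M) hE ha hb
      (isCompact_singleton (x := x))).tendsto_at (mem_singleton x)
    refine hx.congr' ?_
    filter_upwards [self_mem_nhdsWithin] with k hk
    rw [h.normalize_rawMode (Ioo_subset_Icc_self hk)]
  · have hC : M.crossTerm E₀ = 0 := by
      refine integral_eq_zero_of_odd_of_periodic (fun x => ?_) fun x => ?_
      · rw [hM.1, M.even_y₁ hM, M.odd_y₂ hM]; ring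
      · have e1 := (M.y₁_add_one E₀ x).1
        have e2 := (M.y₂_add_one E₀ x).1
        rw [w₂_one hM] at e2
        change M.y₁ E₀ (x + 1) = M.disc E₀ * _ + M.lower E₀ * _ at e1
        change M.y₂ E₀ (x + 1) = M.upper E₀ * _ + M.disc E₀ * _ at e2
        rw [M.ε_periodic, e1, e2, hp, hr]
        linear_combination (M.ε x * M.y₁ E₀ x * M.y₂ E₀ x) * hσ
    rw [hC, mul_zero]
  · rw [ha2, Real.sq_sqrt (by positivity)]
    field_simp

end IsRegularBand

end PhotonicMedium

/-! ### The Zak phase from the overlaps at the end points. -/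

namespace PhotonicMedium

variable {M : PhotonicMedium} {j : ℕ}

theorem blochMode_of_nonneg {k : ℝ} (hk : 0 ≤ k) : M.blochMode j k = M.halfMode j k := if_pos hk

theorem HasEndpointMode.tendstoUniformlyOn_blochMode {k₀ a b : ℝ}
    (h : M.HasEndpointMode j k₀ a b) (hk₀ : 0 ≤ k₀) :
    TendstoUniformlyOn (M.blochMode j) (M.blochMode j k₀) (𝓝[Ioo 0 Real.pi] k₀) (Icc 0 1) := by
  rw [blochMode_of_nonneg hk₀, h.eq]
  refine (h.tendsto.mono (Icc_subset_Icc_left (by norm_num))).congr ?_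
  filter_upwards [self_mem_nhdsWithin] with k hk x _
  rw [blochMode_of_nonneg hk.1.le]

theorem HasEndpointMode.tendstoUniformlyOn_blochMode_neg {k₀ a b : ℝ}
    (h : M.HasEndpointMode j k₀ a b) {l : Filter ℝ}
    (hl : Tendsto (fun k => -k) l (𝓝[Ioo 0 Real.pi] k₀)) :
    TendstoUniformlyOn (M.blochMode j) (fun x => M.modeComb (M.band j k₀) a b (-x)) l
      (Icc 0 1) := by
  intro u hu
  filter_upwards [hl.eventually (h.tendsto u hu), hl.eventually self_mem_nhdsWithin] with k h1 h2 x hx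
  have hk : ¬ 0 ≤ k := fun h' => by linarith [h2.1]
  rw [blochMode, if_neg hk]
  exact h1 (-x) ⟨by linarith [hx.2], by linarith [hx.1]⟩

/-- Reflection changes the sign of `b`; the mixed terms are multiples of `a b` times `crossTerm` and
vanish. -/
theorem HasEndpointMode.cellInner_reflection (hM : M.InversionSymmetric) {k₀ a b : ℝ}
    (h : M.HasEndpointMode j k₀ a b) :
    M.cellInner (M.modeComb (M.band j k₀) a b) (fun x => M.modeComb (M.band j k₀) a b (-x)) =
      ((a ^ 2 * M.normSq₁ (M.band j k₀) - b ^ 2 * M.normSq₂ (M.band j k₀) : ℝ) : ℂ) ∧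
    M.cellInner (fun x => M.modeComb (M.band j k₀) a b (-x)) (M.modeComb (M.band j k₀) a b) =
      ((a ^ 2 * M.normSq₁ (M.band j k₀) - b ^ 2 * M.normSq₂ (M.band j k₀) : ℝ) : ℂ) := by
  have e : (fun x => M.modeComb (M.band j k₀) a b (-x)) = M.modeComb (M.band j k₀) a (-b) :=
    funext fun x => modeComb_neg hM _ a b x
  have hc := h.cross
  have c1 : (b * a - a * -b) * M.crossTerm (M.band j k₀) = 0 := by linear_combination 2 * hc
  have c2 : (-b * a - a * b) * M.crossTerm (M.band j k₀) = 0 := by linear_combination -2 * hc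
  constructor
  · rw [e, cellInner_modeComb, c1, Complex.ofReal_zero, mul_zero, add_zero]
    congr 1
    ring
  · rw [e, cellInner_modeComb, c2, Complex.ofReal_zero, mul_zero, add_zero]
    congr 1
    ring

/-- Both Berry integrals vanish, the end points being negligible, and only the phases of the two
overlaps remain. -/
theorem IsRegularBand.hasZakPhase (hM : M.InversionSymmetric) (h : M.IsRegularBand j)
    {a₀ b₀ a₁ b₁ : ℝ} (h₀ : M.HasEndpointMode j 0 a₀ b₀)
    (h₁ : M.HasEndpointMode j Real.pi a₁ b₁) {t₀ t₁ : ℝ}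
    (ht₀ : ((a₀ ^ 2 * M.normSq₁ (M.band j 0) - b₀ ^ 2 * M.normSq₂ (M.band j 0) : ℝ) : ℂ).arg = t₀)
    (ht₁ : ((a₁ ^ 2 * M.normSq₁ (M.band j Real.pi) -
      b₁ ^ 2 * M.normSq₂ (M.band j Real.pi) : ℝ) : ℂ).arg = t₁) :
    M.HasZakPhase j ((-t₀ - t₁ : ℝ) : Real.Angle) := by
  have hpi := Real.pi_pos
  have hneg : ∀ k ∈ Ioo (-Real.pi) 0, M.berryConnection j k = 0 := fun k hk =>
    h.berryConnection_eq_zero hM (Or.inl hk)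
  have hpos : ∀ k ∈ Ioo 0 Real.pi, M.berryConnection j k = 0 := fun k hk =>
    h.berryConnection_eq_zero hM (Or.inr hk)
  have i1 : ∫ k in (-Real.pi)..0, M.berryConnection j k = 0 := by
    rw [intervalIntegral.integral_of_le (by linarith), MeasureTheory.integral_Ioc_eq_integral_Ioo]
    exact MeasureTheory.setIntegral_eq_zero_of_forall_eq_zero hneg
  have i2 : ∫ k in (0 : ℝ)..Real.pi, M.berryConnection j k = 0 := by
    rw [intervalIntegral.integral_of_le hpi.le, MeasureTheory.integral_Ioc_eq_integral_Ioo]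
    exact MeasureTheory.setIntegral_eq_zero_of_forall_eq_zero hpos
  have n0 : 𝓝[Ioo 0 Real.pi] (0 : ℝ) = 𝓝[>] 0 := nhdsWithin_Ioo_eq_nhdsGT hpi
  have n1 : 𝓝[Ioo 0 Real.pi] Real.pi = 𝓝[<] Real.pi := nhdsWithin_Ioo_eq_nhdsLT hpi
  have l0 : Tendsto (fun k : ℝ => -k) (𝓝[<] 0) (𝓝[Ioo 0 Real.pi] 0) := by
    rw [n0]
    simpa using tendsto_neg_nhdsLT (a := (0 : ℝ))
  have l1 : Tendsto (fun k : ℝ => -k) (𝓝[>] (-Real.pi)) (𝓝[Ioo 0 Real.pi] Real.pi) := by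
    rw [n1]
    simpa using tendsto_neg_nhdsGT (a := -Real.pi)
  refine ⟨_, _, -t₀ - t₁, fun k hk => ⟨h.differentiableAt_periodicPart hM hk,
    h.intervalIntegrable_berryDensity_union hM hk⟩, ?_, ?_, ?_, ?_,
    h₀.tendstoUniformlyOn_blochMode_neg l0, h₁.tendstoUniformlyOn_blochMode_neg l1, ?_, rfl⟩
  · rw [intervalIntegrable_iff_integrableOn_Ioo_of_le (by linarith)]
    exact MeasureTheory.integrableOn_zero.congr_fun (fun k hk => (hneg k hk).symm)
      measurableSet_Ioo
  · rw [intervalIntegrable_iff_integrableOn_Ioo_of_le hpi.le]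
    exact MeasureTheory.integrableOn_zero.congr_fun (fun k hk => (hpos k hk).symm)
      measurableSet_Ioo
  · rw [← n0]; exact h₀.tendstoUniformlyOn_blochMode le_rfl
  · rw [← n1]; exact h₁.tendstoUniformlyOn_blochMode hpi.le
  · rw [i1, i2, blochMode_of_nonneg le_rfl, blochMode_of_nonneg hpi.le, h₀.eq, h₁.eq,
      (h₀.cellInner_reflection hM).1, (h₁.cellInner_reflection hM).2, ht₀, ht₁]
    push_cast
    ring

/-- The Bloch mode at a simple end point of `[0, π]` is even and the overlap with its reflection
is positive, or it is odd and the overlap is negative. -/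
theorem IsRegularBand.exists_simple_endpoint (hM : M.InversionSymmetric) (h : M.IsRegularBand j)
    {k₀ : ℝ} (hk₀ : k₀ = 0 ∨ k₀ = Real.pi) (hd : M.dDisc (M.band j k₀) ≠ 0) :
    ∃ a b t : ℝ, M.HasEndpointMode j k₀ a b ∧
      ((a ^ 2 * M.normSq₁ (M.band j k₀) - b ^ 2 * M.normSq₂ (M.band j k₀) : ℝ) : ℂ).arg = t ∧
      ((Function.Even (M.blochMode j k₀) ∧ ¬ Function.Odd (M.blochMode j k₀) ∧ t = 0) ∨
        (Function.Odd (M.blochMode j k₀) ∧ ¬ Function.Even (M.blochMode j k₀) ∧ t = Real.pi)) := by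
  have hk : 0 ≤ k₀ := (mem_Icc_of_endpoint hk₀).1
  rw [blochMode_of_nonneg hk]
  by_cases hp : M.upper (M.band j k₀) = 0
  · obtain ⟨b, hb, hb1⟩ := h.exists_hasEndpointMode_of_upper_eq_zero hM hk₀ hd hp
    refine ⟨0, b, Real.pi, hb, ?_, Or.inr ⟨?_, ?_, rfl⟩⟩
    · rw [hb1]
      norm_num
    · intro x
      rw [hb.eq, modeComb_neg hM]
      simp [modeComb]
    · intro heven
      obtain ⟨δ, hδ, hpos⟩ := M.y₂_pos_near_zero (M.band j k₀)
      have h1 := heven (δ / 2)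
      rw [hb.eq, modeComb_neg hM] at h1
      have hy := (hpos (δ / 2) ⟨by linarith, by linarith⟩).ne'
      have hb0 : b ≠ 0 := fun h0 => by rw [h0] at hb1; norm_num at hb1
      have h2 := congrArg Complex.im h1
      simp only [modeComb, Complex.add_im, Complex.ofReal_im, Complex.I_mul_im,
        Complex.ofReal_re, zero_add] at h2
      exact mul_ne_zero hb0 hy (by linarith)
  · obtain ⟨a, ha, ha1⟩ := h.exists_hasEndpointMode_of_upper_ne_zero hM hk₀ hp
    refine ⟨a, 0, 0, ha, ?_, Or.inl ⟨?_, ?_, rfl⟩⟩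
    · rw [ha1]
      norm_num
    · intro x
      rw [ha.eq, modeComb_neg hM, neg_zero]
    · intro hodd
      have h1 := hodd 0
      have ha0 : a ≠ 0 := fun h0 => by rw [h0] at ha1; norm_num at ha1
      rw [ha.eq] at h1
      have h2 := congrArg Complex.re h1
      simp [modeComb] at h2
      exact ha0 (by linarith)

/-- The Zak phase of a band that is degenerate at one end of `[0, π]` and simple at the other one
is determined by the parity of the Bloch mode at the simple end. -/
theorem IsRegularBand.exists_hasZakPhase (hM : M.InversionSymmetric) (h : M.IsRegularBand j)
    {k₀ k₁ : ℝ} (hk : (k₀ = 0 ∧ k₁ = Real.pi) ∨ (k₀ = Real.pi ∧ k₁ = 0))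
    (h₀ : M.dDisc (M.band j k₀) = 0) (h₁ : M.dDisc (M.band j k₁) ≠ 0) :
    ∃ θ : Real.Angle, M.HasZakPhase j θ ∧
      ((Function.Even (M.blochMode j k₁) ∧ ¬ Function.Odd (M.blochMode j k₁) ∧ θ = 0) ∨
        (Function.Odd (M.blochMode j k₁) ∧ ¬ Function.Even (M.blochMode j k₁) ∧
          θ = (Real.pi : Real.Angle))) := by
  obtain ⟨a, b, hm, hab⟩ := h.exists_hasEndpointMode_of_degenerate hM (hk.imp And.left And.left) h₀
  -- Equal contributions make the overlap vanish, and `arg 0 = 0` then gives no phase.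
  have harg : ((a ^ 2 * M.normSq₁ (M.band j k₀) -
      b ^ 2 * M.normSq₂ (M.band j k₀) : ℝ) : ℂ).arg = 0 := by
    rw [hab, sub_self, Complex.ofReal_zero, Complex.arg_zero]
  obtain ⟨a', b', t, hm', harg', hpar⟩ :=
    h.exists_simple_endpoint hM (hk.symm.imp And.right And.right) h₁
  -- The sign is harmless, since `-π = π` modulo `2π`.
  refine ⟨((-t : ℝ) : Real.Angle), ?_, ?_⟩
  · rcases hk with ⟨rfl, rfl⟩ | ⟨rfl, rfl⟩
    · simpa using h.hasZakPhase hM hm hm' harg harg'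
    · simpa using h.hasZakPhase hM hm' hm harg' harg
  · refine hpar.imp ?_ ?_
    · rintro ⟨h1, h2, rfl⟩
      exact ⟨h1, h2, by simp⟩
    · rintro ⟨h1, h2, rfl⟩
      exact ⟨h1, h2, by simp⟩

theorem zakPhase_sum (hM : M.InversionSymmetric) (hj : 1 ≤ j)
    (hcross : ∀ m, 1 ≤ m → m ≠ j → m ≠ j + 1 → ∀ k ∈ Icc (-Real.pi) Real.pi,
      M.band m k ≠ M.band j k ∧ M.band m k ≠ M.band (j + 1) k) {k₀ k₁ E₀ : ℝ}
    (hk : (k₀ = 0 ∧ k₁ = Real.pi) ∨ (k₀ = Real.pi ∧ k₁ = 0)) (hD : M.IsDiracPoint j k₀ E₀) :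
    ∃ θ θ' : Real.Angle, M.HasZakPhase j θ ∧ M.HasZakPhase (j + 1) θ' ∧
      (SameParity (M.blochMode j k₁) (M.blochMode (j + 1) k₁) ∨
        DifferentParity (M.blochMode j k₁) (M.blochMode (j + 1) k₁)) ∧
      (SameParity (M.blochMode j k₁) (M.blochMode (j + 1) k₁) → θ + θ' = 0) ∧
      (DifferentParity (M.blochMode j k₁) (M.blochMode (j + 1) k₁) →
        θ + θ' = (Real.pi : Real.Angle)) := by
  obtain ⟨r0, r1, r2⟩ := hD.regular hM hj hcross hk j (Or.inl rfl)
  obtain ⟨s0, s1, s2⟩ := hD.regular hM hj hcross hk (j + 1) (Or.inr rfl)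
  obtain ⟨θ, hθ, hp⟩ := r0.exists_hasZakPhase hM hk r1 r2
  obtain ⟨θ', hθ', hp'⟩ := s0.exists_hasZakPhase hM hk s1 s2
  refine ⟨θ, θ', hθ, hθ', ?_⟩
  -- Each mode has exactly one parity, so the negated parities rule out the other alternative. Two
  -- odd modes give `π + π = 0` modulo `2π`.
  rcases hp with ⟨p1, p2, rfl⟩ | ⟨p1, p2, rfl⟩ <;> rcases hp' with ⟨q1, q2, rfl⟩ | ⟨q1, q2, rfl⟩
  · exact ⟨Or.inl (Or.inl ⟨p1, q1⟩), fun _ => add_zero 0, fun hd => hd.elim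
      (fun hd => absurd hd.2 q2) fun hd => absurd hd.1 p2⟩
  · exact ⟨Or.inr (Or.inl ⟨p1, q1⟩), fun hs => hs.elim
      (fun hs => absurd hs.2 q2) fun hs => absurd hs.1 p2, fun _ => zero_add _⟩
  · exact ⟨Or.inr (Or.inr ⟨p1, q1⟩), fun hs => hs.elim
      (fun hs => absurd hs.1 p2) fun hs => absurd hs.2 q2, fun _ => add_zero _⟩
  · exact ⟨Or.inl (Or.inr ⟨p1, q1⟩), fun _ => by simp, fun hd => hd.elim
      (fun hd => absurd hd.1 p2) fun hd => absurd hd.2 q2⟩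

end PhotonicMedium

theorem mainTheorem10 (M : PhotonicMedium) (hinv : M.InversionSymmetric) (j : ℕ) (hj : 1 ≤ j)
    (E₀ : ℝ)
    (hcross : ∀ m, 1 ≤ m → m ≠ j → m ≠ j + 1 → ∀ k ∈ Icc (-Real.pi) Real.pi,
      M.band m k ≠ M.band j k ∧ M.band m k ≠ M.band (j + 1) k) :
    (M.IsDiracPoint j 0 E₀ →
      ∃ θ θ' : Real.Angle, M.HasZakPhase j θ ∧ M.HasZakPhase (j + 1) θ' ∧
        (SameParity (M.blochMode j Real.pi) (M.blochMode (j + 1) Real.pi) ∨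
          DifferentParity (M.blochMode j Real.pi) (M.blochMode (j + 1) Real.pi)) ∧
        (SameParity (M.blochMode j Real.pi) (M.blochMode (j + 1) Real.pi) → θ + θ' = 0) ∧
        (DifferentParity (M.blochMode j Real.pi) (M.blochMode (j + 1) Real.pi) →
          θ + θ' = (Real.pi : Real.Angle))) ∧
    (M.IsDiracPoint j Real.pi E₀ →
      ∃ θ θ' : Real.Angle, M.HasZakPhase j θ ∧ M.HasZakPhase (j + 1) θ' ∧
        (SameParity (M.blochMode j 0) (M.blochMode (j + 1) 0) ∨
          DifferentParity (M.blochMode j 0) (M.blochMode (j + 1) 0)) ∧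
        (SameParity (M.blochMode j 0) (M.blochMode (j + 1) 0) → θ + θ' = 0) ∧
        (DifferentParity (M.blochMode j 0) (M.blochMode (j + 1) 0) →
          θ + θ' = (Real.pi : Real.Angle))) := by
  exact ⟨fun hD => PhotonicMedium.zakPhase_sum hinv hj hcross (Or.inl ⟨rfl, rfl⟩) hD,
    fun hD => PhotonicMedium.zakPhase_sum hinv hj hcross (Or.inr ⟨rfl, rfl⟩) hD⟩
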